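/- **Setting.** All logarithms are to the base $2$. For $\phi,\psi\in[0,1]$ let $H_b(\phi,\psi)=-\phi\log\psi-(1-\phi)\log(1-\psi)\in[0,\infty]$ be the binary cross entropy (with $0\cdot\infty=0$). Let $\mathcal S,\mathcal Y$ be finite sets, $P_S$ a distribution on $\mathcal S$, $P_{Y|S,X}$ a channel from $\mathcal S\times\mathbb F_2$ to $\mathcal Y$, $0<R<1$, $p_e:\mathcal S\to[0,1]$, $p_d:\mathcal Y\to[0,1]$, and let $P_Q$ be a distribution on $[0,1]$ with finite support that is symmetric about $1/2$ (if $Q\sim P_Q$ then $1-Q\sim P_Q$). **The weighted parity-check code with state.** Let $n\ge 1$ and $k=\lfloor nR\rfloor$. For $\mathbf q\in[0,1]^n$ and $\mathbf u\in\mathbb F_2^n$ put $w_{\mathbf q}(\mathbf u)=\prod_{i=1}^n q_i^{u_i}(1-q_i)^{1-u_i}$. For an invertible $\mathbf H\in\mathbb F_2^{n\times n}$ and $\mathbf p,\mathbf q\in[0,1]^n$ let $$f_{\mathbf H}(\mathbf p,\mathbf q)=\operatorname{argmax}_{\mathbf x\in\mathbb F_2^n} w_{\mathbf p}(\mathbf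 x)\,w_{\mathbf q}(\mathbf x\mathbf H^T),$$ where ties are broken by a fixed, arbitrary rule that depends only on the set of maximizers. Let the message $\mathbf m$ be uniform on $\mathbb F_2^k$, $\mathbf s=(s_1,\dots,s_n)$ i.i.d. $\sim P_S$, $\mathbf q=(q_1,\dots,q_{n-k})$ i.i.d. $\sim P_Q$, and $\mathbf H$ uniform over the invertible matrices in $\mathbb F_2^{n\times n}$, all independent. The encoder sends $\mathbf x=f_{\mathbf H}([p_e(s_1),\dots,p_e(s_n)],[\mathbf m,\mathbf q])$; given $(\mathbf m,\mathbf s,\mathbf q,\mathbf H)$, the outputs $y_i\sim P_{Y|S,X}(\cdot|s_i,x_i)$ are independent; the decoder computes $\hat{\mathbf x}=f_{\mathbf H}([p_d(y_1),\dots,p_d(y_n)],[\tfrac12,\dots,\tfrac12,\mathbf q])$ with $k$ entries $\tfrac12$, and outputs $\hat{\mathbf m}$, the first $k$ bits of $\hat{\mathbf x}\mathbf H^T$. **Nondegeneracy** (automatic if $p_e$, $p_d$ and $Q$ take values in $(0,1)$). 1. $P(0<p_e(S)<1)=1$, or $P(0<p_e(S)<1)+(1-R)P(0<Q<1)>1$.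 2. If $P_S(s)>0$, $H_b(x,p_e(s))<\infty$ and $P_{Y|S,X}(y|s,x)>0$, then $H_b(x,p_d(y))<\infty$. **Theorem.** Suppose that $(P_{X|S},P_{V|Q})$, with $X,V\in\{0,1\}$, is the unique minimizer of $$\mathbf E[H_b(X,p_e(S))]+(1-R)\,\mathbf E[H_b(V,Q)]$$ subject to $H(X|S)+(1-R)H(V|Q)\ge 1$, where $S\sim P_S$, $X|S\sim P_{X|S}$, $Q\sim P_Q$, $V|Q\sim P_{V|Q}$ (uniqueness is meant at the values of $S$ and $Q$ of positive probability). Let $Y|(S,X)\sim P_{Y|S,X}$, and suppose that for all conditional distributions $P_{\tilde X|Y},P_{\tilde V|Q}$ on $\{0,1\}$ with $H(\tilde X|Y)+(1-R)H(\tilde V|Q)\ge 1-R$, $$\mathbf E[H_b(\tilde X,p_d(Y))]+(1-R)\,\mathbf E[H_b(\tilde V,Q)]>\mathbf E[H_b(X,p_d(Y))]+(1-R)\,\mathbf E[H_b(V,Q)].$$ Then, as $n\to\infty$, $\mathbf P(\hat{\mathbf m}\ne\mathbf m)\to0$, and the empirical joint distribution of $(s_i,x_i)_{i=1,\dots,n}$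 tends to $P_SP_{X|S}$ in probability. -/

import Mathlib

open scoped ENNReal Matrix unitInterval Topology

namespace WPC

noncomputable section

/-! ### Information quantities, all to the base `2` and valued in `[0, ∞]` -/

/-- `-log₂ t` for `t ∈ [0,1]`, with the value `∞` at `t = 0`. -/
def negLog (t : I) : ℝ≥0∞ :=
  if t = 0 then ⊤ else ENNReal.ofReal (-Real.logb 2 (t : ℝ))

/-- The binary cross entropy `H_b(φ, ψ) = -φ log ψ - (1 - φ) log (1 - ψ)`, with `0 · ∞ = 0`. -/
def crossEntropy (φ ψ : I) : ℝ≥0∞ :=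
  ENNReal.ofReal (φ : ℝ) * negLog ψ + ENNReal.ofReal (1 - (φ : ℝ)) * negLog (σ ψ)

/-- A bit, seen as the number `0` or `1`. -/
def bit (b : ZMod 2) : I := if b = 1 then 1 else 0

/-- The Shannon entropy of a distribution on a finite alphabet. -/
def entropy {β : Type*} [Fintype β] (P : PMF β) : ℝ≥0∞ :=
  ∑ b, ENNReal.ofReal (Real.negMulLog (P b).toReal / Real.log 2)

/-- The expectation of a nonnegative function under a discrete distribution. -/
def expect {α : Type*} (P : PMF α) (f : α → ℝ≥0∞) : ℝ≥0∞ := ∑' a, P a * f a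

/-- The conditional entropy `H(B|A)`, where `A ∼ P` and `B|A ∼ W`. -/
def condEntropy {α β : Type*} [Fintype β] (P : PMF α) (W : α → PMF β) : ℝ≥0∞ :=
  expect P fun a => entropy (W a)

/-- The expected cross entropy `E[H_b(B, p(A))]`, where `A ∼ P` and `B|A ∼ W`. -/
def expCrossEntropy {α : Type*} (P : PMF α) (W : α → PMF (ZMod 2)) (p : α → I) : ℝ≥0∞ :=
  expect P fun a => expect (W a) fun b => crossEntropy (bit b) (p a)

/-! ### Product distributions -/

/-- The law of independent random variables `A_i ∼ P i`, for `i : Fin n`. -/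
def prodPMF {α : Type*} : {n : ℕ} → (Fin n → PMF α) → PMF (Fin n → α)
  | 0, _ => PMF.pure Fin.elim0
  | _ + 1, P => (P 0).bind fun a => (prodPMF fun i => P i.succ).map (Fin.cons a)

theorem prodPMF_apply {α : Type*} {n : ℕ} (P : Fin n → PMF α) (f : Fin n → α) :
    prodPMF P f = ∏ i, P i (f i) := by
  classical
  induction n with
  | zero =>
    have : f = Fin.elim0 := Subsingleton.elim _ _
    simp [prodPMF, this]
  | succ n ih =>
    rw [prodPMF, PMF.bind_apply, tsum_eq_single (f 0), PMF.map_apply,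
      tsum_eq_single (Fin.tail f), ih, Fin.prod_univ_succ]
    · simp [Fin.tail]
    · intro g hg
      rw [if_neg]
      intro h
      exact hg (by rw [h, Fin.tail_cons])
    · intro a ha
      rw [PMF.map_apply, ENNReal.tsum_eq_zero.2, mul_zero]
      intro g
      rw [if_neg]
      intro h
      exact ha (by rw [h, Fin.cons_zero])

/-! ### The weighted parity-check code -/

/-- The `q`-weight of `u`: the probability of `u` when its entries are independent `Bern(q i)`. -/
def weight {n : ℕ} (q : Fin n → I) (u : Fin n → ZMod 2) : ℝ :=
  ∏ i, if u i = 1 then (q i : ℝ) else 1 - (q i : ℝ)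

open Classical in
/-- The set of maximizers `x` of `w_p(x) w_q(x Hᵀ)`. -/
def maximizers {n : ℕ} (H : GL (Fin n) (ZMod 2)) (p q : Fin n → I) : Finset (Fin n → ZMod 2) :=
  Finset.univ.filter fun x => ∀ x' : Fin n → ZMod 2,
    weight p x' * weight q (x' ᵥ* (H : Matrix (Fin n) (Fin n) (ZMod 2))ᵀ) ≤
      weight p x * weight q (x ᵥ* (H : Matrix (Fin n) (Fin n) (ZMod 2))ᵀ)

/-- A tie-breaking rule: it selects an element of every nonempty set of vectors. -/
structure TieBreak where
  pick : {n : ℕ} → Finset (Fin n → ZMod 2) → (Fin n → ZMod 2)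
  pick_mem : ∀ {n : ℕ} (A : Finset (Fin n → ZMod 2)), A.Nonempty → pick A ∈ A

/-- The query function `f_H(p, q) = argmax_x w_p(x) w_q(x Hᵀ)`; ties are broken by `τ`. -/
def query (τ : TieBreak) {n : ℕ} (H : GL (Fin n) (ZMod 2)) (p q : Fin n → I) :
    Fin n → ZMod 2 :=
  τ.pick (maximizers H p q)

/-- The constant bias `1/2`. -/
def half : I := ⟨1 / 2, by norm_num, by norm_num⟩

variable {S Y : Type*}

/-- The encoder: codeword bias `[p_e(s_1), …, p_e(s_n)]` and parity bias `[m, q]`.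
The message has length `k`, there are `r` parity bits, and the blocklength is `n = k + r`. -/
def encode (τ : TieBreak) (pe : S → I) {k r : ℕ} (H : GL (Fin (k + r)) (ZMod 2))
    (q : Fin r → I) (m : Fin k → ZMod 2) (s : Fin (k + r) → S) : Fin (k + r) → ZMod 2 :=
  query τ H (fun i => pe (s i)) (Fin.append (fun i => bit (m i)) q)

/-- The decoder: codeword bias `[p_d(y_1), …, p_d(y_n)]` and parity bias `[1/2, …, 1/2, q]`;
it outputs the first `k` bits of `x̂ Hᵀ`. -/
def decode (τ : TieBreak) (pd : Y → I) {k r : ℕ} (H : GL (Fin (k + r)) (ZMod 2))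
    (q : Fin r → I) (y : Fin (k + r) → Y) : Fin k → ZMod 2 :=
  fun i => (query τ H (fun j => pd (y j)) (Fin.append (fun _ => half) q) ᵥ*
    (H : Matrix (Fin (k + r)) (Fin (k + r)) (ZMod 2))ᵀ) (Fin.castAdd r i)

/-- What happens in one use of the code. -/
structure Run (S Y : Type*) (k r : ℕ) where
  message : Fin k → ZMod 2
  state : Fin (k + r) → S
  parityBias : Fin r → I
  matrix : GL (Fin (k + r)) (ZMod 2)
  codeword : Fin (k + r) → ZMod 2
  output : Fin (k + r) → Y

/-- The joint law of one use of the code. The message is uniform, the states are i.i.d. `P_S`, the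
parity biases are i.i.d. `P_Q`, the full-rank matrix is uniform, all four are independent, and the
codeword is sent through the memoryless channel `P_{Y|S,X}`. -/
def runLaw (τ : TieBreak) (PS : PMF S) (PY : S → ZMod 2 → PMF Y) (pe : S → I) (PQ : PMF I)
    (k r : ℕ) : PMF (Run S Y k r) :=
  (PMF.uniformOfFintype (Fin k → ZMod 2)).bind fun m =>
  (prodPMF fun _ : Fin (k + r) => PS).bind fun s =>
  (prodPMF fun _ : Fin r => PQ).bind fun q =>
  (PMF.uniformOfFintype (GL (Fin (k + r)) (ZMod 2))).bind fun H =>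
  (prodPMF fun i => PY (s i) (encode τ pe H q m s i)).map fun y =>
    { message := m, state := s, parityBias := q, matrix := H,
      codeword := encode τ pe H q m s, output := y }

/-- The probability that the decoded message differs from the message. -/
def errorProb (τ : TieBreak) (PS : PMF S) (PY : S → ZMod 2 → PMF Y) (pe : S → I) (pd : Y → I)
    (PQ : PMF I) (k r : ℕ) : ℝ≥0∞ :=
  (runLaw τ PS PY pe PQ k r).toOuterMeasure
    {ω | decode τ pd ω.matrix ω.parityBias ω.output ≠ ω.message}

open Classical in
/-- The empirical joint distribution of the pairs `(s_i, x_i)`. -/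
def empirical {n : ℕ} (s : Fin n → S) (x : Fin n → ZMod 2) (a : S) (b : ZMod 2) : ℝ :=
  ((Finset.univ.filter fun i => s i = a ∧ x i = b).card : ℝ) / n

/-- The probability that the empirical distribution of `(s_i, x_i)` is at least `ε` away
from `P_S P_{X|S}` at some pair. -/
def deviationProb (τ : TieBreak) (PS : PMF S) (PY : S → ZMod 2 → PMF Y) (pe : S → I)
    (PQ : PMF I) (W : S → PMF (ZMod 2)) (ε : ℝ) (k r : ℕ) : ℝ≥0∞ :=
  (runLaw τ PS PY pe PQ k r).toOuterMeasure
    {ω | ∃ (a : S) (b : ZMod 2),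
      ε ≤ |empirical ω.state ω.codeword a b - (PS a * W a b).toReal|}

/-! ### The optimization problem of the encoder and the condition for the decoder -/

/-- The objective `E[H_b(X, p_e(S))] + (1 - R) E[H_b(V, Q)]`. -/
def encCost (R : ℝ) (PS : PMF S) (pe : S → I) (PQ : PMF I) (W : S → PMF (ZMod 2))
    (U : I → PMF (ZMod 2)) : ℝ≥0∞ :=
  expCrossEntropy PS W pe + ENNReal.ofReal (1 - R) * expCrossEntropy PQ U id

/-- The constraint `H(X|S) + (1 - R) H(V|Q) ≥ 1`. -/
def EncFeasible (R : ℝ) (PS : PMF S) (PQ : PMF I) (W : S → PMF (ZMod 2))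
    (U : I → PMF (ZMod 2)) : Prop :=
  1 ≤ condEntropy PS W + ENNReal.ofReal (1 - R) * condEntropy PQ U

/-- `(P_{X|S}, P_{V|Q}) = (W, U)` is a minimizer of the objective subject to the constraint. -/
def IsMinimizer (R : ℝ) (PS : PMF S) (pe : S → I) (PQ : PMF I) (W : S → PMF (ZMod 2))
    (U : I → PMF (ZMod 2)) : Prop :=
  EncFeasible R PS PQ W U ∧
    ∀ W' U', EncFeasible R PS PQ W' U' → encCost R PS pe PQ W U ≤ encCost R PS pe PQ W' U'

/-- `(W, U)` is the unique minimizer; conditional distributions are identified when they agree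
at all values of the conditioning variable that have positive probability. -/
def IsUniqueMinimizer (R : ℝ) (PS : PMF S) (pe : S → I) (PQ : PMF I) (W : S → PMF (ZMod 2))
    (U : I → PMF (ZMod 2)) : Prop :=
  IsMinimizer R PS pe PQ W U ∧
    ∀ W' U', IsMinimizer R PS pe PQ W' U' →
      (∀ a ∈ PS.support, W' a = W a) ∧ (∀ t ∈ PQ.support, U' t = U t)

/-- The joint law of `(X, Y)` when `S ∼ P_S`, `X|S ∼ W` and `Y|(S,X) ∼ P_{Y|S,X}`. -/
def lawXY (PS : PMF S) (W : S → PMF (ZMod 2)) (PY : S → ZMod 2 → PMF Y) : PMF (ZMod 2 × Y) :=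
  PS.bind fun a => (W a).bind fun b => (PY a b).map fun y => (b, y)

/-- The strict decoder inequality: whenever `H(X̃|Y) + (1 - R) H(Ṽ|Q) ≥ 1 - R`,
`E[H_b(X̃, p_d(Y))] + (1-R) E[H_b(Ṽ, Q)] > E[H_b(X, p_d(Y))] + (1-R) E[H_b(V, Q)]`. -/
def DecoderInequality (R : ℝ) (PS : PMF S) (PY : S → ZMod 2 → PMF Y) (pd : Y → I) (PQ : PMF I)
    (W : S → PMF (ZMod 2)) (U : I → PMF (ZMod 2)) : Prop :=
  ∀ (W' : Y → PMF (ZMod 2)) (U' : I → PMF (ZMod 2)),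
    ENNReal.ofReal (1 - R) ≤
        condEntropy ((lawXY PS W PY).map Prod.snd) W' + ENNReal.ofReal (1 - R) * condEntropy PQ U' →
      expect (lawXY PS W PY) (fun z => crossEntropy (bit z.1) (pd z.2)) +
          ENNReal.ofReal (1 - R) * expCrossEntropy PQ U id <
        expCrossEntropy ((lawXY PS W PY).map Prod.snd) W' pd +
          ENNReal.ofReal (1 - R) * expCrossEntropy PQ U' id

/-! ### Nondegeneracy for biases equal to `0` or `1` (automatic for biases in `(0,1)`) -/

/-- Either no codeword bit is forced by the state, or the bits that are forced neither by the state
nor by the parity biases leave room in the entropy constraint: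
`P(0 < p_e(S) < 1) + (1 - R) P(0 < Q < 1) > 1`. -/
def EncNondegenerate (R : ℝ) (PS : PMF S) (pe : S → I) (PQ : PMF I) : Prop :=
  (∀ a ∈ PS.support, pe a ∈ Set.Ioo (0 : I) 1) ∨
    1 < PS.toOuterMeasure {a | pe a ∈ Set.Ioo (0 : I) 1} +
      ENNReal.ofReal (1 - R) * PQ.toOuterMeasure (Set.Ioo (0 : I) 1)

/-- The decoder never gives weight zero to an input bit `b` with output `y` that can occur
together: `H_b(b, p_d(y)) < ∞` if `P_S(a) > 0`, `H_b(b, p_e(a)) < ∞` and `P_{Y|S,X}(y|a,b) > 0`. -/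
def DecNondegenerate (PS : PMF S) (PY : S → ZMod 2 → PMF Y) (pe : S → I) (pd : Y → I) : Prop :=
  ∀ a ∈ PS.support, ∀ b : ZMod 2, crossEntropy (bit b) (pe a) ≠ ⊤ →
    ∀ y ∈ (PY a b).support, crossEntropy (bit b) (pd y) ≠ ⊤

end

end WPC

/-!
The proof is the method of types for words of length `n + r`, `r = n - k`, that consist of a
codeword and its parity bits: a *letter* is a value of `S` (of `Y`, for the decoder) at a codeword
position and a value of `Q` at a parity position. Up to factors `2 ^ o(n)` the number of words of
a given joint type with the letters is exponential in the conditional entropy, while the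
logarithm of the weight of a word is linear in its type.

For fixed distinct nonzero words, a uniform invertible matrix sends them to a uniform pair of
distinct nonzero words, so the events that they satisfy the parity equations are almost pairwise
independent. There are about `2 ^ n` words per feasible type at the minimum of the encoder's
problem; hence, by Chebyshev's inequality, words with a cost only slightly above the minimum do
satisfy the parity equations, and the nondegeneracy condition lets one raise the entropy a little
at a small cost. By compactness and uniqueness of the minimizer, all words of at most that cost
whose type is not close to `(P_{X|S}, P_{V|Q})` are exponentially fewer than `2 ^ n`, so none of
them satisfies the parity equations. Hence the encoded word is typical.

The decoder's inequality says that the words that look at least as good to the decoder as a typical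
word are exponentially fewer than `2 ^ r`. A union bound over the pairs of a typical word and a
competitor, which uses pairwise independence, shows that no competitor satisfies the decoder's
parity equations. The zero codeword is sent to zero by every matrix and is excluded separately:
since `Q` is symmetric, its cost is that of fair parity bits, which are covered by the decoder's
inequality.
-/

namespace WPC

noncomputable section

/-! ### Letters, types and the averaging bound on the size of a set of binary vectors -/

/-- The probability of the bit `b` under the Bernoulli distribution with parameter `θ`. -/
def bitProb (θ : ℝ) (b : ZMod 2) : ℝ := if b = 1 then θ else 1 - θ

@[simp] theorem bitProb_one (θ : ℝ) : bitProb θ 1 = θ := by simp [bitProb]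

@[simp] theorem bitProb_zero (θ : ℝ) : bitProb θ 0 = 1 - θ := by simp [bitProb]

theorem zmod_two_cases (b : ZMod 2) : b = 0 ∨ b = 1 := by
  revert b; decide

theorem sum_zmod_two {M : Type*} [AddCommMonoid M] (f : ZMod 2 → M) :
    ∑ b, f b = f 0 + f 1 := Fin.sum_univ_two f

theorem bitProb_nonneg {θ : ℝ} (h : θ ∈ Set.Icc (0 : ℝ) 1) (b : ZMod 2) : 0 ≤ bitProb θ b := by
  rcases zmod_two_cases b with rfl | rfl
  · simpa using h.2
  · simpa using h.1

theorem bitProb_le_one {θ : ℝ} (h : θ ∈ Set.Icc (0 : ℝ) 1) (b : ZMod 2) : bitProb θ b ≤ 1 := by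
  rcases zmod_two_cases b with rfl | rfl
  · simpa using h.1
  · simpa using h.2

theorem bitProb_ne_zero {θ : ℝ} (h : θ ∈ Set.Ioo (0 : ℝ) 1) (b : ZMod 2) : bitProb θ b ≠ 0 := by
  rcases zmod_two_cases b with rfl | rfl
  · simpa using (sub_pos.2 h.2).ne'
  · simpa using h.1.ne'

theorem sum_bitProb (θ : ℝ) : ∑ b, bitProb θ b = 1 := by
  simp [sum_zmod_two]

theorem sum_prod_bitProb {ι : Type*} [Fintype ι] [DecidableEq ι] (θ : ι → ℝ) :
    ∑ z : ι → ZMod 2, ∏ i, bitProb (θ i) (z i) = 1 := by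
  simp [← Fintype.prod_sum, sum_bitProb]

section Counting

variable {ι T : Type*} [Fintype ι]

open Classical in
/-- The number of positions that carry the letter `t` in the word `l`. -/
def letterCount (l : ι → T) (t : T) : ℕ := (Finset.univ.filter fun i => l i = t).card

open Classical in
/-- The number of positions that carry the letter `t` in `l` and the bit `b` in `z`; dividing by
the blocklength gives the joint type of `l` and `z`. -/
def bitCount (l : ι → T) (t : T) (b : ZMod 2) (z : ι → ZMod 2) : ℕ :=
  (Finset.univ.filter fun i => l i = t ∧ z i = b).card

/-- The weight of `z` when the bit at a position with letter `t` has bias `p t`. -/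
def letterWeight (p : T → I) (l : ι → T) (z : ι → ZMod 2) : ℝ :=
  ∏ i, bitProb (p (l i)) (z i)

theorem sum_bitCount (l : ι → T) (t : T) (z : ι → ZMod 2) :
    ∑ b, bitCount l t b z = letterCount l t := by
  classical
  rw [letterCount, Finset.card_eq_sum_card_fiberwise (f := z) (t := Finset.univ) (by simp)]
  simp only [bitCount, Finset.filter_filter]

theorem bitCount_le (l : ι → T) (t : T) (b : ZMod 2) (z : ι → ZMod 2) :
    bitCount l t b z ≤ letterCount l t := by
  rw [← sum_bitCount l t z]
  exact Finset.single_le_sum (f := fun b => bitCount l t b z) (fun _ _ => Nat.zero_le _)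
    (Finset.mem_univ b)

theorem sum_comp_letter_bit [Fintype T] (l : ι → T) (z : ι → ZMod 2) (f : T → ZMod 2 → ℝ) :
    ∑ i, f (l i) (z i) = ∑ t, ∑ b, (bitCount l t b z : ℝ) * f t b := by
  classical
  rw [← Finset.sum_fiberwise Finset.univ (fun i => (l i, z i)), Fintype.sum_prod_type]
  refine Finset.sum_congr rfl fun t _ => Finset.sum_congr rfl fun b _ => ?_
  rw [Finset.sum_congr rfl (g := fun _ => f t b) (by simp +contextual)]
  simp [bitCount]

theorem bitCount_pos (l : ι → T) (z : ι → ZMod 2) (i : ι) : 0 < bitCount l (l i) (z i) z := by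
  classical
  exact Finset.card_pos.2 ⟨i, by simp⟩

theorem bitProb_ne_zero_of_letterWeight_ne_zero {p : T → I} {l : ι → T} {z : ι → ZMod 2}
    (h : letterWeight p l z ≠ 0) (i : ι) : bitProb (p (l i)) (z i) ≠ 0 :=
  Finset.prod_ne_zero_iff.1 h i (Finset.mem_univ i)

theorem bitCount_eq_zero_of_bitProb_eq_zero {p : T → I} {l : ι → T} {z : ι → ZMod 2} {t : T}
    {b : ZMod 2} (hb : bitProb (p t) b = 0) (h : letterWeight p l z ≠ 0) :
    bitCount l t b z = 0 := by
  classical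
  refine Finset.card_eq_zero.2 (Finset.filter_eq_empty_iff.2 fun i _ hi => ?_)
  refine bitProb_ne_zero_of_letterWeight_ne_zero h i ?_
  rw [hi.1, hi.2, hb]

end Counting

section Types

variable {T : Type*}

/-- The Bernoulli parameters `w` that only charge bits to which the biases `p` give positive
weight. -/
def compatible (p : T → I) : Set (T → ℝ) :=
  {w | ∀ t, w t ∈ Set.Icc (0 : ℝ) 1 ∧ ∀ b, bitProb (p t) b = 0 → bitProb (w t) b = 0}

/-- The `ν`-weighted sum of the binary entropies of the parameters `w`, in nats. -/
def ent [Fintype T] (ν w : T → ℝ) : ℝ := ∑ t, ν t * Real.binEntropy (w t)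

/-- The expected value of `c` when the letters have weight `ν` and the bits have parameters `w`. -/
def linCost [Fintype T] (c : T → ZMod 2 → ℝ) (ν w : T → ℝ) : ℝ :=
  ∑ t, ν t * ∑ b, bitProb (w t) b * c t b

/-- Every letter `t` occurs in the word `l` about `N * μ t` times. The scale `N` need not be the
length of `l`: a codeword and its parity bits form one word, of length larger than the
blocklength. -/
def LettersTypical {ι : Type*} [Fintype ι] (μ : T → ℝ) (δ : ℝ) (N : ℕ) (l : ι → T) : Prop :=
  ∀ t, |(letterCount l t : ℝ) / N - μ t| ≤ δ

theorem isCompact_compatible (p : T → I) : IsCompact (compatible p) := by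
  have hpi : compatible p = Set.univ.pi fun t =>
      Set.Icc (0 : ℝ) 1 ∩ ⋂ b, ⋂ (_ : bitProb (p t) b = 0), {θ | bitProb θ b = 0} := by
    ext w; simp [compatible, Set.mem_pi]
  have hclosed : ∀ b, IsClosed {θ : ℝ | bitProb θ b = 0} := fun b => by
    refine isClosed_eq ?_ continuous_const
    unfold bitProb
    split_ifs <;> fun_prop
  rw [hpi]
  exact isCompact_univ_pi fun t => isCompact_Icc.inter_right <|
    isClosed_iInter fun b => isClosed_iInter fun _ => hclosed b

variable [Fintype T]

theorem linCost_eq (c : T → ZMod 2 → ℝ) (ν w : T → ℝ) :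
    linCost c ν w = ∑ t, ν t * (w t * c t 1 + (1 - w t) * c t 0) := by
  simp only [linCost, sum_zmod_two, bitProb_zero, bitProb_one, add_comm]

theorem linCost_log_bitProb_self (ν w : T → ℝ) :
    linCost (fun t b => Real.log (bitProb (w t) b)) ν w = -ent ν w := by
  rw [linCost_eq, ent, ← Finset.sum_neg_distrib]
  refine Finset.sum_congr rfl fun t _ => ?_
  simp only [bitProb_zero, bitProb_one, Real.binEntropy, Real.log_inv]
  ring

theorem linCost_div (c : T → ZMod 2 → ℝ) (ν w : T → ℝ) (N : ℝ) :
    linCost c (fun t => ν t / N) w = linCost c ν w / N := by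
  simp only [linCost, div_mul_eq_mul_div, Finset.sum_div]

theorem ent_div (ν w : T → ℝ) (N : ℝ) : ent (fun t => ν t / N) w = ent ν w / N := by
  simp only [ent, div_mul_eq_mul_div, Finset.sum_div]

theorem continuous_ent : Continuous fun x : (T → ℝ) × (T → ℝ) => ent x.1 x.2 := by
  unfold ent; fun_prop

theorem continuous_linCost (c : T → ZMod 2 → ℝ) :
    Continuous fun x : (T → ℝ) × (T → ℝ) => linCost c x.1 x.2 := by
  simp only [linCost_eq]; fun_prop

/-- The compactness of `compatible p` turns a pointwise implication into a uniform one. -/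
theorem exists_entropy_gap {J : Type*} {p : T → I} {μ : T → ℝ} {a : J → T → ZMod 2 → ℝ}
    {b : J → ℝ} {E : ℝ}
    (h : ∀ w ∈ compatible p, (∀ j, linCost (a j) μ w ≤ b j) → ent μ w < E) :
    ∃ δ > 0, ∀ ν : T → ℝ, (∀ t, |ν t - μ t| ≤ δ) → ∀ w ∈ compatible p,
      (∀ j, linCost (a j) ν w ≤ b j + δ) → ent ν w ≤ E - δ := by
  have hcost (j : J) : Continuous fun z : (ℝ × (T → ℝ)) × (T → ℝ) => linCost (a j) z.1.2 z.2 :=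
    (continuous_linCost (a j)).comp (f := fun z : (ℝ × (T → ℝ)) × (T → ℝ) => (z.1.2, z.2))
      (by fun_prop)
  have hent : Continuous fun z : (ℝ × (T → ℝ)) × (T → ℝ) => ent z.1.2 z.2 :=
    continuous_ent.comp (f := fun z : (ℝ × (T → ℝ)) × (T → ℝ) => (z.1.2, z.2)) (by fun_prop)
  have hnhds := (isCompact_compatible p).eventually_forall_of_forall_eventually
    (x₀ := ((0 : ℝ), μ))
    (P := fun x w => (∀ j, linCost (a j) x.2 w ≤ b j + x.1) → ent x.2 w ≤ E - x.1) fun w hw => by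
      by_cases hj : ∀ j, linCost (a j) μ w ≤ b j
      · have hlt := hent.continuousAt.eventually_lt (x₀ := ((0, μ), w))
          (by fun_prop : Continuous fun z : (ℝ × (T → ℝ)) × (T → ℝ) => E - z.1.1).continuousAt
          (by simpa using h w hw hj)
        exact hlt.mono fun z hz _ => hz.le
      · push Not at hj
        obtain ⟨j, hj⟩ := hj
        have hlt := ContinuousAt.eventually_lt (x₀ := ((0, μ), w))
          (by fun_prop : Continuous fun z : (ℝ × (T → ℝ)) × (T → ℝ) => b j + z.1.1).continuousAt
          (hcost j).continuousAt (by simpa using hj)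
        exact hlt.mono fun z hz hle => absurd (hle j) (not_le.2 hz)
  obtain ⟨δ, hδ, hball⟩ := Metric.nhds_basis_closedBall.eventually_iff.1 hnhds
  refine ⟨δ, hδ, fun ν hν w hw hj => hball (x := (δ, ν)) ?_ w hw hj⟩
  rw [Metric.mem_closedBall, Prod.dist_eq, max_le_iff, dist_pi_le_iff hδ.le]
  exact ⟨by simp [abs_of_pos hδ], fun t => by simpa [Real.dist_eq] using hν t⟩

end Types

theorem card_mul_log_card_le {α : Type*} {A : Finset α} {M : α → ℝ} (hpos : ∀ z ∈ A, 0 < M z)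
    (hsum : ∑ z ∈ A, M z ≤ 1) :
    (A.card : ℝ) * Real.log A.card ≤ -∑ z ∈ A, Real.log (M z) := by
  have hlog : ∀ z ∈ A, Real.log A.card + Real.log (M z) ≤ A.card * M z - 1 := fun z hz => by
    have hA : (0 : ℝ) < A.card := by exact_mod_cast Finset.card_pos.2 ⟨z, hz⟩
    rw [← Real.log_mul hA.ne' (hpos z hz).ne']
    exact Real.log_le_sub_one_of_pos (mul_pos hA (hpos z hz))
  have hle := Finset.sum_le_sum hlog
  simp only [Finset.sum_add_distrib, Finset.sum_sub_distrib, ← Finset.mul_sum, Finset.sum_const,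
    nsmul_eq_mul, mul_one] at hle
  nlinarith [Nat.cast_nonneg (α := ℝ) A.card]

section Averaging

variable {ι T : Type*} [Fintype ι] {p : T → I} {l : ι → T} {A : Finset (ι → ZMod 2)}

/-- The averaged type of a set `A` of vectors: the frequency of the bit `1` among all positions of
all vectors of `A` that carry the letter `t`. It is `p t` if the letter does not occur, which keeps
it compatible with `p`. -/
def averageOnes (p : T → I) (l : ι → T) (A : Finset (ι → ZMod 2)) (t : T) : ℝ :=
  if letterCount l t = 0 then p t
  else (∑ z ∈ A, (bitCount l t 1 z : ℝ)) / (A.card * letterCount l t)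

theorem card_mul_bitProb_averageOnes (p : T → I) (l : ι → T) (hA : A.Nonempty) (t : T)
    (b : ZMod 2) :
    (A.card : ℝ) * letterCount l t * bitProb (averageOnes p l A t) b =
      ∑ z ∈ A, (bitCount l t b z : ℝ) := by
  have hA0 : (A.card : ℝ) ≠ 0 := by exact_mod_cast hA.card_ne_zero
  by_cases h : letterCount l t = 0
  · have hz : ∀ z, bitCount l t b z = 0 := fun z => Nat.le_zero.1 (h ▸ bitCount_le l t b z)
    simp [h, hz]
  · have h' : (letterCount l t : ℝ) ≠ 0 := by exact_mod_cast h
    have hone : (A.card : ℝ) * letterCount l t * averageOnes p l A t =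
        ∑ z ∈ A, (bitCount l t 1 z : ℝ) := by
      rw [averageOnes, if_neg h]
      field_simp
    rcases zmod_two_cases b with rfl | rfl
    · have hsum : ∀ z, (bitCount l t 0 z : ℝ) = letterCount l t - bitCount l t 1 z := fun z => by
        rw [← sum_bitCount l t z, sum_zmod_two]
        push_cast
        ring
      simp only [hsum, Finset.sum_sub_distrib, ← hone, bitProb_zero, Finset.sum_const, nsmul_eq_mul]
      ring
    · rw [bitProb_one, hone]

theorem averageOnes_mem_compatible (hA : A.Nonempty) (hw : ∀ z ∈ A, letterWeight p l z ≠ 0) :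
    averageOnes p l A ∈ compatible p := by
  intro t
  by_cases h : letterCount l t = 0
  · simp only [averageOnes, h, if_true]
    exact ⟨(p t).2, fun _ => id⟩
  have hpos : 0 < (A.card : ℝ) * letterCount l t :=
    mul_pos (by exact_mod_cast hA.card_pos) (by exact_mod_cast Nat.pos_of_ne_zero h)
  have havg := card_mul_bitProb_averageOnes p l hA t
  have hnonneg : ∀ b, 0 ≤ bitProb (averageOnes p l A t) b := fun b =>
    nonneg_of_mul_nonneg_right (havg b ▸ Finset.sum_nonneg fun _ _ => Nat.cast_nonneg _) hpos
  refine ⟨⟨by simpa using hnonneg 1, by simpa using hnonneg 0⟩, fun b hb => ?_⟩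
  refine (mul_eq_zero_iff_left hpos.ne').1 ((havg b).trans (Finset.sum_eq_zero fun z hz => ?_))
  rw [bitCount_eq_zero_of_bitProb_eq_zero hb (hw z hz), Nat.cast_zero]

theorem bitProb_averageOnes_pos (p : T → I) (l : ι → T) {z : ι → ZMod 2} (hz : z ∈ A) (i : ι) :
    0 < bitProb (averageOnes p l A (l i)) (z i) := by
  refine pos_of_mul_pos_right (a := (A.card : ℝ) * letterCount l (l i)) ?_ (by positivity)
  rw [card_mul_bitProb_averageOnes p l ⟨z, hz⟩]
  exact Finset.sum_pos' (fun _ _ => Nat.cast_nonneg _)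
    ⟨z, hz, by exact_mod_cast bitCount_pos l z i⟩

variable [Fintype T]

theorem sum_sum_comp_letter_bit (p : T → I) (l : ι → T) (hA : A.Nonempty)
    (c : T → ZMod 2 → ℝ) :
    ∑ z ∈ A, ∑ i, c (l i) (z i) =
      A.card * linCost c (fun t => letterCount l t) (averageOnes p l A) := by
  simp_rw [sum_comp_letter_bit, linCost, Finset.mul_sum]
  rw [Finset.sum_comm]
  refine Finset.sum_congr rfl fun t _ => ?_
  rw [Finset.sum_comm]
  refine Finset.sum_congr rfl fun b _ => ?_
  rw [← Finset.sum_mul, ← card_mul_bitProb_averageOnes p l hA]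
  ring

theorem log_card_le_ent_averageOnes (hA : A.Nonempty) (hw : ∀ z ∈ A, letterWeight p l z ≠ 0) :
    Real.log A.card ≤ ent (fun t => letterCount l t) (averageOnes p l A) := by
  classical
  have hcompat := averageOnes_mem_compatible hA hw
  set w := averageOnes p l A
  have hpos : ∀ z ∈ A, ∀ i, 0 < bitProb (w (l i)) (z i) := fun z hz =>
    bitProb_averageOnes_pos p l hz
  have hgibbs := card_mul_log_card_le (fun z hz => Finset.prod_pos fun i _ => hpos z hz i)
    ((Finset.sum_le_univ_sum_of_nonneg fun z => Finset.prod_nonneg fun i _ =>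
      bitProb_nonneg (hcompat (l i)).1 _).trans_eq (sum_prod_bitProb fun i => w (l i)))
  rw [Finset.sum_congr rfl fun z hz => Real.log_prod fun i _ => (hpos z hz i).ne',
    sum_sum_comp_letter_bit p l hA fun t b => Real.log (bitProb (w t) b),
    linCost_log_bitProb_self, mul_neg, neg_neg] at hgibbs
  exact le_of_mul_le_mul_left hgibbs (by exact_mod_cast hA.card_pos)

end Averaging

/-- The averaged type of a set of vectors obeys the linear constraints that its members obey, and
its entropy bounds the logarithm of the size of the set. -/
theorem exists_card_le {T J : Type*} [Fintype T] {p : T → I} {μ : T → ℝ}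
    {a : J → T → ZMod 2 → ℝ} {b : J → ℝ} {E : ℝ}
    (h : ∀ w ∈ compatible p, (∀ j, linCost (a j) μ w ≤ b j) → ent μ w < E) :
    ∃ δ > 0, ∀ {ι : Type*} [Fintype ι] {l : ι → T} {N : ℕ}, 0 < N → LettersTypical μ δ N l →
      ∀ {A : Finset (ι → ZMod 2)}, (∀ z ∈ A, letterWeight p l z ≠ 0) →
      (∀ z ∈ A, ∀ j, ∑ i, a j (l i) (z i) ≤ N * (b j + δ)) →
      (A.card : ℝ) ≤ Real.exp (N * (E - δ)) := by
  obtain ⟨δ, hδ, hgap⟩ := exists_entropy_gap h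
  refine ⟨δ, hδ, fun {ι} _ l N hN hl A hA hj => ?_⟩
  rcases A.eq_empty_or_nonempty with rfl | hne
  · simpa using (Real.exp_pos _).le
  have hN' : (0 : ℝ) < N := by exact_mod_cast hN
  have hA0 : (0 : ℝ) < A.card := by exact_mod_cast hne.card_pos
  have hent := hgap _ hl _ (averageOnes_mem_compatible hne hA) fun j => by
    rw [linCost_div, div_le_iff₀' hN']
    refine le_of_mul_le_mul_left ?_ hA0
    rw [← sum_sum_comp_letter_bit p l hne, ← nsmul_eq_mul]
    exact Finset.sum_le_card_nsmul _ _ _ fun z hz => hj z hz j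
  rw [ent_div, div_le_iff₀' hN'] at hent
  rw [← Real.log_le_iff_le_exp hA0]
  exact (log_card_le_ent_averageOnes hne hA).trans hent

/-! ### Uniform probabilities and the second moment method -/

open scoped BigOperators

open Classical in
/-- The probability of the event `P` for a uniformly distributed element of `α`. -/
def uniformProb {α : Type*} [Fintype α] (P : α → Prop) : ℝ := 𝔼 a, if P a then 1 else 0

section UniformProb

variable {α β : Type*} [Fintype α]

theorem uniformProb_eq_expect (P : α → Prop) [DecidablePred P] :
    uniformProb P = 𝔼 a, if P a then 1 else 0 := by
  unfold uniformProb
  congr!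

theorem uniformProb_eq_card_div (P : α → Prop) [DecidablePred P] :
    uniformProb P = (Finset.univ.filter P).card / Fintype.card α := by
  rw [uniformProb_eq_expect, Fintype.expect_eq_sum_div_card, Finset.sum_boole]

theorem uniformProb_mono {P Q : α → Prop} (h : ∀ a, P a → Q a) : uniformProb P ≤ uniformProb Q := by
  refine Finset.expect_le_expect fun a _ => ?_
  split_ifs with hP hQ hQ
  exacts [le_rfl, absurd (h a hP) hQ, zero_le_one, le_rfl]

theorem uniformProb_eq_zero {P : α → Prop} (h : ∀ a, ¬ P a) : uniformProb P = 0 :=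
  Finset.expect_eq_zero fun a _ => if_neg (h a)

theorem uniformProb_or_le (P Q : α → Prop) :
    uniformProb (fun a => P a ∨ Q a) ≤ uniformProb P + uniformProb Q := by
  classical
  simp only [uniformProb]
  rw [← Finset.expect_add_distrib]
  refine Finset.expect_le_expect fun a _ => ?_
  by_cases hP : P a <;> by_cases hQ : Q a <;> simp [hP, hQ]

theorem uniformProb_exists_le (A : Finset β) (P : β → α → Prop) :
    uniformProb (fun a => ∃ b ∈ A, P b a) ≤ ∑ b ∈ A, uniformProb (P b) := by
  classical
  simp only [uniformProb]
  rw [← Finset.expect_sum_comm]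
  refine Finset.expect_le_expect fun a _ => ?_
  have hnonneg : ∀ b ∈ A, (0 : ℝ) ≤ if P b a then 1 else 0 := fun b _ => by split_ifs <;> simp
  split_ifs with h
  · obtain ⟨b, hb, hP⟩ := h
    exact (if_pos hP).symm.trans_le (Finset.single_le_sum hnonneg hb)
  · exact Finset.sum_nonneg hnonneg

theorem uniformProb_exists_le_card_mul {A : Finset β} {P : β → α → Prop} {c : ℝ}
    (h : ∀ b ∈ A, uniformProb (P b) ≤ c) : uniformProb (fun a => ∃ b ∈ A, P b a) ≤ A.card * c :=
  (uniformProb_exists_le A P).trans (by simpa using Finset.sum_le_card_nsmul A _ c h)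

/-- Second moment method: Chebyshev's inequality for the number of `b ∈ A` with `P b`. -/
theorem uniformProb_not_exists_le [Nonempty α] {A : Finset β} (hA : A.Nonempty)
    {P : β → α → Prop} {c d : ℝ} (hc : 0 < c) (hone : ∀ b ∈ A, uniformProb (P b) = c)
    (htwo : ∀ b ∈ A, ∀ b' ∈ A, b ≠ b' → uniformProb (fun a => P b a ∧ P b' a) ≤ d) (hd : 0 ≤ d) :
    uniformProb (fun a => ¬ ∃ b ∈ A, P b a) ≤ 1 / (A.card * c) + d / c ^ 2 - 1 := by
  classical
  have hA0 : (0 : ℝ) < A.card := by exact_mod_cast hA.card_pos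
  set e : ℝ := A.card * c with he
  have : 0 < e := mul_pos hA0 hc
  set X : α → ℝ := fun a => ∑ b ∈ A, if P b a then 1 else 0 with hX
  have hmean : 𝔼 a, X a = e := by
    simp_rw [hX, Finset.expect_sum_comm, ← uniformProb_eq_expect]
    rw [Finset.sum_congr rfl hone, Finset.sum_const, nsmul_eq_mul]
  have hsq : 𝔼 a, X a ^ 2 ≤ e + A.card ^ 2 * d := by
    have hexpand : ∀ a, X a ^ 2 = ∑ b ∈ A, ∑ b' ∈ A, if P b a ∧ P b' a then 1 else 0 := fun a => by
      simp only [hX, sq, Finset.sum_mul_sum, ite_and, mul_ite, mul_one, mul_zero]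
      exact Finset.sum_congr rfl fun b _ => Finset.sum_congr rfl fun b' _ => by split_ifs <;> rfl
    have hpair : ∀ b ∈ A, ∑ b' ∈ A, uniformProb (fun a => P b a ∧ P b' a) ≤ c + A.card * d := by
      intro b hb
      rw [← Finset.add_sum_erase _ _ hb]
      refine add_le_add ((uniformProb_mono fun _ h => h.1).trans_eq (hone b hb)) ?_
      refine (Finset.sum_le_card_nsmul _ _ d fun b' hb' => htwo b hb b'
        (Finset.mem_of_mem_erase hb') (Finset.ne_of_mem_erase hb').symm).trans ?_
      rw [nsmul_eq_mul]
      exact mul_le_mul_of_nonneg_right (by exact_mod_cast Finset.card_erase_le) hd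
    simp_rw [hexpand, Finset.expect_sum_comm, ← uniformProb_eq_expect]
    refine (Finset.sum_le_card_nsmul A _ _ hpair).trans_eq ?_
    rw [nsmul_eq_mul, he]
    ring
  have hvar : 𝔼 a, (X a - e) ^ 2 ≤ e + A.card ^ 2 * d - e ^ 2 := by
    have hexpand : ∀ a, (X a - e) ^ 2 = X a ^ 2 - 2 * e * X a + e ^ 2 := fun a => by ring
    simp_rw [hexpand, Finset.expect_add_distrib, Finset.expect_sub_distrib, ← Finset.mul_expect,
      hmean, Fintype.expect_const]
    linarith
  have hcheb : uniformProb (fun a => ¬ ∃ b ∈ A, P b a) * e ^ 2 ≤ 𝔼 a, (X a - e) ^ 2 := by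
    rw [uniformProb, Finset.expect_mul]
    refine Finset.expect_le_expect fun a _ => ?_
    by_cases h : ∃ b ∈ A, P b a
    · simpa only [not_true_eq_false, h, if_false, zero_mul] using sq_nonneg (X a - e)
    · have hX0 : X a = 0 := Finset.sum_eq_zero fun b hb => if_neg fun hP => h ⟨b, hb, hP⟩
      simp [h, hX0]
  refine ((le_div_iff₀ (by positivity)).2 (hcheb.trans hvar)).trans_eq ?_
  rw [he]
  field_simp

/-- Left translation by a fixed element carries any fibre into any other one. -/
theorem uniformProb_eq_one_div_card {G : Type*} [Group G] [Fintype G] {B : Finset β} {f : G → β}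
    (hf : ∀ g, f g ∈ B)
    (htrans : ∀ b ∈ B, ∀ b' ∈ B, ∃ a : G, ∀ g, f g = b → f (a * g) = b') {b : β} (hb : b ∈ B) :
    uniformProb (fun g => f g = b) = 1 / B.card := by
  classical
  have hle : ∀ b ∈ B, ∀ b' ∈ B, (Finset.univ.filter fun g => f g = b).card ≤
      (Finset.univ.filter fun g => f g = b').card := by
    intro b hb b' hb'
    obtain ⟨a, ha⟩ := htrans b hb b' hb'
    refine Finset.card_le_card_of_injOn (fun g => a * g) (fun g hg => ?_)
      (mul_right_injective a).injOn
    simpa using ha g (by simpa using hg)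
  have hcard : B.card * (Finset.univ.filter fun g => f g = b).card = Fintype.card G := by
    rw [← Finset.card_univ, Finset.card_eq_sum_card_fiberwise (s := Finset.univ) (f := f)
        (t := B) (fun g _ => hf g),
      Finset.sum_congr rfl fun b' hb' => le_antisymm (hle b' hb' b hb) (hle b hb b' hb'),
      Finset.sum_const, smul_eq_mul]
  have hB : (B.card : ℝ) ≠ 0 := by exact_mod_cast Finset.card_ne_zero_of_mem hb
  have hG : (Fintype.card G : ℝ) ≠ 0 := by exact_mod_cast Fintype.card_ne_zero
  rw [uniformProb_eq_card_div, div_eq_div_iff hG hB, one_mul, mul_comm]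
  exact_mod_cast hcard

end UniformProb

/-! ### Uniform invertible matrices over `𝔽₂` -/

section GeneralLinear

theorem exists_mulVec_eq {K n ι : Type*} [Field K] [Fintype n] [DecidableEq n] {v w : ι → n → K}
    (hv : LinearIndependent K v) (hw : LinearIndependent K w) :
    ∃ G : GL n K, ∀ j, G.1 *ᵥ v j = w j := by
  let f := hv.linearCombinationEquiv.symm ≪≫ₗ hw.linearCombinationEquiv
  obtain ⟨g, hg⟩ := Submodule.exists_linearEquiv_restrict_eq f
  refine ⟨Matrix.GeneralLinearGroup.toLin.symm (.ofLinearEquiv g), fun j => ?_⟩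
  have hgv : (Matrix.GeneralLinearGroup.toLin.symm (.ofLinearEquiv g)).1 *ᵥ v j = g (v j) := by
    rw [← Matrix.mulVecLin_apply, ← Matrix.GeneralLinearGroup.coe_toLin, MulEquiv.apply_symm_apply]
    rfl
  have hgj := hg (hv.linearCombinationEquiv (Finsupp.single j 1))
  simpa [f, hgv] using hgj.symm

theorem linearIndependent_pair_zmod_two {V : Type*} [AddCommGroup V] [Module (ZMod 2) V]
    {x y : V} (hx : x ≠ 0) (hy : y ≠ 0) (hxy : x ≠ y) :
    LinearIndependent (ZMod 2) ![x, y] := by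
  refine (LinearIndependent.pair_iff' hx).2 fun a => ?_
  rcases zmod_two_cases a with rfl | rfl
  · simpa using hy.symm
  · simpa using hxy

theorem mulVec_GL_injective {K n : Type*} [CommRing K] [Fintype n] [DecidableEq n] (H : GL n K) :
    Function.Injective fun x : n → K => H.1 *ᵥ x :=
  Matrix.mulVec_injective_of_isUnit H.isUnit

theorem mulVec_GL_ne_zero {K n : Type*} [CommRing K] [Fintype n] [DecidableEq n] (H : GL n K)
    {x : n → K} (hx : x ≠ 0) : H.1 *ᵥ x ≠ 0 := fun h =>
  hx (mulVec_GL_injective H (by simpa using h))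

variable {n : ℕ}

theorem uniformProb_mulVec_eq {x u : Fin n → ZMod 2} (hx : x ≠ 0) (hu : u ≠ 0) :
    uniformProb (fun H : GL (Fin n) (ZMod 2) => H.1 *ᵥ x = u) = 1 / (2 ^ n - 1) := by
  rw [uniformProb_eq_one_div_card (B := Finset.univ.erase (0 : Fin n → ZMod 2))
    (fun H => by simpa using mulVec_GL_ne_zero H hx) (fun b hb b' hb' => ?_) (by simpa)]
  · rw [Finset.cast_card_erase_of_mem (Finset.mem_univ _)]
    simp
  · obtain ⟨G, hG⟩ := exists_mulVec_eq (ι := Unit) (v := fun _ => b) (w := fun _ => b')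
      (by simpa using hb) (by simpa using hb')
    exact ⟨G, fun H hH => by rw [← hG (), ← hH, Units.val_mul, Matrix.mulVec_mulVec]⟩

theorem uniformProb_mulVec_pair_eq {x x' u u' : Fin n → ZMod 2} (hx : x ≠ 0) (hx' : x' ≠ 0)
    (hxx : x ≠ x') (hu : u ≠ 0) (hu' : u' ≠ 0) (huu : u ≠ u') :
    uniformProb (fun H : GL (Fin n) (ZMod 2) => H.1 *ᵥ x = u ∧ H.1 *ᵥ x' = u') =
      1 / ((2 ^ n - 1) * (2 ^ n - 2)) := by
  simp only [← Prod.mk.injEq]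
  rw [uniformProb_eq_one_div_card (B := (Finset.univ.erase (0 : Fin n → ZMod 2)).offDiag)
    (fun H => by
      simpa using ⟨mulVec_GL_ne_zero H hx, mulVec_GL_ne_zero H hx',
        (mulVec_GL_injective H).ne hxx⟩)
    (fun b hb b' hb' => ?_) (by simpa using ⟨hu, hu', huu⟩)]
  · rw [Finset.offDiag_card, Nat.cast_sub (Nat.le_mul_self _), Nat.cast_mul,
      Finset.cast_card_erase_of_mem (Finset.mem_univ _)]
    simp only [Finset.card_univ, Fintype.card_pi, ZMod.card, Finset.prod_const, Fintype.card_fin,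
      Nat.cast_pow, Nat.cast_ofNat]
    congr 1
    ring
  · simp only [Finset.mem_offDiag, Finset.mem_erase, Finset.mem_univ, and_true] at hb hb'
    obtain ⟨G, hG⟩ := exists_mulVec_eq (linearIndependent_pair_zmod_two hb.1 hb.2.1 hb.2.2)
      (linearIndependent_pair_zmod_two hb'.1 hb'.2.1 hb'.2.2)
    have hG0 : G.1 *ᵥ b.1 = b'.1 := hG 0
    have hG1 : G.1 *ᵥ b.2 = b'.2 := hG 1
    refine ⟨G, fun H hH => Prod.ext ?_ ?_⟩
    · simp only [← hG0, ← hH, Units.val_mul, Matrix.mulVec_mulVec]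
    · simp only [← hG1, ← hH, Units.val_mul, Matrix.mulVec_mulVec]

end GeneralLinear

section Linked

variable {k r : ℕ}

/-- The word `z = (x, v)` consists of a codeword `x` and its parity bits: `x Hᵀ = [m, v]`. -/
def Linked (H : GL (Fin (k + r)) (ZMod 2)) (m : Fin k → ZMod 2)
    (z : Fin (k + r) ⊕ Fin r → ZMod 2) : Prop :=
  H.1 *ᵥ (z ∘ Sum.inl) = Fin.append m (z ∘ Sum.inr)

/-- The last `r` entries of `x Hᵀ`. -/
def parityBits (H : GL (Fin (k + r)) (ZMod 2)) (x : Fin (k + r) → ZMod 2) : Fin r → ZMod 2 :=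
  fun j => (H.1 *ᵥ x) (Fin.natAdd k j)

theorem append_ne_zero {m : Fin k → ZMod 2} (hm : m ≠ 0) (v : Fin r → ZMod 2) :
    Fin.append m v ≠ 0 := fun h => hm <| funext fun i => by
  simpa using congrFun h (Fin.castAdd r i)

theorem append_right_injective (m : Fin k → ZMod 2) :
    Function.Injective fun v : Fin r → ZMod 2 => Fin.append m v := fun v v' h => funext fun i => by
  simpa using congrFun h (Fin.natAdd k i)

variable {m : Fin k → ZMod 2}

theorem Linked.inl_ne_zero {H : GL (Fin (k + r)) (ZMod 2)} (hm : m ≠ 0)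
    {z : Fin (k + r) ⊕ Fin r → ZMod 2} (h : Linked H m z) : z ∘ Sum.inl ≠ 0 := fun h0 =>
  append_ne_zero hm (z ∘ Sum.inr) (by rw [← h, h0, Matrix.mulVec_zero])

theorem two_pow_sub_one_nonneg (n : ℕ) : (0 : ℝ) ≤ 2 ^ n - 1 :=
  sub_nonneg.2 (one_le_pow₀ one_le_two)

theorem two_pow_sub_one_mul_two_pow_sub_two_nonneg (n : ℕ) :
    (0 : ℝ) ≤ (2 ^ n - 1) * (2 ^ n - 2) := by
  rcases n.eq_zero_or_pos with rfl | hn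
  · simp
  · exact mul_nonneg (two_pow_sub_one_nonneg n)
      (sub_nonneg.2 (by simpa using pow_le_pow_right₀ one_le_two (Nat.succ_le_of_lt hn)))

theorem uniformProb_linked_le (hm : m ≠ 0) (z : Fin (k + r) ⊕ Fin r → ZMod 2) :
    uniformProb (fun H => Linked H m z) ≤ 1 / (2 ^ (k + r) - 1) := by
  by_cases hz : z ∘ Sum.inl = 0
  · rw [uniformProb_eq_zero fun H h => h.inl_ne_zero hm hz]
    exact one_div_nonneg.2 (two_pow_sub_one_nonneg _)
  · exact (uniformProb_mulVec_eq hz (append_ne_zero hm _)).le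

theorem uniformProb_linked_and_linked_le (hm : m ≠ 0) {z z' : Fin (k + r) ⊕ Fin r → ZMod 2}
    (hz : z ∘ Sum.inl ≠ 0) (hz' : z' ∘ Sum.inl ≠ 0) (hne : z ≠ z') :
    uniformProb (fun H => Linked H m z ∧ Linked H m z') ≤
      1 / ((2 ^ (k + r) - 1) * (2 ^ (k + r) - 2)) := by
  have hnonneg := one_div_nonneg.2 (two_pow_sub_one_mul_two_pow_sub_two_nonneg (k + r))
  by_cases hx : z ∘ Sum.inl = z' ∘ Sum.inl
  · rw [uniformProb_eq_zero]
    · exact hnonneg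
    · rintro H ⟨h, h'⟩
      have happend : Fin.append m (z ∘ Sum.inr) = Fin.append m (z' ∘ Sum.inr) := by
        rw [← h, ← h', hx]
      exact hne (funext (Sum.rec (congrFun hx) (congrFun (append_right_injective m happend))))
  by_cases hv : z ∘ Sum.inr = z' ∘ Sum.inr
  · rw [uniformProb_eq_zero]
    · exact hnonneg
    · rintro H ⟨h, h'⟩
      exact hx (mulVec_GL_injective H (h.trans (hv ▸ h'.symm)))
  exact (uniformProb_mulVec_pair_eq hz hz' hx (append_ne_zero hm _) (append_ne_zero hm _)
    ((append_right_injective m).ne hv)).le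

theorem uniformProb_not_exists_linked_le (hm : m ≠ 0) (hn : 2 ≤ k + r)
    {A : Finset (Fin (k + r) ⊕ Fin r → ZMod 2)} (hA : ∀ z ∈ A, z ∘ Sum.inl ≠ 0)
    (hne : A.Nonempty) :
    uniformProb (fun H => ¬ ∃ z ∈ A, Linked H m z) ≤
      (2 ^ (k + r) - 1) / A.card + 1 / (2 ^ (k + r) - 2) := by
  have hpow : (4 : ℝ) ≤ 2 ^ (k + r) := by
    calc (4 : ℝ) = 2 ^ 2 := by norm_num
      _ ≤ _ := pow_le_pow_right₀ one_le_two hn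
  have h1 : (0 : ℝ) < 2 ^ (k + r) - 1 := by linarith
  have h2 : (0 : ℝ) < 2 ^ (k + r) - 2 := by linarith
  refine (uniformProb_not_exists_le hne (one_div_pos.2 h1)
    (fun z hz => uniformProb_mulVec_eq (hA z hz) (append_ne_zero hm _))
    (fun z hz z' hz' hzz => uniformProb_linked_and_linked_le hm (hA z hz) (hA z' hz') hzz)
    (by positivity)).trans_eq ?_
  have hA0 : (A.card : ℝ) ≠ 0 := by exact_mod_cast hne.card_ne_zero
  field_simp
  ring

theorem uniformProb_linked_and_parityBits_le (hm : m ≠ 0) {z : Fin (k + r) ⊕ Fin r → ZMod 2}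
    {x : Fin (k + r) → ZMod 2} (hx : x ≠ 0) (hxz : x ≠ z ∘ Sum.inl) (v : Fin r → ZMod 2) :
    uniformProb (fun H => Linked H m z ∧ parityBits H x = v) ≤
      2 ^ k * (1 / ((2 ^ (k + r) - 1) * (2 ^ (k + r) - 2))) := by
  have hnonneg := one_div_nonneg.2 (two_pow_sub_one_mul_two_pow_sub_two_nonneg (k + r))
  by_cases hz : z ∘ Sum.inl = 0
  · rw [uniformProb_eq_zero fun H h => h.1.inl_ne_zero hm hz]
    positivity
  have hmsg : ∀ H : GL (Fin (k + r)) (ZMod 2), Linked H m z ∧ parityBits H x = v →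
      ∃ a ∈ (Finset.univ : Finset (Fin k → ZMod 2)),
        Linked H m z ∧ H.1 *ᵥ x = Fin.append a v := by
    rintro H ⟨hH, rfl⟩
    exact ⟨fun i => (H.1 *ᵥ x) (Fin.castAdd r i), Finset.mem_univ _, hH,
      Fin.append_castAdd_natAdd.symm⟩
  refine (uniformProb_mono hmsg).trans ((uniformProb_exists_le_card_mul
    (c := 1 / ((2 ^ (k + r) - 1) * (2 ^ (k + r) - 2))) fun a _ => ?_).trans_eq (by simp))
  by_cases h : Fin.append a v = 0 ∨ Fin.append m (z ∘ Sum.inr) = Fin.append a v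
  · rw [uniformProb_eq_zero]
    · exact hnonneg
    · rintro H ⟨h1, h2⟩
      rcases h with h | h
      · exact mulVec_GL_ne_zero H hx (h2.trans h)
      · exact hxz (mulVec_GL_injective H (h2.trans (h.symm.trans h1.symm)))
  · push Not at h
    exact (uniformProb_mulVec_pair_eq hz hx (Ne.symm hxz) (append_ne_zero hm _) h.1 h.2).le

end Linked

/-! ### Chebyshev's inequality for independent events -/

@[simp] theorem coe_bit_one : (bit 1 : ℝ) = 1 := by simp [bit]

@[simp] theorem coe_bit_zero : (bit 0 : ℝ) = 0 := by simp [bit]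

section IndependentBits

variable {ι : Type*} [Fintype ι] [DecidableEq ι]

theorem sum_prod_bitProb_mul_centered (θ : ι → ℝ) (i j : ι) :
    ∑ z : ι → ZMod 2, (∏ l, bitProb (θ l) (z l)) * ((bit (z i) - θ i) * (bit (z j) - θ j)) =
      if i = j then θ i * (1 - θ i) else 0 := by
  have hprod : ∀ z : ι → ZMod 2,
      (∏ l, bitProb (θ l) (z l)) * ((bit (z i) - θ i) * (bit (z j) - θ j)) =
        ∏ l, bitProb (θ l) (z l) * ((if l = i then bit (z l) - θ l else 1) *
          (if l = j then bit (z l) - θ l else 1)) := fun z => by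
    simp only [Finset.prod_mul_distrib, Fintype.prod_ite_eq']
  simp_rw [hprod, ← Fintype.prod_sum fun l b => bitProb (θ l) b *
    ((if l = i then bit b - θ l else 1) * (if l = j then bit b - θ l else 1)), sum_zmod_two]
  split_ifs with hij
  · subst hij
    rw [Fintype.prod_eq_single i fun l hl => by simp [hl]]
    simp only [if_true, bitProb_zero, bitProb_one, coe_bit_zero, coe_bit_one]
    ring
  · refine Finset.prod_eq_zero (Finset.mem_univ i) ?_
    simp only [if_true, if_neg hij, bitProb_zero, bitProb_one, coe_bit_zero, coe_bit_one]
    ring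

theorem sum_prod_bitProb_mul_sq (θ : ι → ℝ) (J : Finset ι) :
    ∑ z : ι → ZMod 2, (∏ i, bitProb (θ i) (z i)) * (∑ i ∈ J, (bit (z i) - θ i)) ^ 2 =
      ∑ i ∈ J, θ i * (1 - θ i) := by
  simp_rw [sq, Finset.sum_mul_sum, Finset.mul_sum]
  rw [Finset.sum_comm]
  refine Finset.sum_congr rfl fun i hi => ?_
  rw [Finset.sum_comm]
  simp [sum_prod_bitProb_mul_centered, hi]

theorem sum_prod_bitProb_deviation_le {θ : ι → ℝ} (hθ : ∀ i, θ i ∈ Set.Icc (0 : ℝ) 1)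
    (J : Finset ι) {c : ℝ} (hc : 0 < c) :
    ∑ z : ι → ZMod 2 with c ≤ |∑ i ∈ J, (bit (z i) - θ i)|, ∏ i, bitProb (θ i) (z i) ≤
      J.card / c ^ 2 := by
  have hnonneg : ∀ z : ι → ZMod 2, 0 ≤ ∏ i, bitProb (θ i) (z i) := fun z =>
    Finset.prod_nonneg fun i _ => bitProb_nonneg (hθ i) _
  rw [le_div_iff₀ (by positivity), Finset.sum_mul]
  calc ∑ z : ι → ZMod 2 with c ≤ |∑ i ∈ J, (bit (z i) - θ i)|, (∏ i, bitProb (θ i) (z i)) * c ^ 2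
      ≤ ∑ z : ι → ZMod 2 with c ≤ |∑ i ∈ J, (bit (z i) - θ i)|,
          (∏ i, bitProb (θ i) (z i)) * (∑ i ∈ J, (bit (z i) - θ i)) ^ 2 := by
        refine Finset.sum_le_sum fun z hz => mul_le_mul_of_nonneg_left ?_ (hnonneg z)
        rw [← sq_abs (∑ i ∈ J, _)]
        exact pow_le_pow_left₀ hc.le (Finset.mem_filter.1 hz).2 2
    _ ≤ ∑ z : ι → ZMod 2, (∏ i, bitProb (θ i) (z i)) * (∑ i ∈ J, (bit (z i) - θ i)) ^ 2 :=
        Finset.sum_le_univ_sum_of_nonneg fun z => mul_nonneg (hnonneg z) (sq_nonneg _)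
    _ = ∑ i ∈ J, θ i * (1 - θ i) := sum_prod_bitProb_mul_sq θ J
    _ ≤ ∑ _i ∈ J, (1 : ℝ) := Finset.sum_le_sum fun i _ => by nlinarith [(hθ i).1, (hθ i).2]
    _ = J.card := by simp

end IndependentBits

theorem pmf_toReal_mem_Icc {α : Type*} (P : PMF α) (a : α) : (P a).toReal ∈ Set.Icc (0 : ℝ) 1 :=
  ⟨ENNReal.toReal_nonneg, ENNReal.toReal_mono ENNReal.one_ne_top (P.coe_le_one a)⟩

theorem sum_pmf_toReal {α : Type*} [Fintype α] (P : PMF α) : ∑ a, (P a).toReal = 1 := by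
  rw [← ENNReal.toReal_sum fun a _ => P.apply_ne_top a, ← tsum_fintype (L := .unconditional _),
    P.tsum_coe, ENNReal.toReal_one]

theorem pmf_toReal_eq_bitProb (P : PMF (ZMod 2)) (b : ZMod 2) :
    (P b).toReal = bitProb (P 1).toReal b := by
  have hsum := sum_pmf_toReal P
  rw [sum_zmod_two] at hsum
  rcases zmod_two_cases b with rfl | rfl
  · rw [bitProb_zero, ← hsum, add_sub_cancel_right]
  · rw [bitProb_one]

section ProdPMF

variable {n : ℕ}

theorem prodPMF_map {α β : Type*} (P : Fin n → PMF α) (g : Fin n → α → β) :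
    (prodPMF P).map (fun a i => g i (a i)) = prodPMF fun i => (P i).map (g i) := by
  induction n with
  | zero =>
    simp only [prodPMF, PMF.pure_map]
    congr 1
    exact Subsingleton.elim _ _
  | succ n ih =>
    simp only [prodPMF, PMF.map_bind, PMF.bind_map, PMF.map_comp, Function.comp_def, ← ih]
    congr! with a f i
    refine Fin.cases ?_ (fun i => ?_) i <;> simp

theorem prodPMF_bits_deviation_le (P : Fin n → PMF (ZMod 2)) {c : ℝ} (hc : 0 < c) :
    (prodPMF P).toOuterMeasure {z | c ≤ |∑ i, (bit (z i) - (P i 1).toReal)|} ≤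
      ENNReal.ofReal (n / c ^ 2) := by
  classical
  have hIcc : ∀ i, (P i 1).toReal ∈ Set.Icc (0 : ℝ) 1 := fun i => pmf_toReal_mem_Icc _ _
  have happly : ∀ z, prodPMF P z = ENNReal.ofReal (∏ i, bitProb (P i 1).toReal (z i)) := fun z => by
    rw [prodPMF_apply, ENNReal.ofReal_prod_of_nonneg fun i _ => bitProb_nonneg (hIcc i) _]
    refine Finset.prod_congr rfl fun i _ => ?_
    rw [← pmf_toReal_eq_bitProb, ENNReal.ofReal_toReal (PMF.apply_ne_top _ _)]
  have hdev := sum_prod_bitProb_deviation_le hIcc Finset.univ hc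
  rw [Finset.card_fin] at hdev
  refine le_trans (le_of_eq ?_) (ENNReal.ofReal_le_ofReal hdev)
  rw [PMF.toOuterMeasure_apply_fintype, Finset.sum_filter, ENNReal.ofReal_sum_of_nonneg fun z _ =>
    ite_nonneg (Finset.prod_nonneg fun i _ => bitProb_nonneg (hIcc i) _) le_rfl]
  refine Finset.sum_congr rfl fun z _ => ?_
  rw [Set.indicator_apply, happly, ← ENNReal.ofReal_zero, apply_ite ENNReal.ofReal]
  rfl

open Classical in
theorem prodPMF_deviation_le {α : Type*} (P : Fin n → PMF α) (B : Fin n → Set α) {c : ℝ}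
    (hc : 0 < c) :
    (prodPMF P).toOuterMeasure {a | c ≤ |((Finset.univ.filter fun i => a i ∈ B i).card : ℝ) -
      ∑ i, ((P i).toOuterMeasure (B i)).toReal|} ≤ ENNReal.ofReal (n / c ^ 2) := by
  let g : Fin n → α → ZMod 2 := fun i => (B i).indicator 1
  have hprob : ∀ i, (P i).map (g i) 1 = (P i).toOuterMeasure (B i) := fun i => by
    rw [← PMF.toOuterMeasure_apply_singleton, PMF.toOuterMeasure_map_apply]
    congr 1
    ext a
    simp [g, Set.indicator_apply]
  have hcount : ∀ a : Fin n → α, ∑ i, (bit (g i (a i)) : ℝ) =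
      (Finset.univ.filter fun i => a i ∈ B i).card := fun a => by
    rw [← Finset.sum_boole]
    refine Finset.sum_congr rfl fun i _ => ?_
    by_cases h : a i ∈ B i <;> simp [g, h]
  have hbits := prodPMF_bits_deviation_le (fun i => (P i).map (g i)) hc
  rw [← prodPMF_map, PMF.toOuterMeasure_map_apply] at hbits
  simpa only [Finset.sum_sub_distrib, hprob, Set.preimage_ofPred_eq, hcount] using hbits

end ProdPMF

/-! ### Discrete distributions -/

theorem toOuterMeasure_le_one {α : Type*} (P : PMF α) (s : Set α) : P.toOuterMeasure s ≤ 1 :=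
  (P.toOuterMeasure.mono s.subset_univ).trans
    ((P.toOuterMeasure_apply_eq_one_iff _).2 (Set.subset_univ _)).le

theorem toOuterMeasure_bind_le {α β : Type*} (p : PMF α) (f : α → PMF β) {s : Set β} {B : Set α}
    {η : ℝ≥0∞} (h : ∀ a ∈ p.support, a ∉ B → (f a).toOuterMeasure s ≤ η) :
    (p.bind f).toOuterMeasure s ≤ p.toOuterMeasure B + η := by
  rw [PMF.toOuterMeasure_bind_apply, PMF.toOuterMeasure_apply]
  calc ∑' a, p a * (f a).toOuterMeasure s ≤ ∑' a, (B.indicator p a + p a * η) := by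
        refine ENNReal.tsum_le_tsum fun a => ?_
        by_cases ha : a ∈ B
        · rw [Set.indicator_of_mem ha]
          exact le_add_right (mul_le_of_le_one_right' (toOuterMeasure_le_one _ s))
        · rw [Set.indicator_of_notMem ha, zero_add]
          by_cases hp : p a = 0
          · simp [hp]
          · gcongr
            exact h a hp ha
    _ = ∑' a, B.indicator p a + η := by
        rw [ENNReal.tsum_add, ENNReal.tsum_mul_right, p.tsum_coe, one_mul]

theorem toOuterMeasure_uniformOfFintype {α : Type*} [Fintype α] [Nonempty α] (s : Set α) :
    (PMF.uniformOfFintype α).toOuterMeasure s = ENNReal.ofReal (uniformProb (· ∈ s)) := by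
  classical
  rw [PMF.toOuterMeasure_uniformOfFintype_apply, Fintype.card_subtype, uniformProb_eq_card_div,
    ENNReal.ofReal_div_of_pos (by exact_mod_cast Fintype.card_pos), ENNReal.ofReal_natCast,
    ENNReal.ofReal_natCast]

/-! ### The entropy-constrained optimisation problem over the letters -/

section Weights

variable {ι T : Type*} [Fintype ι] {p : T → I} {l : ι → T} {z z' : ι → ZMod 2}

/-- The cost `-log` of a bit, in nats. -/
def natCost (p : T → I) (t : T) (b : ZMod 2) : ℝ := -Real.log (bitProb (p t) b)

theorem letterWeight_nonneg (p : T → I) (l : ι → T) (z : ι → ZMod 2) : 0 ≤ letterWeight p l z :=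
  Finset.prod_nonneg fun i _ => bitProb_nonneg (p (l i)).2 _

theorem log_letterWeight (h : letterWeight p l z ≠ 0) :
    Real.log (letterWeight p l z) = -∑ i, natCost p (l i) (z i) := by
  rw [letterWeight, Real.log_prod fun i _ => bitProb_ne_zero_of_letterWeight_ne_zero h i]
  simp only [natCost, Finset.sum_neg_distrib, neg_neg]

theorem letterWeight_ne_zero_of_le (h : letterWeight p l z ≠ 0)
    (hle : letterWeight p l z ≤ letterWeight p l z') : letterWeight p l z' ≠ 0 :=
  (((letterWeight_nonneg p l z).lt_of_ne' h).trans_le hle).ne'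

theorem sum_natCost_le (h : letterWeight p l z ≠ 0)
    (hle : letterWeight p l z ≤ letterWeight p l z') :
    ∑ i, natCost p (l i) (z' i) ≤ ∑ i, natCost p (l i) (z i) := by
  have hlog := Real.log_le_log ((letterWeight_nonneg p l z).lt_of_ne' h) hle
  rwa [log_letterWeight h, log_letterWeight (letterWeight_ne_zero_of_le h hle),
    neg_le_neg_iff] at hlog

end Weights

theorem bitProb_ne_zero_of_compatible {T : Type*} {p : T → I} {w : T → ℝ} (hw : w ∈ compatible p)
    {t : T} {b : ZMod 2} (h : bitProb (w t) b ≠ 0) : bitProb (p t) b ≠ 0 :=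
  mt ((hw t).2 b) h

section Optimisation

variable {T : Type*} {p : T → I} {c : T → ZMod 2 → ℝ} {μ w w₀ u : T → ℝ} {E δ : ℝ}

theorem bitProb_mix (x y a : ℝ) (b : ZMod 2) :
    bitProb ((1 - a) * x + a * y) b = (1 - a) * bitProb x b + a * bitProb y b := by
  rcases zmod_two_cases b with rfl | rfl
  · simp only [bitProb_zero]
    ring
  · simp only [bitProb_one]

theorem mix_mem_compatible (hw : w ∈ compatible p) (hu : u ∈ compatible p) {a : ℝ}
    (ha : a ∈ Set.Icc (0 : ℝ) 1) : (fun t => (1 - a) * w t + a * u t) ∈ compatible p := fun t =>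
  ⟨convex_Icc _ _ (hw t).1 (hu t).1 (sub_nonneg.2 ha.2) ha.1 (sub_add_cancel _ _), fun b hb => by
    rw [bitProb_mix, (hw t).2 b hb, (hu t).2 b hb, mul_zero, mul_zero, add_zero]⟩

theorem update_mem_compatible [DecidableEq T] (hw : w ∈ compatible p) {t : T} {x : ℝ}
    (ht : w t ∈ Set.Ioo (0 : ℝ) 1) (hx : x ∈ Set.Ioo (0 : ℝ) 1) :
    Function.update w t x ∈ compatible p := fun s => by
  rcases eq_or_ne s t with rfl | hs
  · rw [Function.update_self]
    exact ⟨Set.Ioo_subset_Icc_self hx, fun b hb => absurd ((hw s).2 b hb) (bitProb_ne_zero ht b)⟩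
  · rw [Function.update_of_ne hs]
    exact hw s

variable [Fintype T]

theorem linCost_update_sub [DecidableEq T] (c : T → ZMod 2 → ℝ) (μ w : T → ℝ) (t : T) (x : ℝ) :
    linCost c μ (Function.update w t x) - linCost c μ w =
      (x - w t) * (μ t * (c t 1 - c t 0)) := by
  rw [linCost_eq, linCost_eq, ← Finset.sum_sub_distrib,
    Fintype.sum_eq_single t fun s hs => by simp [Function.update_of_ne hs], Function.update_self]
  ring

theorem linCost_mix (c : T → ZMod 2 → ℝ) (μ w u : T → ℝ) (a : ℝ) :
    linCost c μ (fun t => (1 - a) * w t + a * u t) =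
      (1 - a) * linCost c μ w + a * linCost c μ u := by
  simp only [linCost_eq, Finset.mul_sum, ← Finset.sum_add_distrib]
  exact Finset.sum_congr rfl fun t _ => by ring

theorem le_ent_mix (hμ : ∀ t, 0 ≤ μ t) (hw : w ∈ compatible p) (hu : u ∈ compatible p) {a : ℝ}
    (ha : a ∈ Set.Icc (0 : ℝ) 1) :
    (1 - a) * ent μ w + a * ent μ u ≤ ent μ fun t => (1 - a) * w t + a * u t := by
  simp only [ent, Finset.mul_sum, ← Finset.sum_add_distrib]
  refine Finset.sum_le_sum fun t _ => ?_
  have hconcave := mul_le_mul_of_nonneg_left (Real.strictConcave_binEntropy.concaveOn.2 (hw t).1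
    (hu t).1 (sub_nonneg.2 ha.2) ha.1 (sub_add_cancel _ _)) (hμ t)
  simp only [smul_eq_mul] at hconcave
  linarith

theorem exists_strictly_feasible (c : T → ZMod 2 → ℝ) (hμ : ∀ t, 0 ≤ μ t)
    (hw₀ : w₀ ∈ compatible p) (hfeas : E ≤ ent μ w₀) (hu : u ∈ compatible p) (huE : E < ent μ u)
    (hδ : 0 < δ) : ∃ w ∈ compatible p, E < ent μ w ∧ linCost c μ w < linCost c μ w₀ + δ := by
  have hcont : Continuous fun a : ℝ => (1 - a) * linCost c μ w₀ + a * linCost c μ u := by fun_prop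
  have hcost := (hcont.tendsto 0).eventually_lt_const (u := linCost c μ w₀ + δ) (by simpa)
  obtain ⟨a, hlt, ha⟩ :=
    ((hcost.filter_mono nhdsWithin_le_nhds).and (Ioo_mem_nhdsGT one_pos)).exists
  have hmem := Set.Ioo_subset_Icc_self ha
  refine ⟨_, mix_mem_compatible hw₀ hu hmem, ?_, (linCost_mix c μ w₀ u a).trans_lt hlt⟩
  refine lt_of_lt_of_le ?_ (le_ent_mix hμ hw₀ hu hmem)
  nlinarith [ha.1, ha.2]

/-- `w₀` is the unique minimizer of the expected value of `c` among the parameters that are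
compatible with `p` and have entropy at least `E`. -/
structure IsUniqueLetterMinimizer (p : T → I) (c : T → ZMod 2 → ℝ) (μ : T → ℝ) (E : ℝ)
    (w₀ : T → ℝ) : Prop where
  compatible : w₀ ∈ compatible p
  feasible : E ≤ ent μ w₀
  eq_of_le : ∀ w ∈ WPC.compatible p, E ≤ ent μ w → linCost c μ w ≤ linCost c μ w₀ → w = w₀

/-- Were the constraint slack, the linear objective could be improved, or kept, by moving one
nondegenerate coordinate. -/
theorem IsUniqueLetterMinimizer.ent_eq (h : IsUniqueLetterMinimizer p c μ E w₀) (hE : 0 ≤ E) :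
    ent μ w₀ = E := by
  classical
  by_contra hne
  have hlt : E < ent μ w₀ := h.feasible.lt_of_ne' hne
  obtain ⟨t, -, ht⟩ : ∃ t ∈ Finset.univ, μ t * Real.binEntropy (w₀ t) ≠ 0 :=
    Finset.exists_ne_zero_of_sum_ne_zero (hE.trans_lt hlt).ne'
  obtain ⟨ht0, ht1⟩ := not_or.1 (mt Real.binEntropy_eq_zero.2 (right_ne_zero_of_mul ht))
  have hIoo : w₀ t ∈ Set.Ioo (0 : ℝ) 1 :=
    ⟨(h.compatible t).1.1.lt_of_ne' ht0, (h.compatible t).1.2.lt_of_ne ht1⟩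
  have hcont : Continuous fun x : ℝ => ent μ (Function.update w₀ t x) :=
    continuous_ent.comp (continuous_const.prodMk (continuous_const.update t continuous_id))
  have hworse : ∀ᶠ x in 𝓝 (w₀ t), x ≠ w₀ t → 0 < (x - w₀ t) * (μ t * (c t 1 - c t 0)) := by
    filter_upwards [hcont.continuousAt.eventually_const_lt (by simpa using hlt),
      isOpen_Ioo.mem_nhds hIoo] with x hxE hx hxne
    rw [← linCost_update_sub]
    by_contra! hle
    have heq := h.eq_of_le _ (update_mem_compatible h.compatible hIoo hx) hxE.le
      (sub_nonpos.1 hle)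
    exact hxne (by simpa using congrFun heq t)
  rcases le_total (μ t * (c t 1 - c t 0)) 0 with hD | hD
  · obtain ⟨x, hx, hgt⟩ :=
      ((hworse.filter_mono nhdsWithin_le_nhds).and
        (self_mem_nhdsWithin (a := w₀ t) (s := Set.Ioi (w₀ t)))).exists
    exact (hx hgt.ne').not_ge (mul_nonpos_of_nonneg_of_nonpos (sub_pos.2 hgt).le hD)
  · obtain ⟨x, hx, hgt⟩ :=
      ((hworse.filter_mono nhdsWithin_le_nhds).and
        (self_mem_nhdsWithin (a := w₀ t) (s := Set.Iio (w₀ t)))).exists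
    exact (hx hgt.ne).not_ge (mul_nonpos_of_nonpos_of_nonneg (sub_neg.2 hgt).le hD)

end Optimisation

/-! ### Counting typical and atypical vectors -/

section Typical

variable {ι T : Type*} [Fintype ι] {p : T → I} {μ w : T → ℝ} {l : ι → T} {z : ι → ZMod 2} {N : ℕ}
  {δ ε : ℝ}

/-- The joint type of `l` and `z`, relative to the scale `N`, is within `δ` of the distribution in
which the letter `t` has mass `μ t` and carries a bit with parameter `w t`. -/
def Typical (μ w : T → ℝ) (δ : ℝ) (N : ℕ) (l : ι → T) (z : ι → ZMod 2) : Prop :=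
  ∀ t b, |(bitCount l t b z : ℝ) / N - μ t * bitProb (w t) b| ≤ δ

theorem LettersTypical.mono (h : LettersTypical μ δ N l) (hle : δ ≤ ε) : LettersTypical μ ε N l :=
  fun t => (h t).trans hle

theorem Typical.mono (h : Typical μ w δ N l z) (hle : δ ≤ ε) : Typical μ w ε N l z :=
  fun t b => (h t b).trans hle

/-- As the letters are typical, a bit that is too rare makes the other bit too frequent. -/
theorem exists_excess_of_not_typical (hl : LettersTypical μ (ε / 2) N l)
    (h : ¬ Typical μ w ε N l z) :
    ∃ t b, μ t * bitProb (w t) b + ε / 2 ≤ (bitCount l t b z : ℝ) / N := by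
  simp only [Typical, not_forall, not_le] at h
  obtain ⟨t, b, hb⟩ := h
  by_contra! hlt
  have hletter := abs_le.1 (hl t)
  rw [← sum_bitCount l t z, sum_zmod_two, Nat.cast_add, add_div] at hletter
  have h0 := hlt t 0
  have h1 := hlt t 1
  rw [bitProb_zero] at h0
  rw [bitProb_one] at h1
  rcases zmod_two_cases b with rfl | rfl <;> simp only [bitProb_zero, bitProb_one] at hb <;>
    rcases lt_abs.1 hb with hb | hb <;> linarith

theorem abs_bitCount_sub_eq (l : ι → T) (w : T → ℝ) (t : T) (b : ZMod 2) (z : ι → ZMod 2) :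
    |(bitCount l t b z : ℝ) - letterCount l t * bitProb (w t) b| =
      |(bitCount l t 1 z : ℝ) - letterCount l t * w t| := by
  rcases zmod_two_cases b with rfl | rfl
  · rw [← sum_bitCount l t z, sum_zmod_two, Nat.cast_add, bitProb_zero, ← abs_neg]
    ring_nf
  · rw [bitProb_one]

theorem typical_of_abs_bitCount_sub_le (hw : ∀ t, w t ∈ Set.Icc (0 : ℝ) 1) (hN : 0 < N)
    (hl : LettersTypical μ (ε / 2) N l)
    (h : ∀ t, |(bitCount l t 1 z : ℝ) - letterCount l t * w t| ≤ N * (ε / 2)) :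
    Typical μ w ε N l z := fun t b => by
  have hN' : (0 : ℝ) < N := by exact_mod_cast hN
  have hbits : |((bitCount l t b z : ℝ) - letterCount l t * bitProb (w t) b) / N| ≤ ε / 2 := by
    rw [abs_div, abs_of_pos hN', div_le_iff₀' hN', abs_bitCount_sub_eq]
    exact h t
  have hletters : |((letterCount l t : ℝ) / N - μ t) * bitProb (w t) b| ≤ ε / 2 := by
    rw [abs_mul, abs_of_nonneg (bitProb_nonneg (hw t) b)]
    exact (mul_le_of_le_one_right (abs_nonneg _) (bitProb_le_one (hw t) b)).trans (hl t)
  calc |(bitCount l t b z : ℝ) / N - μ t * bitProb (w t) b|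
      = |((bitCount l t b z : ℝ) - letterCount l t * bitProb (w t) b) / N +
          ((letterCount l t : ℝ) / N - μ t) * bitProb (w t) b| := by ring_nf
    _ ≤ ε := (abs_add_le _ _).trans (by linarith)

theorem sum_bit_sub_eq [DecidableEq T] (l : ι → T) (w : T → ℝ) (t : T) (z : ι → ZMod 2) :
    ∑ i with l i = t, ((bit (z i) : ℝ) - w (l i)) = bitCount l t 1 z - letterCount l t * w t := by
  classical
  rw [Finset.sum_sub_distrib, Finset.sum_congr (f := fun i => w (l i)) rfl (g := fun _ => w t)
    fun i hi => by rw [(Finset.mem_filter.1 hi).2]]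
  have hbit : ∀ b : ZMod 2, (bit b : ℝ) = if b = 1 then 1 else 0 := fun b => by
    unfold bit; split_ifs <;> rfl
  simp only [hbit, Finset.sum_boole, Finset.filter_filter, Finset.sum_const, nsmul_eq_mul]
  simp only [bitCount, letterCount]
  congr!

theorem sum_letterCount [Fintype T] (l : ι → T) : ∑ t, letterCount l t = Fintype.card ι := by
  classical
  rw [← Finset.card_univ, Finset.card_eq_sum_card_fiberwise (f := l) (t := Finset.univ) (by simp)]
  simp only [letterCount]

theorem sum_filter_le_sum_sum_filter [Fintype T] {α : Type*} [Fintype α] {f : α → ℝ}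
    (hf : ∀ a, 0 ≤ f a) {P : α → Prop} [DecidablePred P] {Q : T → α → Prop}
    [∀ t, DecidablePred (Q t)] (h : ∀ a, P a → ∃ t, Q t a) :
    ∑ a with P a, f a ≤ ∑ t, ∑ a with Q t a, f a := by
  simp only [Finset.sum_filter]
  rw [Finset.sum_comm]
  refine Finset.sum_le_sum fun a _ => ?_
  have hnonneg : ∀ t, 0 ≤ if Q t a then f a else 0 := fun t => by split_ifs <;> simp [hf a]
  split_ifs with ha
  · obtain ⟨t, ht⟩ := h a ha
    simpa [ht] using Finset.single_le_sum (fun t _ => hnonneg t) (Finset.mem_univ t)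
  · exact Finset.sum_nonneg fun t _ => hnonneg t

open Classical in
theorem sum_prod_bitProb_not_typical_le [Finite T] (hw : ∀ t, w t ∈ Set.Icc (0 : ℝ) 1) (hN : 0 < N)
    (hε : 0 < ε) (hl : LettersTypical μ (ε / 2) N l) (hcard : Fintype.card ι ≤ 2 * N) :
    ∑ z : ι → ZMod 2 with ¬ Typical μ w ε N l z, ∏ i, bitProb (w (l i)) (z i) ≤
      8 / (N * ε ^ 2) := by
  cases nonempty_fintype T
  have hnonneg : ∀ z : ι → ZMod 2, 0 ≤ ∏ i, bitProb (w (l i)) (z i) := fun z =>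
    Finset.prod_nonneg fun i _ => bitProb_nonneg (hw _) _
  have hfar : ∀ z, ¬ Typical μ w ε N l z →
      ∃ t, N * (ε / 2) ≤ |∑ i with l i = t, ((bit (z i) : ℝ) - w (l i))| := fun z hz => by
    contrapose! hz
    exact typical_of_abs_bitCount_sub_le hw hN hl fun t => sum_bit_sub_eq l w t z ▸ (hz t).le
  calc ∑ z : ι → ZMod 2 with ¬ Typical μ w ε N l z, ∏ i, bitProb (w (l i)) (z i)
      ≤ ∑ t, ∑ z : ι → ZMod 2 with N * (ε / 2) ≤ |∑ i with l i = t, ((bit (z i) : ℝ) - w (l i))|,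
          ∏ i, bitProb (w (l i)) (z i) := sum_filter_le_sum_sum_filter hnonneg hfar
    _ ≤ ∑ t, (letterCount l t : ℝ) / (N * (ε / 2)) ^ 2 := Finset.sum_le_sum fun t _ => by
        have := sum_prod_bitProb_deviation_le (fun i => hw (l i))
          (Finset.univ.filter fun i => l i = t) (c := N * (ε / 2)) (by positivity)
        simp only [letterCount]
        convert this
    _ = Fintype.card ι / (N * (ε / 2)) ^ 2 := by
        rw [← Finset.sum_div, ← Nat.cast_sum, sum_letterCount]
    _ ≤ 2 * N / (N * (ε / 2)) ^ 2 := by gcongr; exact_mod_cast hcard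
    _ = 8 / (N * ε ^ 2) := by field_simp; norm_num

open Classical in
theorem half_le_sum_prod_bitProb_typical [Finite T] (hw : ∀ t, w t ∈ Set.Icc (0 : ℝ) 1) (hε : 0 < ε)
    (hN : 16 / ε ^ 2 < N) (hl : LettersTypical μ (ε / 2) N l) (hcard : Fintype.card ι ≤ 2 * N) :
    1 / 2 ≤ ∑ z : ι → ZMod 2 with Typical μ w ε N l z, ∏ i, bitProb (w (l i)) (z i) := by
  have hN' : (0 : ℝ) < N := lt_trans (by positivity) hN
  have hatyp := sum_prod_bitProb_not_typical_le hw (by exact_mod_cast hN') hε hl hcard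
  have htotal := Finset.sum_filter_add_sum_filter_not Finset.univ (fun z => Typical μ w ε N l z)
    fun z => ∏ i, bitProb (w (l i)) (z i)
  rw [sum_prod_bitProb fun i => w (l i)] at htotal
  have hsmall : 8 / (N * ε ^ 2) ≤ 1 / 2 := by
    rw [div_lt_iff₀ (by positivity)] at hN
    rw [div_le_div_iff₀ (by positivity) two_pos]
    linarith
  linarith

open Classical in
/-- The function that counts the occurrences of the bit `b` at the letter `t`. -/
def bitIndicator (t : T) (b : ZMod 2) : T → ZMod 2 → ℝ := fun s x =>
  if s = t ∧ x = b then 1 else 0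

theorem sum_bitIndicator (l : ι → T) (z : ι → ZMod 2) (t : T) (b : ZMod 2) :
    ∑ i, bitIndicator t b (l i) (z i) = bitCount l t b z := by
  simp only [bitIndicator, bitCount, Finset.sum_boole]

open Classical in
/-- The vectors of positive weight and of total cost at most `C`. -/
def cheapVectors (p : T → I) (c : T → ZMod 2 → ℝ) (C : ℝ) (l : ι → T) : Finset (ι → ZMod 2) :=
  Finset.univ.filter fun z => letterWeight p l z ≠ 0 ∧ ∑ i, c (l i) (z i) ≤ C

theorem mem_cheapVectors {c : T → ZMod 2 → ℝ} {C : ℝ} :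
    z ∈ cheapVectors p c C l ↔ letterWeight p l z ≠ 0 ∧ ∑ i, c (l i) (z i) ≤ C := by
  simp [cheapVectors]

variable [Fintype T]

theorem Typical.abs_sum_sub_linCost_le (h : Typical μ w δ N l z) (hN : 0 < N)
    (c : T → ZMod 2 → ℝ) :
    |∑ i, c (l i) (z i) - N * linCost c μ w| ≤ N * (δ * ∑ t, ∑ b, |c t b|) := by
  have hN' : (0 : ℝ) < N := by exact_mod_cast hN
  have hdiff : ∑ i, c (l i) (z i) - N * linCost c μ w =
      N * ∑ t, ∑ b, ((bitCount l t b z : ℝ) / N - μ t * bitProb (w t) b) * c t b := by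
    simp only [sum_comp_letter_bit, linCost, Finset.mul_sum, ← Finset.sum_sub_distrib]
    refine Finset.sum_congr rfl fun t _ => Finset.sum_congr rfl fun b _ => ?_
    field_simp
  rw [hdiff, abs_mul, abs_of_pos hN', Finset.mul_sum]
  gcongr
  refine (Finset.abs_sum_le_sum_abs _ _).trans (Finset.sum_le_sum fun t _ => ?_)
  rw [Finset.mul_sum]
  refine (Finset.abs_sum_le_sum_abs _ _).trans (Finset.sum_le_sum fun b _ => ?_)
  rw [abs_mul]
  exact mul_le_mul_of_nonneg_right (h t b) (abs_nonneg _)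

theorem Typical.sum_le (h : Typical μ w δ N l z) (hN : 0 < N) {c : T → ZMod 2 → ℝ} {C : ℝ}
    (hC : linCost c μ w + δ * ∑ t, ∑ b, |c t b| ≤ C) : ∑ i, c (l i) (z i) ≤ N * C := by
  have hdev := (abs_le.1 (h.abs_sum_sub_linCost_le hN c)).2
  have hNC := mul_le_mul_of_nonneg_left hC (Nat.cast_nonneg (α := ℝ) N)
  linarith

theorem Typical.prod_bitProb_le (h : Typical μ w δ N l z) (hN : 0 < N)
    (hw : ∀ t, w t ∈ Set.Icc (0 : ℝ) 1) {E : ℝ}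
    (hE : -ent μ w + δ * ∑ t, ∑ b, |Real.log (bitProb (w t) b)| ≤ -E) :
    ∏ i, bitProb (w (l i)) (z i) ≤ Real.exp (-(N * E)) := by
  by_cases h0 : ∏ i, bitProb (w (l i)) (z i) = 0
  · exact h0.trans_le (Real.exp_pos _).le
  have hpos := (Finset.prod_nonneg fun i _ => bitProb_nonneg (hw (l i)) (z i)).lt_of_ne' h0
  rw [← Real.log_le_iff_le_exp hpos,
    Real.log_prod fun i hi => Finset.prod_ne_zero_iff.1 h0 i hi, ← mul_neg]
  exact h.sum_le hN (c := fun t b => Real.log (bitProb (w t) b))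
    (by rwa [linCost_log_bitProb_self])

theorem eventually_add_mul_lt {x y : ℝ} (h : x < y) (B : ℝ) :
    ∀ᶠ κ in 𝓝[>] (0 : ℝ), x + κ * B < y :=
  ((Continuous.tendsto' (by fun_prop) 0 x (by simp)).mono_left
    nhdsWithin_le_nhds).eventually_lt_const h

/-- The typical vectors for `(μ, w)` have total mass at least `1 / 2`, and each of them has
mass at most `exp (-N * E)`. -/
theorem exists_le_card_cheapVectors {c : T → ZMod 2 → ℝ} {E C : ℝ} (hw : w ∈ compatible p)
    (hE : E < ent μ w) (hC : linCost c μ w < C) :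
    ∃ δ > 0, ∃ N₀ : ℕ, ∀ {ι : Type*} [Fintype ι] {l : ι → T} {N : ℕ}, N₀ ≤ N →
      Fintype.card ι ≤ 2 * N → LettersTypical μ δ N l →
      Real.exp (N * E) / 2 ≤ ((cheapVectors p c (N * C) l).card : ℝ) := by
  classical
  obtain ⟨κ, ⟨hcost, hmass⟩, hκ⟩ := ((eventually_add_mul_lt hC (∑ t, ∑ b, |c t b|)).and
    (eventually_add_mul_lt (neg_lt_neg hE) (∑ t, ∑ b, |Real.log (bitProb (w t) b)|))).and
      self_mem_nhdsWithin |>.exists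
  obtain ⟨N₀, hN₀⟩ := exists_nat_gt (16 / κ ^ 2)
  refine ⟨κ / 2, half_pos hκ, N₀, fun {ι} _ {l N} hN hcard hl => ?_⟩
  have hN' : 16 / κ ^ 2 < N := hN₀.trans_le (by exact_mod_cast hN)
  have hpos : 0 < N := by exact_mod_cast (show (0 : ℝ) ≤ 16 / κ ^ 2 by positivity).trans_lt hN'
  have hhalf := half_le_sum_prod_bitProb_typical (fun t => (hw t).1) hκ hN' hl hcard
  rw [← Finset.sum_filter_ne_zero] at hhalf
  have hsum := hhalf.trans (Finset.sum_le_card_nsmul _ _ (Real.exp (-(N * E))) fun z hz =>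
    (Finset.mem_filter.1 (Finset.mem_filter.1 hz).1).2.prod_bitProb_le hpos (fun t => (hw t).1)
      hmass.le)
  rw [nsmul_eq_mul, Real.exp_neg, ← div_eq_mul_inv, le_div_iff₀ (Real.exp_pos _)] at hsum
  rw [div_eq_inv_mul, ← one_div]
  refine hsum.trans (Nat.cast_le.2 (Finset.card_le_card ?_))
  intro z hz
  simp only [Finset.mem_filter, Finset.mem_univ, true_and] at hz
  exact mem_cheapVectors.2 ⟨Finset.prod_ne_zero_iff.2 fun i hi => bitProb_ne_zero_of_compatible hw
    (Finset.prod_ne_zero_iff.1 hz.2 i hi), hz.1.sum_le hpos hcost.le⟩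

theorem linCost_bitIndicator (μ w : T → ℝ) (t : T) (b : ZMod 2) :
    linCost (bitIndicator t b) μ w = μ t * bitProb (w t) b := by
  rw [linCost, Fintype.sum_eq_single t fun s hs => by simp [bitIndicator, hs],
    Fintype.sum_eq_single b fun x hx => by simp [bitIndicator, hx]]
  simp [bitIndicator]

theorem exists_card_typical_le {E : ℝ} (hμ : ∀ t, 0 < μ t) (hE : ent μ w < E) :
    ∃ δ > 0, ∀ {ι : Type*} [Fintype ι] {l : ι → T} {N : ℕ}, 0 < N → LettersTypical μ δ N l →
      ∀ {A : Finset (ι → ZMod 2)}, (∀ z ∈ A, letterWeight p l z ≠ 0) →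
      (∀ z ∈ A, Typical μ w δ N l z) → (A.card : ℝ) ≤ Real.exp (N * E) := by
  obtain ⟨δ, hδ, hfew⟩ := exists_card_le (p := p) (μ := μ) (E := E)
    (a := fun j : T × ZMod 2 => bitIndicator j.1 j.2)
    (b := fun j => μ j.1 * bitProb (w j.1) j.2) fun w' _ hle => by
      have hw' : w' = w := funext fun t => by
        have h0 := hle (t, 0)
        have h1 := hle (t, 1)
        simp only [linCost_bitIndicator, mul_le_mul_iff_right₀ (hμ t), bitProb_zero,
          bitProb_one] at h0 h1
        linarith
      rwa [hw']
  refine ⟨δ, hδ, fun {ι} _ {l N} hN hl {A} hA htyp => ?_⟩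
  have hN' : (0 : ℝ) < N := by exact_mod_cast hN
  refine (hfew hN hl hA fun z hz j => ?_).trans (Real.exp_le_exp.2 (by gcongr; linarith))
  rw [sum_bitIndicator, ← div_le_iff₀' hN']
  linarith [(abs_le.1 (htyp z hz j.1 j.2)).2]

theorem IsUniqueLetterMinimizer.exists_card_excess_le {c : T → ZMod 2 → ℝ} {E : ℝ}
    (h : IsUniqueLetterMinimizer p c μ E w) (hε : 0 < ε) (t : T) (b : ZMod 2) :
    ∃ δ > 0, ∀ {ι : Type*} [Fintype ι] {l : ι → T} {N : ℕ}, 0 < N → LettersTypical μ δ N l →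
      ∀ {A : Finset (ι → ZMod 2)}, (∀ z ∈ A, letterWeight p l z ≠ 0) →
      (∀ z ∈ A, ∑ i, c (l i) (z i) ≤ N * (linCost c μ w + δ)) →
      (∀ z ∈ A, μ t * bitProb (w t) b + ε ≤ (bitCount l t b z : ℝ) / N) →
      (A.card : ℝ) ≤ Real.exp (N * (E - δ)) := by
  have hlin (v : T → ℝ) : linCost (-bitIndicator t b) μ v = -(μ t * bitProb (v t) b) := by
    rw [← linCost_bitIndicator]
    simp [linCost]
  obtain ⟨δ, hδ, hfew⟩ := exists_card_le (p := p) (μ := μ) (E := E)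
    (a := fun i : Bool => cond i c (-bitIndicator t b))
    (b := fun i => cond i (linCost c μ w) (-(μ t * bitProb (w t) b + ε))) fun w' hw' hle => by
      by_contra! hE
      have hexcess := hle false
      rw [cond_false, cond_false, hlin, h.eq_of_le w' hw' hE (hle true)] at hexcess
      linarith
  refine ⟨δ, hδ, fun {ι} _ {l N} hN hl {A} hA hcost hexcess => hfew hN hl hA fun z hz i => ?_⟩
  cases i
  · simp only [cond_false, Pi.neg_apply, Finset.sum_neg_distrib, sum_bitIndicator]
    have hcount := (le_div_iff₀' (Nat.cast_pos.2 hN)).1 (hexcess z hz)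
    nlinarith [mul_nonneg (Nat.cast_nonneg (α := ℝ) N) hδ.le]
  · exact hcost z hz

theorem IsUniqueLetterMinimizer.exists_card_not_typical_le {c : T → ZMod 2 → ℝ} {E : ℝ}
    (h : IsUniqueLetterMinimizer p c μ E w) (hε : 0 < ε) :
    ∃ δ > 0, ∀ {ι : Type*} [Fintype ι] {l : ι → T} {N : ℕ}, 0 < N → LettersTypical μ δ N l →
      ∀ {A : Finset (ι → ZMod 2)}, (∀ z ∈ A, letterWeight p l z ≠ 0) →
      (∀ z ∈ A, ∑ i, c (l i) (z i) ≤ N * (linCost c μ w + δ)) →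
      (∀ z ∈ A, ¬ Typical μ w ε N l z) →
      (A.card : ℝ) ≤ 2 * Fintype.card T * Real.exp (N * (E - δ)) := by
  classical
  choose d hd hfew using fun j : T × ZMod 2 => h.exists_card_excess_le (half_pos hε) j.1 j.2
  obtain ⟨δ, hδ, hδd⟩ := Pi.exists_forall_pos_add_lt (x := fun _ => 0) hd
  simp only [zero_add] at hδd
  refine ⟨min δ (ε / 2), by positivity, fun {ι} _ {l N} hN hl {A} hA hcost htyp => ?_⟩
  let excess (j : T × ZMod 2) : Finset (ι → ZMod 2) :=
    A.filter fun z => μ j.1 * bitProb (w j.1) j.2 + ε / 2 ≤ (bitCount l j.1 j.2 z : ℝ) / N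
  have hcover : A ⊆ Finset.univ.biUnion excess := fun z hz => by
    obtain ⟨t, b, hb⟩ :=
      exists_excess_of_not_typical (hl.mono (min_le_right _ _)) (htyp z hz)
    simpa only [excess, Finset.mem_biUnion, Finset.mem_filter] using
      ⟨(t, b), Finset.mem_univ _, hz, hb⟩
  have hexcess : ∀ j, ((excess j).card : ℝ) ≤ Real.exp (N * (E - min δ (ε / 2))) := fun j => by
    have hle : min δ (ε / 2) ≤ d j := (min_le_left _ _).trans (hδd j).le
    refine (hfew j hN (hl.mono hle) (fun z hz => hA z (Finset.mem_filter.1 hz).1)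
      (fun z hz => (hcost z (Finset.mem_filter.1 hz).1).trans (by gcongr))
      (fun z hz => (Finset.mem_filter.1 hz).2)).trans (Real.exp_le_exp.2 (by gcongr))
  calc (A.card : ℝ) ≤ ∑ j, ((excess j).card : ℝ) := by
        exact_mod_cast (Finset.card_le_card hcover).trans Finset.card_biUnion_le
    _ ≤ ∑ _j : T × ZMod 2, Real.exp (N * (E - min δ (ε / 2))) :=
        Finset.sum_le_sum fun j _ => hexcess j
    _ = 2 * Fintype.card T * Real.exp (N * (E - min δ (ε / 2))) := by
        simp [mul_comm]

end Typical

/-! ### The encoder finds a typical codeword -/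

section Encoder

theorem exists_nat_mul_exp_neg_le (C : ℝ) {δ η : ℝ} (hδ : 0 < δ) (hη : 0 < η) :
    ∃ N₀ : ℕ, ∀ N : ℕ, N₀ ≤ N → C * Real.exp (-(N * δ)) ≤ η := by
  have h : Filter.Tendsto (fun N : ℕ => C * Real.exp (-(N * δ))) Filter.atTop (𝓝 (C * 0)) :=
    (Real.tendsto_exp_neg_atTop_nhds_zero.comp
      (tendsto_natCast_atTop_atTop.atTop_mul_const hδ)).const_mul C
  rw [mul_zero] at h
  exact Filter.eventually_atTop.1 (h.eventually_le_const hη)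

theorem exp_nat_mul_log_two (N : ℕ) : Real.exp (N * Real.log 2) = 2 ^ N := by
  rw [← Real.log_pow, Real.exp_log (by positivity)]

theorem card_le_card_filter_inl_ne_zero_add {k r : ℕ}
    (A : Finset (Fin (k + r) ⊕ Fin r → ZMod 2)) :
    A.card ≤ (A.filter fun z => z ∘ Sum.inl ≠ 0).card + 2 ^ (k + r) := by
  have hzero : (A.filter fun z => z ∘ Sum.inl = 0).card ≤ 2 ^ r := by
    refine (Finset.card_le_card_of_injOn (t := Finset.univ) (fun z => z ∘ Sum.inr)
      (fun _ _ => Finset.mem_univ _) fun z hz z' hz' h => ?_).trans_eq (by simp)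
    have hinl := (Finset.mem_filter.1 hz).2.trans (Finset.mem_filter.1 hz').2.symm
    exact funext (Sum.rec (congrFun hinl) (congrFun h))
  have hpow : 2 ^ r ≤ 2 ^ (k + r) := Nat.pow_le_pow_right two_pos (Nat.le_add_left r k)
  have hsplit := Finset.card_filter_add_card_filter_not (s := A) fun z => z ∘ Sum.inl = 0
  simp only [ne_eq]
  lia

theorem uniformProb_not_exists_linked_le_of_le_card {k r : ℕ} {m : Fin k → ZMod 2} (hm : m ≠ 0)
    {η : ℝ} (hη : 0 < η) (hn : 2 / η + 2 ≤ 2 ^ (k + r))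
    {A : Finset (Fin (k + r) ⊕ Fin r → ZMod 2)} (hA : 2 ^ (k + r) * (2 / η + 1) ≤ A.card) :
    uniformProb (fun H => ¬ ∃ z ∈ A, Linked H m z) ≤ η := by
  set B := A.filter fun z => z ∘ Sum.inl ≠ 0
  have hη2 : 0 < 2 / η := by positivity
  have hB : 2 ^ (k + r) * (2 / η) ≤ B.card := by
    have h : (A.card : ℝ) ≤ B.card + 2 ^ (k + r) := by
      exact_mod_cast card_le_card_filter_inl_ne_zero_add A
    linarith
  have hBpos : (0 : ℝ) < B.card := lt_of_lt_of_le (by positivity) hB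
  have htwo : 2 ≤ k + r := by
    by_contra! hlt
    have h : (2 : ℝ) ^ (k + r) ≤ 2 ^ 1 := pow_le_pow_right₀ one_le_two (by lia)
    linarith
  have hmean : ((2 : ℝ) ^ (k + r) - 1) / B.card ≤ η / 2 := by
    rw [div_le_iff₀ hBpos]
    calc (2 : ℝ) ^ (k + r) - 1 ≤ η / 2 * (2 ^ (k + r) * (2 / η)) := by
          rw [show η / 2 * (2 ^ (k + r) * (2 / η)) = 2 ^ (k + r) by field_simp]
          linarith
      _ ≤ η / 2 * B.card := by gcongr
  have hvar : 1 / ((2 : ℝ) ^ (k + r) - 2) ≤ η / 2 :=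
    (one_div_le_one_div_of_le hη2 (by linarith)).trans_eq (one_div_div _ _)
  calc uniformProb (fun H => ¬ ∃ z ∈ A, Linked H m z)
      ≤ uniformProb (fun H => ¬ ∃ z ∈ B, Linked H m z) :=
        uniformProb_mono fun H h ⟨z, hz, hH⟩ => h ⟨z, (Finset.mem_filter.1 hz).1, hH⟩
    _ ≤ (2 ^ (k + r) - 1) / B.card + 1 / (2 ^ (k + r) - 2) :=
        uniformProb_not_exists_linked_le hm htwo (fun z hz => (Finset.mem_filter.1 hz).2)
          (Finset.card_pos.1 (by exact_mod_cast hBpos))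
    _ ≤ η := by linarith

variable {T : Type*} [Fintype T] {p : T → I} {c : T → ZMod 2 → ℝ} {μ w w₀ u : T → ℝ}
  {ε η δ₀ : ℝ}

theorem exists_uniformProb_not_exists_cheap_linked_le (c : T → ZMod 2 → ℝ) (hμ : ∀ t, 0 ≤ μ t)
    (hw₀ : w₀ ∈ compatible p) (hfeas : Real.log 2 ≤ ent μ w₀) (hu : u ∈ compatible p)
    (hslack : Real.log 2 < ent μ u) (hδ₀ : 0 < δ₀) (hη : 0 < η) :
    ∃ δ > 0, ∃ N₀ : ℕ, ∀ {k r : ℕ} {l : Fin (k + r) ⊕ Fin r → T}, N₀ ≤ k + r →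
      LettersTypical μ δ (k + r) l → ∀ {m : Fin k → ZMod 2}, m ≠ 0 →
      uniformProb (fun H => ¬ ∃ z ∈ cheapVectors p c ((k + r : ℕ) * (linCost c μ w₀ + δ₀)) l,
        Linked H m z) ≤ η := by
  obtain ⟨w, hw, hwE, hwC⟩ := exists_strictly_feasible c hμ hw₀ hfeas hu hslack hδ₀
  obtain ⟨E, hE, hEw⟩ := exists_between hwE
  obtain ⟨δ, hδ, N₁, hmany⟩ := exists_le_card_cheapVectors hw hEw hwC
  obtain ⟨N₂, hexp⟩ := exists_nat_mul_exp_neg_le (2 * (2 / η + 1)) (sub_pos.2 hE) one_pos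
  obtain ⟨N₃, hpow⟩ := pow_unbounded_of_one_lt (2 / η + 2) (one_lt_two (α := ℝ))
  refine ⟨δ, hδ, max (max N₁ N₂) N₃, fun {k r l} hN hl {m} hm => ?_⟩
  obtain ⟨⟨hN₁, hN₂⟩, hN₃⟩ := by simpa only [max_le_iff] using hN
  refine uniformProb_not_exists_linked_le_of_le_card hm hη
    (hpow.le.trans (pow_le_pow_right₀ one_le_two hN₃))
    (le_trans ?_ (hmany hN₁ (by simp; lia) hl))
  have hgrowth := hexp (k + r) hN₂
  rw [Real.exp_neg, ← div_eq_mul_inv, div_le_one (Real.exp_pos _)] at hgrowth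
  calc (2 : ℝ) ^ (k + r) * (2 / η + 1) = 2 ^ (k + r) * (2 * (2 / η + 1)) / 2 := by ring
    _ ≤ 2 ^ (k + r) * Real.exp ((k + r : ℕ) * (E - Real.log 2)) / 2 := by gcongr
    _ = Real.exp ((k + r : ℕ) * E) / 2 := by
        rw [← exp_nat_mul_log_two, ← Real.exp_add]
        ring_nf

open Classical in
theorem IsUniqueLetterMinimizer.exists_uniformProb_atypical_linked_le
    (h : IsUniqueLetterMinimizer p c μ (Real.log 2) w₀) (hε : 0 < ε) (hη : 0 < η) :
    ∃ δ > 0, ∃ N₀ : ℕ, ∀ {k r : ℕ} {l : Fin (k + r) ⊕ Fin r → T}, N₀ ≤ k + r →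
      LettersTypical μ δ (k + r) l → ∀ {m : Fin k → ZMod 2}, m ≠ 0 →
      uniformProb (fun H => ∃ z ∈ (cheapVectors p c ((k + r : ℕ) * (linCost c μ w₀ + δ)) l).filter
        fun z => ¬ Typical μ w₀ ε (k + r) l z, Linked H m z) ≤ η := by
  obtain ⟨δ, hδ, hfew⟩ := h.exists_card_not_typical_le hε
  obtain ⟨N₀, hN₀⟩ := exists_nat_mul_exp_neg_le (4 * Fintype.card T) hδ hη
  refine ⟨δ, hδ, max N₀ 1, fun {k r l} hN hl {m} hm => ?_⟩
  obtain ⟨hN₀', hpos⟩ := max_le_iff.1 hN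
  set A := (cheapVectors p c ((k + r : ℕ) * (linCost c μ w₀ + δ)) l).filter
    fun z => ¬ Typical μ w₀ ε (k + r) l z
  have hcheap : ∀ z ∈ A, z ∈ cheapVectors p c _ l := fun z hz => (Finset.mem_filter.1 hz).1
  have hcard : (A.card : ℝ) ≤ 2 * Fintype.card T * Real.exp ((k + r : ℕ) * (Real.log 2 - δ)) :=
    hfew hpos hl (fun z hz => (mem_cheapVectors.1 (hcheap z hz)).1)
      (fun z hz => (mem_cheapVectors.1 (hcheap z hz)).2) fun z hz => (Finset.mem_filter.1 hz).2
  have hpow : (2 : ℝ) ≤ 2 ^ (k + r) := by simpa using pow_le_pow_right₀ (one_le_two (α := ℝ)) hpos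
  refine (uniformProb_exists_le_card_mul fun z _ => uniformProb_linked_le hm z).trans ?_
  rw [mul_one_div, div_le_iff₀ (by linarith)]
  calc (A.card : ℝ) ≤ 2 * Fintype.card T * Real.exp ((k + r : ℕ) * (Real.log 2 - δ)) := hcard
    _ = 4 * Fintype.card T * Real.exp (-((k + r : ℕ) * δ)) * (2 ^ (k + r) / 2) := by
        rw [mul_sub, sub_eq_add_neg, Real.exp_add, exp_nat_mul_log_two]
        ring
    _ ≤ η * (2 ^ (k + r) / 2) := by gcongr; exact hN₀ (k + r) hN₀'
    _ ≤ η * (2 ^ (k + r) - 1) := by gcongr; linarith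

/-- For the matrix `H` the message `m` has a codeword of positive weight, and all its codewords of
maximal weight are typical. This is what the analysis needs of the encoder, whatever the rule by
which ties are broken. -/
def EncoderGood (p : T → I) (μ w : T → ℝ) (ε : ℝ) {k r : ℕ} (l : Fin (k + r) ⊕ Fin r → T)
    (m : Fin k → ZMod 2) (H : GL (Fin (k + r)) (ZMod 2)) : Prop :=
  (∃ z, Linked H m z ∧ letterWeight p l z ≠ 0) ∧
    ∀ z, Linked H m z → (∀ z', Linked H m z' → letterWeight p l z' ≤ letterWeight p l z) →
      Typical μ w ε (k + r) l z

theorem IsUniqueLetterMinimizer.exists_uniformProb_not_encoderGood_le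
    (h : IsUniqueLetterMinimizer p c μ (Real.log 2) w₀)
    (hcost : ∀ {k r : ℕ} {l : Fin (k + r) ⊕ Fin r → T} {z z'}, letterWeight p l z ≠ 0 →
      letterWeight p l z ≤ letterWeight p l z' → ∑ i, c (l i) (z' i) ≤ ∑ i, c (l i) (z i))
    (hε : 0 < ε) (hη : 0 < η) :
    ∃ δ > 0, ∃ N₀ : ℕ, ∀ {k r : ℕ} {l : Fin (k + r) ⊕ Fin r → T}, N₀ ≤ k + r →
      LettersTypical μ δ (k + r) l → ∀ {m : Fin k → ZMod 2}, m ≠ 0 →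
      uniformProb (fun H => ¬ EncoderGood p μ w₀ ε l m H) ≤
        uniformProb (fun H => ¬ ∃ z ∈ cheapVectors p c ((k + r : ℕ) * (linCost c μ w₀ + δ)) l,
          Linked H m z) + η := by
  classical
  obtain ⟨δ, hδ, N₀, hatypical⟩ := h.exists_uniformProb_atypical_linked_le hε hη
  refine ⟨δ, hδ, N₀, fun hN hl m hm =>
    ((uniformProb_mono fun H hH => ?_).trans (uniformProb_or_le _ _)).trans
      (add_le_add_right (hatypical hN hl hm) _)⟩
  by_contra! hcon
  obtain ⟨⟨z₀, hz₀, hlink₀⟩, htyp⟩ := hcon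
  obtain ⟨hweight, hcheap⟩ := mem_cheapVectors.1 hz₀
  refine hH ⟨⟨z₀, hlink₀, hweight⟩, fun z hlink hmax => by_contra fun hz => ?_⟩
  have hle := hmax z₀ hlink₀
  exact htyp z (Finset.mem_filter.2 ⟨mem_cheapVectors.2
    ⟨letterWeight_ne_zero_of_le hweight hle, (hcost hweight hle).trans hcheap⟩, hz⟩) hlink

end Encoder

section EncoderSlack

variable {A B : Type*} {p : A ⊕ B → I} {μ w w₀ : A ⊕ B → ℝ}

theorem exists_linked_letterWeight_ne_zero (hA : ∀ a, p (Sum.inl a) ∈ Set.Ioo (0 : I) 1)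
    (hB : ∀ b, p (Sum.inr b) = 0 ∨ p (Sum.inr b) = 1) {k r : ℕ} (s : Fin (k + r) → A)
    (q : Fin r → B) (m : Fin k → ZMod 2) (H : GL (Fin (k + r)) (ZMod 2)) :
    ∃ z, Linked H m z ∧ letterWeight p (Sum.map s q) z ≠ 0 := by
  classical
  let v : Fin r → ZMod 2 := fun j => if p (Sum.inr (q j)) = 1 then 1 else 0
  refine ⟨Sum.elim (H⁻¹.1 *ᵥ Fin.append m v) v, ?_, Finset.prod_ne_zero_iff.2 ?_⟩
  · rw [Linked, Sum.elim_comp_inl, Sum.elim_comp_inr, Matrix.mulVec_mulVec, ← Units.val_mul,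
      mul_inv_cancel, Units.val_one, Matrix.one_mulVec]
  rintro (i | j) -
  · exact bitProb_ne_zero (hA (s i)) _
  · rcases hB (q j) with h | h <;> simp [v, h]

variable [Fintype A] [Fintype B]

theorem eq_half_of_log_two_le_ent (hμ : ∀ t, 0 < μ t) (hsum : ∑ a, μ (Sum.inl a) = 1)
    (hB : ∀ b, w (Sum.inr b) = 0 ∨ w (Sum.inr b) = 1) (hw : Real.log 2 ≤ ent μ w) (a : A) :
    w (Sum.inl a) = 2⁻¹ := by
  rw [← Real.binEntropy_eq_log_two]
  by_contra hne
  have hzero : ∀ b, Real.binEntropy (w (Sum.inr b)) = 0 := fun b =>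
    Real.binEntropy_eq_zero.2 (hB b)
  refine hw.not_gt ?_
  calc ent μ w = ∑ a, μ (Sum.inl a) * Real.binEntropy (w (Sum.inl a)) := by
        simp [ent, Fintype.sum_sum_type, hzero]
    _ < ∑ a, μ (Sum.inl a) * Real.log 2 := by
        refine Finset.sum_lt_sum (fun a _ => ?_) ⟨a, Finset.mem_univ a, ?_⟩
        · exact mul_le_mul_of_nonneg_left Real.binEntropy_le_log_two (hμ _).le
        · exact mul_lt_mul_of_pos_left (Real.binEntropy_le_log_two.lt_of_ne hne) (hμ _)
    _ = Real.log 2 := by rw [← Finset.sum_mul, hsum, one_mul]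

theorem eq_of_all_parity_forced (hμ : ∀ t, 0 < μ t) (hsum : ∑ a, μ (Sum.inl a) = 1)
    (hB : ∀ b, p (Sum.inr b) = 0 ∨ p (Sum.inr b) = 1)
    (hw : w ∈ compatible p) (hwE : Real.log 2 ≤ ent μ w)
    (hw₀ : w₀ ∈ compatible p) (hw₀E : Real.log 2 ≤ ent μ w₀) : w = w₀ := by
  have hforced {w : A ⊕ B → ℝ} (hw : w ∈ compatible p) (b : B) :
      w (Sum.inr b) = p (Sum.inr b) := by
    rcases hB b with h | h
    · simpa [h] using (hw (Sum.inr b)).2 1 (by simp [h])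
    · simpa [h, sub_eq_zero, eq_comm (a := (1 : ℝ))] using (hw (Sum.inr b)).2 0 (by simp [h])
  have hhalf {w : A ⊕ B → ℝ} (hw : w ∈ compatible p) (hwE : Real.log 2 ≤ ent μ w) (a : A) :
      w (Sum.inl a) = 2⁻¹ :=
    eq_half_of_log_two_le_ent hμ hsum (fun b => by rcases hB b with h | h <;> simp [hforced hw, h])
      hwE a
  funext t
  rcases t with a | b
  · rw [hhalf hw hwE, hhalf hw₀ hw₀E]
  · rw [hforced hw, hforced hw₀]

/-- The nondegeneracy of the encoder in terms of letters: either the entropy constraint can be met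
strictly, or no codeword bit is forced by the state and all parity bits are forced. In the second
case a codeword of positive weight exists for every matrix. -/
def EncoderSlack (p : A ⊕ B → I) (μ : A ⊕ B → ℝ) : Prop :=
  (∃ u ∈ compatible p, Real.log 2 < ent μ u) ∨
    (∀ a, p (Sum.inl a) ∈ Set.Ioo (0 : I) 1) ∧
      (∀ b, p (Sum.inr b) = 0 ∨ p (Sum.inr b) = 1) ∧ ∑ a, μ (Sum.inl a) = 1

theorem IsUniqueLetterMinimizer.exists_encoderGood
    (h : IsUniqueLetterMinimizer p (natCost p) μ (Real.log 2) w₀) (hμ : ∀ t, 0 < μ t)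
    (hslack : EncoderSlack p μ) {ε η : ℝ} (hε : 0 < ε) (hη : 0 < η) :
    ∃ δ > 0, ∃ N₀ : ℕ, ∀ {k r : ℕ} {s : Fin (k + r) → A} {q : Fin r → B}, N₀ ≤ k + r →
      LettersTypical μ δ (k + r) (Sum.map s q) → ∀ {m : Fin k → ZMod 2}, m ≠ 0 →
      uniformProb (fun H => ¬ EncoderGood p μ w₀ ε (Sum.map s q) m H) ≤ η := by
  rcases hslack with ⟨u, hu, huE⟩ | ⟨hA, hB, hsum⟩
  · obtain ⟨δ₁, hδ₁, N₁, hgood⟩ :=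
      h.exists_uniformProb_not_encoderGood_le sum_natCost_le hε (half_pos hη)
    obtain ⟨δ₂, hδ₂, N₂, hcheap⟩ := exists_uniformProb_not_exists_cheap_linked_le (natCost p)
      (fun t => (hμ t).le) h.compatible h.feasible hu huE hδ₁ (half_pos hη)
    refine ⟨min δ₁ δ₂, lt_min hδ₁ hδ₂, max N₁ N₂, fun hN hl m hm => ?_⟩
    obtain ⟨hN₁, hN₂⟩ := max_le_iff.1 hN
    linarith [hgood hN₁ (hl.mono (min_le_left _ _)) hm, hcheap hN₂ (hl.mono (min_le_right _ _)) hm]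
  · have hzero : IsUniqueLetterMinimizer p (fun _ _ => 0) μ (Real.log 2) w₀ :=
      ⟨h.compatible, h.feasible, fun w hw hwE _ =>
        eq_of_all_parity_forced hμ hsum hB hw hwE h.compatible h.feasible⟩
    obtain ⟨δ, hδ, N₀, hgood⟩ :=
      hzero.exists_uniformProb_not_encoderGood_le (fun _ _ => le_rfl) hε hη
    refine ⟨δ, hδ, N₀, fun {k r s q} hN hl m hm => (hgood hN hl hm).trans_eq ?_⟩
    rw [uniformProb_eq_zero, zero_add]
    intro H
    obtain ⟨z, hlink, hz⟩ := exists_linked_letterWeight_ne_zero hA hB s q m H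
    refine not_not.2 ⟨z, mem_cheapVectors.2 ⟨hz, ?_⟩, hlink⟩
    simp only [linCost, mul_zero, Finset.sum_const_zero, zero_add]
    positivity

end EncoderSlack

/-! ### The decoder's competitors -/

section Competitors

variable {ι T : Type*} [Fintype ι] {p : T → I} {μ w₀ : T → ℝ} {l : ι → T} {z : ι → ZMod 2}
  {δ E : ℝ} {N : ℕ}

/-- The decoder's condition in letters, with the entropy constraint `E ≤ ent μ w` and all expected
values taken with respect to the letter frequencies `μ`. The second field is the same inequality
for the zero vector, whose entropy is too small for the first one. -/
structure IsDecoderDominant [Fintype T] (p : T → I) (μ : T → ℝ) (E : ℝ) (w₀ : T → ℝ) : Prop where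
  lt_of_le_ent : ∀ w ∈ compatible p, E ≤ ent μ w →
    linCost (natCost p) μ w₀ < linCost (natCost p) μ w
  lt_zero : (∀ t, 0 < μ t → p t ≠ 1) → linCost (natCost p) μ w₀ < linCost (natCost p) μ 0

theorem Typical.lettersTypical (h : Typical μ w₀ δ N l z) :
    LettersTypical μ (2 * δ) N l := fun t => by
  have hsum : (letterCount l t : ℝ) / N - μ t =
      ((bitCount l t 0 z : ℝ) / N - μ t * bitProb (w₀ t) 0) +
        ((bitCount l t 1 z : ℝ) / N - μ t * bitProb (w₀ t) 1) := by
    rw [← sum_bitCount l t z, sum_zmod_two, bitProb_zero, bitProb_one]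
    push_cast
    ring
  rw [hsum, two_mul]
  exact (abs_add_le _ _).trans (add_le_add (h t 0) (h t 1))

theorem LettersTypical.typical_zero (h : LettersTypical μ δ N l) (hδ : 0 ≤ δ) :
    Typical μ 0 δ N l 0 := fun t b => by
  classical
  rcases zmod_two_cases b with rfl | rfl
  · simpa [bitCount, letterCount] using h t
  · simpa [bitCount] using hδ

variable [Fintype T]

theorem IsDecoderDominant.exists_card_letterWeight_le (h : IsDecoderDominant p μ E w₀) :
    ∃ γ > 0, ∃ δ > 0, ∀ {ι : Type*} [Fintype ι] {l : ι → T} {N : ℕ}, 0 < N → ∀ {z : ι → ZMod 2},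
      letterWeight p l z ≠ 0 → Typical μ w₀ δ N l z →
      ∀ {A : Finset (ι → ZMod 2)}, (∀ z' ∈ A, letterWeight p l z ≤ letterWeight p l z') →
      (A.card : ℝ) ≤ Real.exp (N * (E - γ)) := by
  obtain ⟨γ, hγ, hfew⟩ := exists_card_le (p := p) (μ := μ) (E := E)
    (a := fun _ : Unit => natCost p) (b := fun _ => linCost (natCost p) μ w₀) fun w hw hle => by
      by_contra! hE
      exact absurd (hle ()) (not_le.2 (h.lt_of_le_ent w hw hE))
  obtain ⟨δ, ⟨hcost, hletters⟩, hδ⟩ := ((eventually_add_mul_lt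
    (lt_add_of_pos_right (linCost (natCost p) μ w₀) hγ) (∑ t, ∑ b, |natCost p t b|)).and
    (eventually_add_mul_lt hγ 2)).and self_mem_nhdsWithin |>.exists
  exact ⟨γ, hγ, δ, hδ, fun hN z hz htyp A hA => hfew hN (htyp.lettersTypical.mono (by linarith))
    (fun z' hz' => letterWeight_ne_zero_of_le hz (hA z' hz'))
    fun z' hz' _ => (sum_natCost_le hz (hA z' hz')).trans (htyp.sum_le hN hcost.le)⟩

theorem IsDecoderDominant.exists_letterWeight_zero_lt (h : IsDecoderDominant p μ E w₀) :
    ∃ δ > 0, ∀ {ι : Type*} [Fintype ι] {l : ι → T} {N : ℕ}, 0 < N → ∀ {z : ι → ZMod 2},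
      letterWeight p l z ≠ 0 → Typical μ w₀ δ N l z → letterWeight p l 0 < letterWeight p l z := by
  by_cases hp : ∀ t, 0 < μ t → p t ≠ 1
  · obtain ⟨C, hC₀, hC⟩ := exists_between (h.lt_zero hp)
    obtain ⟨δ, ⟨hcost, hcost₀⟩, hδ⟩ := ((eventually_add_mul_lt hC₀ (∑ t, ∑ b, |natCost p t b|)).and
      (eventually_add_mul_lt hC (2 * ∑ t, ∑ b, |natCost p t b|))).and self_mem_nhdsWithin |>.exists
    refine ⟨δ, hδ, fun {ι} _ {l N} hN {z} hz htyp => ?_⟩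
    by_contra! hle
    have hN' : (0 : ℝ) < N := by exact_mod_cast hN
    have hupper := (sum_natCost_le hz hle).trans (htyp.sum_le hN hcost.le)
    have hzero := htyp.lettersTypical.typical_zero (mul_nonneg zero_le_two (le_of_lt hδ))
    have hlower := (abs_le.1 (hzero.abs_sum_sub_linCost_le hN (natCost p))).1
    nlinarith
  · push Not at hp
    obtain ⟨t, ht, hpt⟩ := hp
    refine ⟨μ t / 3, by positivity, fun {ι} _ {l N} _ {z} hz htyp => ?_⟩
    have hfreq := (abs_le.1 (htyp.lettersTypical t)).1
    have hcount : letterCount l t ≠ 0 := fun h0 => by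
      rw [h0, Nat.cast_zero, zero_div] at hfreq
      linarith
    classical
    obtain ⟨i, hi⟩ := Finset.card_ne_zero.1 hcount
    have hzero : letterWeight p l 0 = 0 := by
      by_contra h0
      exact bitProb_ne_zero_of_letterWeight_ne_zero h0 i (by simp [(Finset.mem_filter.1 hi).2, hpt])
    rw [hzero]
    exact (letterWeight_nonneg p l z).lt_of_ne' hz

end Competitors

section UnionBound

variable {k r : ℕ}

theorem uniformProb_linked_and_exists_le {m : Fin k → ZMod 2} (hm : m ≠ 0)
    (z : Fin (k + r) ⊕ Fin r → ZMod 2) (D : Finset (Fin (k + r) ⊕ Fin r → ZMod 2)) :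
    uniformProb (fun H => Linked H m z ∧
      ∃ x, x ≠ 0 ∧ x ≠ z ∘ Sum.inl ∧ Sum.elim x (parityBits H x) ∈ D) ≤
      D.card * (2 ^ k * (1 / ((2 ^ (k + r) - 1) * (2 ^ (k + r) - 2)))) := by
  have hnonneg := one_div_nonneg.2 (two_pow_sub_one_mul_two_pow_sub_two_nonneg (k + r))
  refine (uniformProb_mono fun H => ?_).trans (uniformProb_exists_le_card_mul (A := D)
    (P := fun z' H => z' ∘ Sum.inl ≠ 0 ∧ z' ∘ Sum.inl ≠ z ∘ Sum.inl ∧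
      Linked H m z ∧ parityBits H (z' ∘ Sum.inl) = z' ∘ Sum.inr) fun z' _ => ?_)
  · rintro ⟨hz, x, hx, hxz, hD⟩
    exact ⟨_, hD, hx, hxz, hz, rfl⟩
  · by_cases h : z' ∘ Sum.inl ≠ 0 ∧ z' ∘ Sum.inl ≠ z ∘ Sum.inl
    · exact (uniformProb_mono fun H h' => h'.2.2).trans
        (uniformProb_linked_and_parityBits_le hm h.1 h.2 _)
    · rw [uniformProb_eq_zero fun H h' => h ⟨h'.1, h'.2.1⟩]
      positivity

theorem toOuterMeasure_bind_map_le {G Z O Ω : Type*} (u : PMF G) (z : G → Z) (P : Z → PMF O)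
    (f : G → O → Ω) {s : Set Ω} {A : Finset Z} {β : ℝ≥0∞} (hs : ∀ g y, f g y ∈ s → z g ∈ A)
    (h : ∀ a ∈ A, ∀ y, u.toOuterMeasure {g | z g = a ∧ f g y ∈ s} ≤ β) :
    (u.bind fun g => (P (z g)).map (f g)).toOuterMeasure s ≤ A.card * β := by
  classical
  have hexpand : ∀ g, (P (z g)).toOuterMeasure (f g ⁻¹' s) =
      ∑ a ∈ A, ∑' y, if z g = a ∧ f g y ∈ s then P a y else 0 := fun g => by
    by_cases hg : z g ∈ A
    · rw [Finset.sum_eq_single_of_mem (z g) hg fun a _ ha => by simp [ha.symm],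
        PMF.toOuterMeasure_apply]
      simp [Set.indicator_apply]
    · rw [Finset.sum_eq_zero fun a ha => by simp [show z g ≠ a from fun h => hg (h ▸ ha)]]
      simp [Set.preimage, fun y => mt (hs g y) hg]
  have hterm : ∀ a ∈ A, ∑' g, u g * ∑' y, (if z g = a ∧ f g y ∈ s then P a y else 0) ≤ β :=
    fun a ha => calc
      _ = ∑' y, P a y * u.toOuterMeasure {g | z g = a ∧ f g y ∈ s} := by
        simp only [← ENNReal.tsum_mul_left, PMF.toOuterMeasure_apply, Set.indicator_apply,
          Set.mem_ofPred_eq]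
        rw [ENNReal.tsum_comm]
        refine tsum_congr fun y => tsum_congr fun g => ?_
        split_ifs <;> ring
      _ ≤ ∑' y, P a y * β := ENNReal.tsum_le_tsum fun y => mul_le_mul_right (h a ha y) _
      _ = β := by rw [ENNReal.tsum_mul_right, PMF.tsum_coe, one_mul]
  simp only [PMF.toOuterMeasure_bind_apply, PMF.toOuterMeasure_map_apply, hexpand, Finset.mul_sum]
  rw [Summable.tsum_finsetSum fun _ _ => ENNReal.summable]
  simpa using Finset.sum_le_card_nsmul A _ β hterm

end UnionBound

/-! ### The channel -/

section Channel

variable {A B Y : Type*} {n r : ℕ}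

theorem bitCount_sumMap_inl (s : Fin n → A) (q : Fin r → B) (a : A) (b : ZMod 2)
    (z : Fin n ⊕ Fin r → ZMod 2) :
    bitCount (Sum.map s q) (Sum.inl a) b z = bitCount s a b (z ∘ Sum.inl) := by
  classical
  simp [bitCount, Finset.card_filter, Fintype.sum_sum_type, -Finset.sum_boole]

theorem bitCount_sumMap_inr (s : Fin n → A) (q : Fin r → B) (t : B) (b : ZMod 2)
    (z : Fin n ⊕ Fin r → ZMod 2) :
    bitCount (Sum.map s q) (Sum.inr t) b z = bitCount q t b (z ∘ Sum.inr) := by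
  classical
  simp [bitCount, Finset.card_filter, Fintype.sum_sum_type, -Finset.sum_boole]

theorem typical_sumMap_iff {μ w : A ⊕ B → ℝ} {δ : ℝ} {N : ℕ} {s : Fin n → A} {q : Fin r → B}
    {z : Fin n ⊕ Fin r → ZMod 2} :
    Typical μ w δ N (Sum.map s q) z ↔
      Typical (μ ∘ Sum.inl) (w ∘ Sum.inl) δ N s (z ∘ Sum.inl) ∧
        Typical (μ ∘ Sum.inr) (w ∘ Sum.inr) δ N q (z ∘ Sum.inr) := by
  simp only [Typical, Sum.forall, bitCount_sumMap_inl, bitCount_sumMap_inr, Function.comp_apply]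

variable [Fintype A] {PY : A → ZMod 2 → PMF Y} {μ w : A ⊕ B → ℝ}

/-- The weight of the output `y` together with the channel input `b`, when the letters `a : A` have
weights `μ` and the inputs have parameters `w`; this is `P_{X,Y}(b, y)` if `μ` and `w` are `P_S` and
`P_{X|S}`. -/
def outMass (PY : A → ZMod 2 → PMF Y) (μ w : A ⊕ B → ℝ) (y : Y) (b : ZMod 2) : ℝ :=
  ∑ a, μ (Sum.inl a) * (bitProb (w (Sum.inl a)) b * (PY a b y).toReal)

/-- The letter weights seen by the decoder, whose letters are outputs and parity biases. -/
def decMass (PY : A → ZMod 2 → PMF Y) (μ w : A ⊕ B → ℝ) : Y ⊕ B → ℝ :=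
  Sum.elim (fun y => ∑ b, outMass PY μ w y b) fun t => μ (Sum.inr t)

/-- The conditional probabilities of a one given the decoder's letters (`0` at outputs of
weight `0`). -/
def decParam (PY : A → ZMod 2 → PMF Y) (μ w : A ⊕ B → ℝ) : Y ⊕ B → ℝ :=
  Sum.elim (fun y => outMass PY μ w y 1 / ∑ b, outMass PY μ w y b) fun t => w (Sum.inr t)

theorem outMass_nonneg (hμ : ∀ t, 0 ≤ μ t) (hw : ∀ t, w t ∈ Set.Icc (0 : ℝ) 1) (y : Y)
    (b : ZMod 2) : 0 ≤ outMass PY μ w y b :=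
  Finset.sum_nonneg fun _ _ =>
    mul_nonneg (hμ _) (mul_nonneg (bitProb_nonneg (hw _) _) ENNReal.toReal_nonneg)

theorem decMass_mul_bitProb_decParam_inl (hμ : ∀ t, 0 ≤ μ t)
    (hw : ∀ t, w t ∈ Set.Icc (0 : ℝ) 1) (y : Y) (b : ZMod 2) :
    decMass PY μ w (Sum.inl y) * bitProb (decParam PY μ w (Sum.inl y)) b =
      outMass PY μ w y b := by
  have hnonneg := outMass_nonneg (PY := PY) hμ hw y
  simp only [decMass, decParam, Sum.elim_inl]
  by_cases h0 : ∑ b, outMass PY μ w y b = 0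
  · rw [h0, zero_mul, (Finset.sum_eq_zero_iff_of_nonneg fun b _ => hnonneg b).1 h0 b
      (Finset.mem_univ b)]
  · rcases zmod_two_cases b with rfl | rfl
    · rw [bitProb_zero, mul_one_sub, mul_div_cancel₀ _ h0, sum_zmod_two, add_sub_cancel_right]
    · rw [bitProb_one, mul_div_cancel₀ _ h0]

theorem decParam_mem_Icc (hμ : ∀ t, 0 ≤ μ t) (hw : ∀ t, w t ∈ Set.Icc (0 : ℝ) 1) :
    ∀ t, decParam PY μ w t ∈ Set.Icc (0 : ℝ) 1
  | Sum.inl y => by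
    have hnonneg := outMass_nonneg (PY := PY) hμ hw y
    exact ⟨div_nonneg (hnonneg 1) (Finset.sum_nonneg fun b _ => hnonneg b), div_le_one_of_le₀
      (Finset.single_le_sum (fun b _ => hnonneg b) (Finset.mem_univ 1))
      (Finset.sum_nonneg fun b _ => hnonneg b)⟩
  | Sum.inr t => hw (Sum.inr t)

theorem prodPMF_bitCount_deviation_le (P : Fin n → PMF Y) (x : Fin n → ZMod 2) (y₀ : Y)
    (b : ZMod 2) {c : ℝ} (hc : 0 < c) :
    (prodPMF P).toOuterMeasure {y | c ≤ |(bitCount y y₀ b x : ℝ) -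
      ∑ i, if x i = b then (P i y₀).toReal else 0|} ≤ ENNReal.ofReal (n / c ^ 2) := by
  classical
  have hdev := prodPMF_deviation_le P (fun i => if x i = b then {y₀} else ∅) hc
  have hcount : ∀ y : Fin n → Y, (Finset.univ.filter fun i =>
      y i ∈ if x i = b then ({y₀} : Set Y) else ∅).card = bitCount y y₀ b x := fun y => by
    rw [bitCount]
    congr 1
    ext i
    by_cases h : x i = b <;> simp [h]
  have hprob : ∀ i, ((P i).toOuterMeasure (if x i = b then ({y₀} : Set Y) else ∅)).toReal =
      if x i = b then (P i y₀).toReal else 0 := fun i => by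
    by_cases h : x i = b <;> simp [h, PMF.toOuterMeasure_apply_singleton]
  simpa only [hcount, hprob] using hdev

theorem eventually_prodPMF_bitCount_deviation_le (PY : A → ZMod 2 → PMF Y) (μ w : A ⊕ B → ℝ)
    {δ η : ℝ} (hδ : 0 < δ) (hη : 0 < η) (y₀ : Y) (b : ZMod 2) :
    ∀ᶠ ε in 𝓝[>] (0 : ℝ), ∀ᶠ n in Filter.atTop, ∀ {s : Fin n → A} {x : Fin n → ZMod 2},
      Typical (μ ∘ Sum.inl) (w ∘ Sum.inl) ε n s x →
      (prodPMF fun i => PY (s i) (x i)).toOuterMeasure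
        {y | δ < |(bitCount y y₀ b x : ℝ) / n - outMass PY μ w y₀ b|} ≤ ENNReal.ofReal η := by
  let c : A → ZMod 2 → ℝ := fun a b' => if b' = b then (PY a b' y₀).toReal else 0
  filter_upwards [eventually_add_mul_lt (half_pos hδ) (∑ a, ∑ b', |c a b'|)] with ε hε
  filter_upwards [Filter.eventually_gt_atTop 0,
    Filter.eventually_ge_atTop ⌈4 / (δ ^ 2 * η)⌉₊] with n hn hlarge s x hx
  have hn' : (0 : ℝ) < n := by exact_mod_cast hn
  have hmean : |∑ i, c (s i) (x i) - n * outMass PY μ w y₀ b| ≤ n * (δ / 2) := by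
    have hlin : linCost c (μ ∘ Sum.inl) (w ∘ Sum.inl) = outMass PY μ w y₀ b := by
      simp [linCost, outMass, c]
    rw [← hlin]
    refine (hx.abs_sum_sub_linCost_le hn c).trans ?_
    gcongr
    linarith
  refine (MeasureTheory.measure_mono fun y hy => ?_).trans
    ((prodPMF_bitCount_deviation_le (fun i => PY (s i) (x i)) x y₀ b (c := n * (δ / 2))
      (by positivity)).trans (ENNReal.ofReal_le_ofReal ?_))
  · have hy' : δ < |(bitCount y y₀ b x : ℝ) / n - outMass PY μ w y₀ b| := hy
    rw [← mul_lt_mul_iff_right₀ hn', ← abs_of_pos hn', ← abs_mul, abs_of_pos hn', mul_sub,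
      mul_div_cancel₀ _ hn'.ne'] at hy'
    have htri := abs_sub_le (bitCount y y₀ b x : ℝ) (∑ i, c (s i) (x i))
      (n * outMass PY μ w y₀ b)
    change n * (δ / 2) ≤ |(bitCount y y₀ b x : ℝ) - ∑ i, c (s i) (x i)|
    linarith
  · have hle : 4 / (δ ^ 2 * η) ≤ n := (Nat.le_ceil _).trans (by exact_mod_cast hlarge)
    rw [div_le_iff₀ (by positivity)] at hle ⊢
    nlinarith

theorem exists_prodPMF_not_typical_le [Finite Y] (PY : A → ZMod 2 → PMF Y) {μ w : A ⊕ B → ℝ}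
    (hμ : ∀ t, 0 ≤ μ t) (hw : ∀ t, w t ∈ Set.Icc (0 : ℝ) 1) {δ η : ℝ} (hδ : 0 < δ) (hη : 0 < η) :
    ∃ ε > 0, ∃ N₀ : ℕ, ∀ {n r : ℕ} {s : Fin n → A} {q : Fin r → B} {z : Fin n ⊕ Fin r → ZMod 2},
      N₀ ≤ n → Typical μ w ε n (Sum.map s q) z →
      (prodPMF fun i => PY (s i) (z (Sum.inl i))).toOuterMeasure
        {y | ¬ Typical (decMass PY μ w) (decParam PY μ w) δ n (Sum.map y q) z} ≤
        ENNReal.ofReal η := by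
  cases nonempty_fintype Y
  have hη' : 0 < η / (Fintype.card (Y × ZMod 2) + 1) := by positivity
  obtain ⟨ε, ⟨hout, hεδ⟩, hε⟩ := (((Filter.eventually_all.2 fun j : Y × ZMod 2 =>
    eventually_prodPMF_bitCount_deviation_le PY μ w hδ hη' j.1 j.2).and
    (eventually_add_mul_lt hδ 1)).and self_mem_nhdsWithin).exists
  obtain ⟨N₀, hN₀⟩ := Filter.eventually_atTop.1 (Filter.eventually_all.2 hout)
  refine ⟨ε, hε, N₀, fun {n r s q z} hn hz => ?_⟩
  rw [typical_sumMap_iff] at hz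
  calc _ ≤ (prodPMF fun i => PY (s i) (z (Sum.inl i))).toOuterMeasure (⋃ j : Y × ZMod 2,
        {y | δ < |(bitCount y j.1 j.2 (z ∘ Sum.inl) : ℝ) / n - outMass PY μ w j.1 j.2|}) := by
        refine MeasureTheory.measure_mono fun y hy => ?_
        by_contra hcon
        simp only [Set.mem_iUnion, Set.mem_ofPred_eq, not_exists, not_lt, Prod.forall] at hcon
        refine hy (typical_sumMap_iff.2 ⟨fun y₀ b => ?_, hz.2.mono (by linarith)⟩)
        simpa only [Function.comp_apply, decMass_mul_bitProb_decParam_inl hμ hw] using hcon y₀ b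
    _ ≤ ∑ j : Y × ZMod 2, ENNReal.ofReal (η / (Fintype.card (Y × ZMod 2) + 1)) :=
        (MeasureTheory.measure_iUnion_fintype_le _ _).trans
          (Finset.sum_le_sum fun j _ => hN₀ n hn j hz.1)
    _ ≤ ENNReal.ofReal η := by
        rw [Finset.sum_const, nsmul_eq_mul, Finset.card_univ, ← ENNReal.ofReal_natCast,
          ← ENNReal.ofReal_mul (by positivity)]
        refine ENNReal.ofReal_le_ofReal ?_
        rw [mul_div_assoc', div_le_iff₀ (by positivity)]
        nlinarith

end Channel

/-! ### The code -/

section Code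

variable {k r : ℕ} {H : GL (Fin (k + r)) (ZMod 2)} {m : Fin k → ZMod 2} {x : Fin (k + r) → ZMod 2}

/-- The word formed by the codeword `x` and its parity bits, on whose letters the encoder and the
decoder put their weights. -/
def withParity (H : GL (Fin (k + r)) (ZMod 2)) (x : Fin (k + r) → ZMod 2) :
    Fin (k + r) ⊕ Fin r → ZMod 2 := Sum.elim x (parityBits H x)

theorem withParity_zero (H : GL (Fin (k + r)) (ZMod 2)) : withParity H 0 = 0 := by
  funext i
  rcases i with _ | _ <;> simp [withParity, parityBits]

theorem linked_withParity_iff :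
    Linked H m (withParity H x) ↔ (fun i => (H.1 *ᵥ x) (Fin.castAdd r i)) = m := by
  rw [Linked, withParity, Sum.elim_comp_inl, Sum.elim_comp_inr]
  constructor
  · intro h
    funext i
    rw [h, Fin.append_left]
  · rintro rfl
    exact Fin.append_castAdd_natAdd.symm

theorem Linked.eq_withParity {z : Fin (k + r) ⊕ Fin r → ZMod 2} (h : Linked H m z) :
    z = withParity H (z ∘ Sum.inl) := by
  funext i
  rcases i with i | j
  · rfl
  · simp only [withParity, Sum.elim_inr, parityBits]
    rw [h, Fin.append_right]
    rfl

theorem weight_mul_weight_append {T : Type*} (p : T → I) (l : Fin (k + r) ⊕ Fin r → T)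
    (a : Fin k → I) (H : GL (Fin (k + r)) (ZMod 2)) (x : Fin (k + r) → ZMod 2) :
    weight (fun i => p (l (Sum.inl i))) x *
      weight (Fin.append a fun j => p (l (Sum.inr j)))
        (x ᵥ* (H : Matrix (Fin (k + r)) (Fin (k + r)) (ZMod 2))ᵀ) =
      (∏ i, bitProb (a i) ((H.1 *ᵥ x) (Fin.castAdd r i))) * letterWeight p l (withParity H x) := by
  rw [Matrix.vecMul_transpose]
  unfold weight letterWeight withParity parityBits
  rw [Fintype.prod_sum_type, Fin.prod_univ_add fun i => if (H.1 *ᵥ x) i = 1 then _ else _]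
  simp only [Fin.append_left, Fin.append_right, Sum.elim_inl, Sum.elim_inr]
  unfold bitProb
  ring

theorem prod_bitProb_bit (m u : Fin k → ZMod 2) :
    ∏ i, bitProb (bit (m i)) (u i) = if u = m then 1 else 0 := by
  split_ifs with h
  · subst h
    refine Finset.prod_eq_one fun i _ => ?_
    rcases zmod_two_cases (u i) with h | h <;> simp [h]
  · obtain ⟨i, hi⟩ := Function.ne_iff.1 h
    refine Finset.prod_eq_zero (Finset.mem_univ i) ?_
    rcases zmod_two_cases (u i) with h | h <;> rcases zmod_two_cases (m i) with h' | h' <;>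
      simp [h, h'] at hi ⊢

theorem prod_bitProb_half (u : Fin k → ZMod 2) : ∏ i, bitProb half (u i) = (1 / 2) ^ k := by
  have hhalf : ∀ b, bitProb half b = 1 / 2 := fun b => by
    rcases zmod_two_cases b with rfl | rfl <;> norm_num [half]
  simp [hhalf]

theorem weight_mul_weight_le_query (τ : TieBreak) {n : ℕ} (H : GL (Fin n) (ZMod 2))
    (p q : Fin n → I) (x : Fin n → ZMod 2) :
    weight p x * weight q (x ᵥ* (H : Matrix (Fin n) (Fin n) (ZMod 2))ᵀ) ≤
      weight p (query τ H p q) *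
        weight q (query τ H p q ᵥ* (H : Matrix (Fin n) (Fin n) (ZMod 2))ᵀ) := by
  have hne : (maximizers H p q).Nonempty := by
    obtain ⟨x₀, hx₀⟩ := Finite.exists_max fun x : Fin n → ZMod 2 =>
      weight p x * weight q (x ᵥ* (H : Matrix (Fin n) (Fin n) (ZMod 2))ᵀ)
    exact ⟨x₀, Finset.mem_filter.2 ⟨Finset.mem_univ _, hx₀⟩⟩
  exact (Finset.mem_filter.1 (τ.pick_mem _ hne)).2 x

variable {A B Y : Type*} {s : Fin (k + r) → A} {q : Fin r → B} {y : Fin (k + r) → Y}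
  {pe : A → I} {pb : B → I} {pd : Y → I} (τ : TieBreak)

theorem linked_encode_and_letterWeight_le
    (hex : ∃ z, Linked H m z ∧ letterWeight (Sum.elim pe pb) (Sum.map s q) z ≠ 0) :
    Linked H m (withParity H (encode τ pe H (pb ∘ q) m s)) ∧
      ∀ z, Linked H m z → letterWeight (Sum.elim pe pb) (Sum.map s q) z ≤
        letterWeight (Sum.elim pe pb) (Sum.map s q)
          (withParity H (encode τ pe H (pb ∘ q) m s)) := by
  set x := encode τ pe H (pb ∘ q) m s
  have hmax : ∀ z, Linked H m z → letterWeight (Sum.elim pe pb) (Sum.map s q) z ≤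
      (if (fun i => (H.1 *ᵥ x) (Fin.castAdd r i)) = m then 1 else 0) *
        letterWeight (Sum.elim pe pb) (Sum.map s q) (withParity H x) := fun z hz => by
    have hle := weight_mul_weight_le_query τ H (fun i => Sum.elim pe pb (Sum.map s q (Sum.inl i)))
      (Fin.append (fun i => bit (m i)) fun j => Sum.elim pe pb (Sum.map s q (Sum.inr j)))
      (z ∘ Sum.inl)
    rwa [weight_mul_weight_append, weight_mul_weight_append, prod_bitProb_bit, prod_bitProb_bit,
      if_pos (linked_withParity_iff.1 (hz.eq_withParity ▸ hz)), one_mul, ← hz.eq_withParity] at hle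
  obtain ⟨z₀, hz₀, hw₀⟩ := hex
  have hpos := (letterWeight_nonneg _ _ z₀).lt_of_ne' hw₀
  by_cases hm : (fun i => (H.1 *ᵥ x) (Fin.castAdd r i)) = m
  · exact ⟨linked_withParity_iff.2 hm, by simpa only [if_pos hm, one_mul] using hmax⟩
  · exact absurd (hmax z₀ hz₀) (by simpa only [if_neg hm, zero_mul, not_le] using hpos)

theorem exists_of_decode_ne (hx : Linked H m (withParity H x))
    (hne : decode τ pd H (pb ∘ q) y ≠ m) :
    ∃ x', x' ≠ x ∧ letterWeight (Sum.elim pd pb) (Sum.map y q) (withParity H x) ≤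
      letterWeight (Sum.elim pd pb) (Sum.map y q) (withParity H x') := by
  refine ⟨query τ H (fun j => pd (y j)) (Fin.append (fun _ => half) (pb ∘ q)), fun h => ?_, ?_⟩
  · refine hne ?_
    unfold decode
    rw [h, Matrix.vecMul_transpose]
    exact linked_withParity_iff.1 hx
  · have hle := weight_mul_weight_le_query τ H
      (fun i => Sum.elim pd pb (Sum.map y q (Sum.inl i)))
      (Fin.append (fun _ => half) fun j => Sum.elim pd pb (Sum.map y q (Sum.inr j))) x
    rw [weight_mul_weight_append, weight_mul_weight_append, prod_bitProb_half,
      prod_bitProb_half] at hle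
    exact le_of_mul_le_mul_left hle (by positivity)

theorem letterWeight_ne_zero_of_mem_support {PY : A → ZMod 2 → PMF Y}
    (hnd : ∀ a b, bitProb (pe a) b ≠ 0 → ∀ y ∈ (PY a b).support, bitProb (pd y) b ≠ 0)
    {z : Fin (k + r) ⊕ Fin r → ZMod 2}
    (hz : letterWeight (Sum.elim pe pb) (Sum.map s q) z ≠ 0)
    (hy : y ∈ (prodPMF fun i => PY (s i) (z (Sum.inl i))).support) :
    letterWeight (Sum.elim pd pb) (Sum.map y q) z ≠ 0 := by
  have hne := bitProb_ne_zero_of_letterWeight_ne_zero hz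
  refine Finset.prod_ne_zero_iff.2 ?_
  rintro (i | j) -
  · rw [PMF.mem_support_iff, prodPMF_apply] at hy
    exact hnd _ _ (hne (Sum.inl i)) _
      ((PMF.mem_support_iff _ _).2 (Finset.prod_ne_zero_iff.1 hy i (Finset.mem_univ i)))
  · exact hne (Sum.inr j)

end Code

/-! ### The error probability for typical states and parity biases -/

section RunBound

theorem one_div_two_pow_sub_one_mul_le {n : ℕ} (hn : 2 ≤ n) :
    1 / (((2 : ℝ) ^ n - 1) * (2 ^ n - 2)) ≤ 4 * Real.exp (-(2 * (n * Real.log 2))) := by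
  have hpow : (4 : ℝ) ≤ 2 ^ n := by
    calc (4 : ℝ) = 2 ^ 2 := by norm_num
      _ ≤ 2 ^ n := pow_le_pow_right₀ one_le_two hn
  have hexp : Real.exp (-(2 * (n * Real.log 2))) = ((2 : ℝ) ^ n * 2 ^ n)⁻¹ := by
    rw [Real.exp_neg, two_mul, Real.exp_add, exp_nat_mul_log_two]
  rw [hexp, ← div_eq_mul_inv, div_le_div_iff₀ (by nlinarith) (by positivity)]
  nlinarith

theorem union_bound_le {ρ γ : ℝ} {k r : ℕ} (h2 : 2 ≤ k + r)
    (hr : |(r : ℝ) / (k + r : ℕ) - ρ| * Real.log 2 ≤ γ / 4) :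
    Real.exp ((k + r : ℕ) * (Real.log 2 + γ / 4)) *
      (Real.exp ((k + r : ℕ) * (ρ * Real.log 2 - γ)) *
        (2 ^ k * (1 / ((2 ^ (k + r) - 1) * (2 ^ (k + r) - 2))))) ≤
      4 * Real.exp (-((k + r : ℕ) * (γ / 2))) := by
  have hN : (0 : ℝ) < (k + r : ℕ) := by exact_mod_cast (show 0 < k + r by omega)
  have hrate : (k + r : ℕ) * (ρ * Real.log 2) - r * Real.log 2 ≤ (k + r : ℕ) * (γ / 4) := by
    have hle := mul_le_mul_of_nonneg_left ((mul_le_mul_of_nonneg_right (neg_le_abs _)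
      (Real.log_nonneg one_le_two)).trans hr) hN.le
    refine le_trans (le_of_eq ?_) hle
    field_simp
    ring
  calc _ ≤ Real.exp ((k + r : ℕ) * (Real.log 2 + γ / 4)) *
        (Real.exp ((k + r : ℕ) * (ρ * Real.log 2 - γ)) * (Real.exp (k * Real.log 2) *
          (4 * Real.exp (-(2 * ((k + r : ℕ) * Real.log 2)))))) := by
        rw [exp_nat_mul_log_two k]
        gcongr
        exact one_div_two_pow_sub_one_mul_le h2
    _ = 4 * Real.exp ((k + r : ℕ) * (ρ * Real.log 2) - r * Real.log 2 -
          (k + r : ℕ) * (3 / 4 * γ)) := by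
        rw [mul_left_comm _ (4 : ℝ), mul_left_comm _ (4 : ℝ), mul_left_comm _ (4 : ℝ),
          ← Real.exp_add, ← Real.exp_add, ← Real.exp_add]
        push_cast
        ring_nf
    _ ≤ _ := by
        gcongr
        linarith

variable {A B Y : Type*} {pe : A → I} {pb : B → I} {pd : Y → I} {PY : A → ZMod 2 → PMF Y}

/-- The joint law of the matrix and the outputs, given the message, the states and the parity
biases. -/
def codeLaw (τ : TieBreak) (PY : A → ZMod 2 → PMF Y) (pe : A → I) {k r : ℕ} (m : Fin k → ZMod 2)
    (s : Fin (k + r) → A) (q : Fin r → I) :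
    PMF (GL (Fin (k + r)) (ZMod 2) × (Fin (k + r) → Y)) :=
  (PMF.uniformOfFintype (GL (Fin (k + r)) (ZMod 2))).bind fun H =>
    (prodPMF fun i => PY (s i) (encode τ pe H q m s i)).map (Prod.mk H)

theorem mem_support_of_mem_codeLaw {τ : TieBreak} {k r : ℕ} {m : Fin k → ZMod 2}
    {s : Fin (k + r) → A} {q : Fin r → I} {H : GL (Fin (k + r)) (ZMod 2)} {y : Fin (k + r) → Y}
    (h : (H, y) ∈ (codeLaw τ PY pe m s q).support) :
    y ∈ (prodPMF fun i => PY (s i) (encode τ pe H q m s i)).support := by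
  obtain ⟨H', -, hH'⟩ := (PMF.mem_support_bind_iff _ _ _).1 h
  obtain ⟨y', hy', heq⟩ := (PMF.mem_support_map_iff _ _ _).1 hH'
  obtain ⟨rfl, rfl⟩ := Prod.ext_iff.1 heq
  exact hy'

/-- The codeword together with its parity bits. -/
def encodedWord (τ : TieBreak) (pe : A → I) (pb : B → I) {k r : ℕ} (m : Fin k → ZMod 2)
    (s : Fin (k + r) → A) (q : Fin r → B) (H : GL (Fin (k + r)) (ZMod 2)) :
    Fin (k + r) ⊕ Fin r → ZMod 2 :=
  withParity H (encode τ pe H (pb ∘ q) m s)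

/-- The word `z` could be the encoded one and is typical for the decoder, but some codeword other
than `0` and that of `z` looks at least as good to the decoder as `z`. -/
def Confusable {T : Type*} (p : T → I) (μ w : T → ℝ) (δ : ℝ) {k r : ℕ}
    (l : Fin (k + r) ⊕ Fin r → T) (m : Fin k → ZMod 2) (H : GL (Fin (k + r)) (ZMod 2))
    (z : Fin (k + r) ⊕ Fin r → ZMod 2) : Prop :=
  (letterWeight p l z ≠ 0 ∧ Typical μ w δ (k + r) l z) ∧ Linked H m z ∧
    ∃ x, x ≠ 0 ∧ x ≠ z ∘ Sum.inl ∧ letterWeight p l z ≤ letterWeight p l (withParity H x)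

theorem IsDecoderDominant.exists_uniformProb_confusable_le {T : Type*} [Fintype T] {p : T → I}
    {μ w : T → ℝ} {E : ℝ} (h : IsDecoderDominant p μ E w) :
    ∃ γ > 0, ∃ δ > 0, ∀ {k r : ℕ} {l : Fin (k + r) ⊕ Fin r → T} {m : Fin k → ZMod 2},
      0 < k + r → m ≠ 0 → ∀ z, uniformProb (fun H => Confusable p μ w δ l m H z) ≤
        Real.exp ((k + r : ℕ) * (E - γ)) *
          (2 ^ k * (1 / ((2 ^ (k + r) - 1) * (2 ^ (k + r) - 2)))) := by
  classical
  obtain ⟨γ, hγ, δ, hδ, hcard⟩ := h.exists_card_letterWeight_le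
  refine ⟨γ, hγ, δ, hδ, fun {k r l m} hN hm z => ?_⟩
  have hnonneg := one_div_nonneg.2 (two_pow_sub_one_mul_two_pow_sub_two_nonneg (k + r))
  by_cases hz : letterWeight p l z ≠ 0 ∧ Typical μ w δ (k + r) l z
  · set D := Finset.univ.filter fun z' => letterWeight p l z ≤ letterWeight p l z'
    refine (uniformProb_mono fun H hH => ?_).trans
      ((uniformProb_linked_and_exists_le hm z D).trans
        (mul_le_mul_of_nonneg_right (hcard hN hz.1 hz.2 fun z' hz' => (Finset.mem_filter.1 hz').2)
          (by positivity)))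
    obtain ⟨-, hlink, x, hx, hxz, hle⟩ := hH
    exact ⟨hlink, x, hx, hxz, Finset.mem_filter.2 ⟨Finset.mem_univ _, hle⟩⟩
  · rw [uniformProb_eq_zero fun H hH => hz hH.1]
    positivity

variable [Fintype A] [Fintype B] {μ w : A ⊕ B → ℝ}

theorem IsUniqueLetterMinimizer.exists_codeLaw_not_typical_le [Finite Y]
    (h : IsUniqueLetterMinimizer (Sum.elim pe pb) (natCost (Sum.elim pe pb)) μ (Real.log 2) w)
    (hμ : ∀ t, 0 < μ t) (hslack : EncoderSlack (Sum.elim pe pb) μ) (τ : TieBreak)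
    (PY : A → ZMod 2 → PMF Y) {ε δ η : ℝ} (hε : 0 < ε) (hδ : 0 < δ) (hη : 0 < η) :
    ∃ δ' > 0, ∃ N₀ : ℕ, ∀ {k r : ℕ} {s : Fin (k + r) → A} {q : Fin r → B}, N₀ ≤ k + r →
      LettersTypical μ δ' (k + r) (Sum.map s q) → ∀ {m : Fin k → ZMod 2}, m ≠ 0 →
      (codeLaw τ PY pe m s (pb ∘ q)).toOuterMeasure
        {ω | ¬ (Linked ω.1 m (encodedWord τ pe pb m s q ω.1) ∧
          (letterWeight (Sum.elim pe pb) (Sum.map s q) (encodedWord τ pe pb m s q ω.1) ≠ 0 ∧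
            Typical μ w ε (k + r) (Sum.map s q) (encodedWord τ pe pb m s q ω.1)) ∧
          Typical (decMass PY μ w) (decParam PY μ w) δ (k + r) (Sum.map ω.2 q)
            (encodedWord τ pe pb m s q ω.1))} ≤ ENNReal.ofReal η := by
  obtain ⟨ε', hε', N₁, hout⟩ := exists_prodPMF_not_typical_le PY (fun t => (hμ t).le)
    (fun t => (h.compatible t).1) hδ (half_pos hη)
  obtain ⟨δ', hδ', N₂, hgood⟩ := h.exists_encoderGood hμ hslack (lt_min hε hε') (half_pos hη)
  refine ⟨δ', hδ', max N₁ N₂, fun {k r s q} hN hl m hm => ?_⟩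
  obtain ⟨hN₁, hN₂⟩ := max_le_iff.1 hN
  refine (toOuterMeasure_bind_le _ _ (B := {H | ¬ EncoderGood (Sum.elim pe pb) μ w (min ε ε')
    (Sum.map s q) m H}) (η := ENNReal.ofReal (η / 2)) fun H _ hH => ?_).trans ?_
  · obtain ⟨hex, htyp⟩ := not_not.1 hH
    obtain ⟨hlink, hmax⟩ := linked_encode_and_letterWeight_le τ hex
    have hword := htyp _ hlink hmax
    have hne : letterWeight (Sum.elim pe pb) (Sum.map s q) (encodedWord τ pe pb m s q H) ≠ 0 :=
      hex.elim fun z hz => letterWeight_ne_zero_of_le hz.2 (hmax z hz.1)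
    rw [PMF.toOuterMeasure_map_apply]
    refine (MeasureTheory.measure_mono ?_).trans (hout hN₁ (hword.mono (min_le_right _ _)))
    exact fun y hy hD => hy ⟨hlink, ⟨hne, hword.mono (min_le_left _ _)⟩, hD⟩
  · rw [toOuterMeasure_uniformOfFintype]
    refine (add_le_add_left (ENNReal.ofReal_le_ofReal (hgood hN₂ hl hm)) _).trans ?_
    rw [← ENNReal.ofReal_add (half_pos hη).le (half_pos hη).le, add_halves]

theorem IsDecoderDominant.exists_codeLaw_confusable_le [Fintype Y] {ρ : ℝ}
    (h : IsDecoderDominant (Sum.elim pd pb) (decMass PY μ w) (ρ * Real.log 2) (decParam PY μ w))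
    (hμ : ∀ t, 0 < μ t) (hent : ent μ w = Real.log 2) (τ : TieBreak) {η : ℝ} (hη : 0 < η) :
    ∃ δ > 0, ∃ N₀ : ℕ, ∀ {k r : ℕ} {s : Fin (k + r) → A} {q : Fin r → B}, N₀ ≤ k + r →
      |(r : ℝ) / (k + r : ℕ) - ρ| ≤ δ → LettersTypical μ δ (k + r) (Sum.map s q) →
      ∀ {m : Fin k → ZMod 2}, m ≠ 0 →
      (codeLaw τ PY pe m s (pb ∘ q)).toOuterMeasure
        {ω | (letterWeight (Sum.elim pe pb) (Sum.map s q) (encodedWord τ pe pb m s q ω.1) ≠ 0 ∧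
            Typical μ w δ (k + r) (Sum.map s q) (encodedWord τ pe pb m s q ω.1)) ∧
          Confusable (Sum.elim pd pb) (decMass PY μ w) (decParam PY μ w) δ (Sum.map ω.2 q) m ω.1
            (encodedWord τ pe pb m s q ω.1)} ≤ ENNReal.ofReal η := by
  classical
  obtain ⟨γ, hγ, δ₁, hδ₁, hconf⟩ := h.exists_uniformProb_confusable_le
  obtain ⟨δ₂, hδ₂, hcard⟩ := exists_card_typical_le (p := Sum.elim pe pb) hμ
    (show ent μ w < Real.log 2 + γ / 4 by linarith)
  obtain ⟨N₀, hN₀⟩ := exists_nat_mul_exp_neg_le 4 (half_pos hγ) hη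
  have hlog : 0 < Real.log 2 := Real.log_pos one_lt_two
  refine ⟨min (min δ₁ δ₂) (γ / 4 / Real.log 2), by positivity, max N₀ 2,
    fun {k r s q} hN hr hl m hm => ?_⟩
  set δ := min (min δ₁ δ₂) (γ / 4 / Real.log 2)
  have hδle₁ : δ ≤ δ₁ := (min_le_left _ _).trans (min_le_left _ _)
  have hδle₂ : δ ≤ δ₂ := (min_le_left _ _).trans (min_le_right _ _)
  obtain ⟨hN', h2⟩ := max_le_iff.1 hN
  set C := Finset.univ.filter fun z => letterWeight (Sum.elim pe pb) (Sum.map s q) z ≠ 0 ∧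
    Typical μ w δ (k + r) (Sum.map s q) z
  have hC : (C.card : ℝ) ≤ Real.exp ((k + r : ℕ) * (Real.log 2 + γ / 4)) :=
    hcard (by omega) (hl.mono hδle₂) (fun z hz => (Finset.mem_filter.1 hz).2.1)
      fun z hz => (Finset.mem_filter.1 hz).2.2.mono hδle₂
  have hnonneg := one_div_nonneg.2 (two_pow_sub_one_mul_two_pow_sub_two_nonneg (k + r))
  refine (toOuterMeasure_bind_map_le _ (encodedWord τ pe pb m s q)
    (fun z => prodPMF fun i => PY (s i) (z (Sum.inl i))) Prod.mk (A := C)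
    (β := ENNReal.ofReal (Real.exp ((k + r : ℕ) * (ρ * Real.log 2 - γ)) *
      (2 ^ k * (1 / ((2 ^ (k + r) - 1) * (2 ^ (k + r) - 2))))))
    (fun H y hy => Finset.mem_filter.2 ⟨Finset.mem_univ _, hy.1⟩) fun z _ y => ?_).trans ?_
  · rw [toOuterMeasure_uniformOfFintype]
    refine ENNReal.ofReal_le_ofReal
      ((uniformProb_mono ?_).trans (hconf (l := Sum.map y q) (by omega) hm z))
    rintro H ⟨rfl, -, ⟨hne, htyp⟩, hlink⟩
    exact ⟨⟨hne, htyp.mono hδle₁⟩, hlink⟩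
  · rw [← ENNReal.ofReal_natCast, ← ENNReal.ofReal_mul (Nat.cast_nonneg _)]
    exact ENNReal.ofReal_le_ofReal <| (mul_le_mul_of_nonneg_right hC (by positivity)).trans <|
      (union_bound_le h2 ((le_div_iff₀ hlog).1 (hr.trans (min_le_right _ _)))).trans (hN₀ _ hN')

theorem exists_codeLaw_decode_ne_or_not_typical_le [Fintype Y] {ρ : ℝ}
    (h : IsUniqueLetterMinimizer (Sum.elim pe pb) (natCost (Sum.elim pe pb)) μ (Real.log 2) w)
    (hμ : ∀ t, 0 < μ t) (hslack : EncoderSlack (Sum.elim pe pb) μ)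
    (hdom : IsDecoderDominant (Sum.elim pd pb) (decMass PY μ w) (ρ * Real.log 2) (decParam PY μ w))
    (hnd : ∀ a b, bitProb (pe a) b ≠ 0 → ∀ y ∈ (PY a b).support, bitProb (pd y) b ≠ 0)
    (τ : TieBreak) {ε η : ℝ} (hε : 0 < ε) (hη : 0 < η) :
    ∃ δ > 0, ∃ N₀ : ℕ, ∀ {k r : ℕ} {s : Fin (k + r) → A} {q : Fin r → B}, N₀ ≤ k + r →
      |(r : ℝ) / (k + r : ℕ) - ρ| ≤ δ → LettersTypical μ δ (k + r) (Sum.map s q) →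
      ∀ {m : Fin k → ZMod 2}, m ≠ 0 →
      (codeLaw τ PY pe m s (pb ∘ q)).toOuterMeasure
        {ω | decode τ pd ω.1 (pb ∘ q) ω.2 ≠ m ∨ ¬ Typical (μ ∘ Sum.inl) (w ∘ Sum.inl) ε (k + r) s
          (encode τ pe ω.1 (pb ∘ q) m s)} ≤ ENNReal.ofReal η := by
  obtain ⟨δ₁, hδ₁, hzero⟩ := hdom.exists_letterWeight_zero_lt
  obtain ⟨δ₂, hδ₂, N₂, hconf⟩ := hdom.exists_codeLaw_confusable_le (pe := pe) hμ
    (h.ent_eq (Real.log_nonneg one_le_two)) τ (half_pos hη)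
  obtain ⟨δ₃, hδ₃, N₃, htyp⟩ := h.exists_codeLaw_not_typical_le hμ hslack τ PY
    (lt_min hε hδ₂) (lt_min hδ₁ hδ₂) (half_pos hη)
  refine ⟨min δ₂ δ₃, lt_min hδ₂ hδ₃, max 1 (max N₂ N₃), fun {k r s q} hN hr hl m hm => ?_⟩
  obtain ⟨hN₁, hN₂, hN₃⟩ : 1 ≤ k + r ∧ N₂ ≤ k + r ∧ N₃ ≤ k + r := by
    simpa only [max_le_iff] using hN
  refine (PMF.toOuterMeasure_mono _ ?_).trans ((MeasureTheory.measure_union_le _ _).trans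
    ((add_le_add (htyp hN₃ (hl.mono (min_le_right _ _)) hm) (hconf hN₂
      (hr.trans (min_le_left _ _)) (hl.mono (min_le_left _ _)) hm)).trans_eq ?_))
  · rintro ⟨H, y⟩ ⟨hbad, hsupp⟩
    refine or_iff_not_imp_left.2 fun hgood => ?_
    obtain ⟨hlink, ⟨hne, hE⟩, hD⟩ := not_not.1 hgood
    refine ⟨⟨hne, hE.mono (min_le_right _ _)⟩, ?_⟩
    rcases hbad with hbad | hbad
    · have hneD := letterWeight_ne_zero_of_mem_support hnd hne (mem_support_of_mem_codeLaw hsupp)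
      obtain ⟨x', hx', hle⟩ := exists_of_decode_ne τ hlink hbad
      refine ⟨⟨hneD, hD.mono (min_le_right _ _)⟩, hlink, x', ?_, hx', hle⟩
      rintro rfl
      rw [withParity_zero] at hle
      exact absurd hle (not_le.2 (hzero (by omega) hneD (hD.mono (min_le_left _ _))))
    · exact absurd (typical_sumMap_iff.1 (hE.mono (min_le_left _ _))).1 hbad
  · rw [← ENNReal.ofReal_add (half_pos hη).le (half_pos hη).le, add_halves]

end RunBound

/-! ### The hypotheses in terms of letters -/

section Expectation

variable {α : Type*} {P : PMF α}

theorem expect_eq_sum (P : PMF α) [Fintype P.support] (f : α → ℝ≥0∞) :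
    expect P f = ∑ a : P.support, P a * f a := by
  rw [expect, ← tsum_fintype (L := .unconditional _),
    tsum_subtype_eq_of_support_subset (f := fun a => P a * f a)]
  exact fun a ha => (PMF.mem_support_iff _ _).2 (left_ne_zero_of_mul ha)

theorem expect_ne_top_iff [Finite P.support] {f : α → ℝ≥0∞} :
    expect P f ≠ ⊤ ↔ ∀ a ∈ P.support, f a ≠ ⊤ := by
  cases nonempty_fintype P.support
  refine ⟨fun hf a ha h => hf (ENNReal.tsum_eq_top_of_eq_top ⟨a, ?_⟩), fun hf => ?_⟩
  · rw [h, ENNReal.mul_top ((PMF.mem_support_iff _ _).1 ha)]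
  · rw [expect_eq_sum]
    exact ENNReal.sum_ne_top.2 fun a _ => ENNReal.mul_ne_top (P.apply_ne_top _) (hf a a.2)

theorem toReal_expect [Fintype P.support] {f : α → ℝ≥0∞} (hf : expect P f ≠ ⊤) :
    (expect P f).toReal = ∑ a : P.support, (P a).toReal * (f a).toReal := by
  rw [expect_eq_sum, ENNReal.toReal_sum fun (a : P.support) _ =>
    ENNReal.mul_ne_top (P.apply_ne_top a) (expect_ne_top_iff.1 hf a a.2)]
  simp only [ENNReal.toReal_mul]

theorem sum_support_toReal (P : PMF α) [Fintype P.support] :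
    ∑ a : P.support, (P a).toReal = 1 := by
  have h : expect P (fun _ => 1) = 1 := by simp [expect]
  simpa [h] using (toReal_expect (P := P) (f := fun _ => 1) (by simp [h])).symm

theorem toReal_toOuterMeasure (P : PMF α) [Fintype P.support] (s : Set α) :
    (P.toOuterMeasure s).toReal =
      ∑ a : P.support, (P a).toReal * s.indicator (fun _ => 1) (a : α) := by
  have h : P.toOuterMeasure s = expect P (s.indicator fun _ => 1) := by
    simp only [PMF.toOuterMeasure_apply, expect, ← Set.indicator_mul_right, mul_one]
  rw [h, toReal_expect (expect_ne_top_iff.2 fun a _ => ?_)]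
  · refine Finset.sum_congr rfl fun a _ => ?_
    by_cases ha : (a : α) ∈ s <;> simp [ha]
  · by_cases ha : a ∈ s <;> simp [ha]

theorem sum_support_mul [Fintype α] (P : PMF α) [Fintype P.support] (g : α → ℝ) :
    ∑ a : P.support, (P a).toReal * g a = ∑ a, (P a).toReal * g a := by
  classical
  rw [← Finset.sum_subtype (Finset.univ.filter (· ∈ P.support)) (by simp)
    fun a => (P a).toReal * g a]
  refine Finset.sum_filter_of_ne fun a _ ha => (PMF.mem_support_iff _ _).2 fun h => ha ?_
  rw [h, ENNReal.toReal_zero, zero_mul]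

end Expectation

section Entropies

theorem crossEntropy_bit (b : ZMod 2) (t : I) :
    crossEntropy (bit b) t = if bitProb t b = 0 then ⊤ else
      ENNReal.ofReal (-Real.log (bitProb t b) / Real.log 2) := by
  have hneg : ∀ u : I, negLog u = if (u : ℝ) = 0 then ⊤ else
      ENNReal.ofReal (-Real.log u / Real.log 2) := fun u => by
    simp only [negLog, Real.logb, neg_div, Subtype.ext_iff, Set.Icc.coe_zero]
  rcases zmod_two_cases b with rfl | rfl
  · have h : bitProb t 0 = (σ t : I) := by simp
    rw [h, ← hneg]
    simp [crossEntropy, bit]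
  · simp [crossEntropy, bit, hneg]

theorem crossEntropy_bit_eq_top_iff {b : ZMod 2} {t : I} :
    crossEntropy (bit b) t = ⊤ ↔ bitProb t b = 0 := by
  rw [crossEntropy_bit]
  split_ifs with h <;> simp [h]

theorem toReal_crossEntropy_bit (b : ZMod 2) (t : I) :
    (crossEntropy (bit b) t).toReal = -Real.log (bitProb t b) / Real.log 2 := by
  rw [crossEntropy_bit]
  split_ifs with h
  · simp [h]
  · exact ENNReal.toReal_ofReal (div_nonneg (neg_nonneg.2 (Real.log_nonpos (bitProb_nonneg t.2 b)
      (bitProb_le_one t.2 b))) (Real.log_pos one_lt_two).le)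

theorem expect_crossEntropy_ne_top_iff {P : PMF (ZMod 2)} {t : I} :
    (expect P fun b => crossEntropy (bit b) t) ≠ ⊤ ↔
      ∀ b, bitProb t b = 0 → bitProb (P 1).toReal b = 0 := by
  classical
  rw [expect_ne_top_iff]
  refine forall_congr' fun b => ?_
  rw [PMF.mem_support_iff, Ne, Ne, crossEntropy_bit_eq_top_iff, not_imp_not,
    ← pmf_toReal_eq_bitProb, ENNReal.toReal_eq_zero_iff, or_iff_left (P.apply_ne_top b)]

theorem toReal_expect_crossEntropy {P : PMF (ZMod 2)} {t : I}
    (h : (expect P fun b => crossEntropy (bit b) t) ≠ ⊤) :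
    (expect P fun b => crossEntropy (bit b) t).toReal =
      (∑ b, bitProb (P 1).toReal b * -Real.log (bitProb t b)) / Real.log 2 := by
  classical
  rw [toReal_expect h, sum_support_mul P fun b => (crossEntropy (bit b) t).toReal, Finset.sum_div]
  refine Finset.sum_congr rfl fun b _ => ?_
  rw [toReal_crossEntropy_bit, pmf_toReal_eq_bitProb, mul_div_assoc]

theorem entropy_eq_binEntropy (P : PMF (ZMod 2)) :
    entropy P = ENNReal.ofReal (Real.binEntropy (P 1).toReal / Real.log 2) := by
  have hlog : 0 < Real.log 2 := Real.log_pos one_lt_two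
  have hterm : ∀ b, 0 ≤ Real.negMulLog (P b).toReal / Real.log 2 := fun b =>
    div_nonneg (Real.negMulLog_nonneg (pmf_toReal_mem_Icc P b).1 (pmf_toReal_mem_Icc P b).2)
      hlog.le
  rw [entropy, sum_zmod_two, ← ENNReal.ofReal_add (hterm 0) (hterm 1),
    Real.binEntropy_eq_negMulLog_add_negMulLog_one_sub, pmf_toReal_eq_bitProb P 0, bitProb_zero,
    ← add_div, add_comm]

/-- The Bernoulli distribution on bits. -/
def bernPMF (θ : I) : PMF (ZMod 2) :=
  PMF.ofFintype (fun b => ENNReal.ofReal (bitProb θ b)) (by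
    rw [← ENNReal.ofReal_sum_of_nonneg fun b _ => bitProb_nonneg θ.2 b, sum_bitProb,
      ENNReal.ofReal_one])

theorem toReal_bernPMF (θ : I) (b : ZMod 2) : (bernPMF θ b).toReal = bitProb θ b :=
  ENNReal.toReal_ofReal (bitProb_nonneg θ.2 b)

variable {α : Type*} {P : PMF α} {W : α → PMF (ZMod 2)} {p : α → I}

theorem condEntropy_ne_top [Finite P.support] : condEntropy P W ≠ ⊤ :=
  expect_ne_top_iff.2 fun a _ => by
    rw [entropy_eq_binEntropy]
    exact ENNReal.ofReal_ne_top

theorem toReal_condEntropy [Fintype P.support] :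
    (condEntropy P W).toReal =
      (∑ a : P.support, (P a).toReal * Real.binEntropy (W a 1).toReal) / Real.log 2 := by
  rw [condEntropy, toReal_expect condEntropy_ne_top, Finset.sum_div]
  refine Finset.sum_congr rfl fun a _ => ?_
  have hW := pmf_toReal_mem_Icc (W a) 1
  rw [entropy_eq_binEntropy, ENNReal.toReal_ofReal (div_nonneg
    (Real.binEntropy_nonneg hW.1 hW.2) (Real.log_pos one_lt_two).le), mul_div_assoc]

theorem expCrossEntropy_ne_top_iff [Finite P.support] :
    expCrossEntropy P W p ≠ ⊤ ↔ ∀ a ∈ P.support, ∀ b, bitProb (p a) b = 0 →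
      bitProb (W a 1).toReal b = 0 := by
  simp only [expCrossEntropy, expect_ne_top_iff (P := P), expect_crossEntropy_ne_top_iff]

theorem toReal_expCrossEntropy [Fintype P.support] (h : expCrossEntropy P W p ≠ ⊤) :
    (expCrossEntropy P W p).toReal = (∑ a : P.support, (P a).toReal *
      ∑ b, bitProb (W a 1).toReal b * -Real.log (bitProb (p a) b)) / Real.log 2 := by
  rw [expCrossEntropy, toReal_expect h, Finset.sum_div]
  refine Finset.sum_congr rfl fun a _ => ?_
  rw [toReal_expect_crossEntropy (expect_ne_top_iff.1 h a a.2), mul_div_assoc]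

end Entropies

section Letters

variable {α : Type*} {R : ℝ} {P : PMF α} {PQ : PMF I} {W : α → PMF (ZMod 2)}
  {U : I → PMF (ZMod 2)} {p : α → I}

/-- The weights of the letters: the values of a random variable with law `P` for the codeword
positions, and the parity biases, scaled by the number `1 - R` of parity bits per codeword bit. -/
def letterMass (R : ℝ) (P : PMF α) (PQ : PMF I) : P.support ⊕ PQ.support → ℝ :=
  Sum.elim (fun a => (P a).toReal) fun t => (1 - R) * (PQ t).toReal

/-- A pair of conditional distributions on bits, as a family of Bernoulli parameters. -/
def letterParam (P : PMF α) (PQ : PMF I) (W : α → PMF (ZMod 2)) (U : I → PMF (ZMod 2)) :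
    P.support ⊕ PQ.support → ℝ :=
  Sum.elim (fun a => (W a 1).toReal) fun t => (U t 1).toReal

/-- The biases of the letters. -/
abbrev letterBias (P : PMF α) (PQ : PMF I) (p : α → I) : P.support ⊕ PQ.support → I :=
  Sum.elim (p ∘ Subtype.val) Subtype.val

theorem toReal_pos_of_mem_support (a : P.support) : 0 < (P a).toReal :=
  ENNReal.toReal_pos ((PMF.mem_support_iff _ _).1 a.2) (P.apply_ne_top _)

theorem letterMass_pos (hR : R < 1) : ∀ t, 0 < letterMass R P PQ t
  | Sum.inl a => toReal_pos_of_mem_support a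
  | Sum.inr t => mul_pos (sub_pos.2 hR) (toReal_pos_of_mem_support t)

theorem letterParam_mem_Icc : ∀ t, letterParam P PQ W U t ∈ Set.Icc (0 : ℝ) 1
  | Sum.inl _ => pmf_toReal_mem_Icc _ _
  | Sum.inr _ => pmf_toReal_mem_Icc _ _

theorem exists_letterParam_eq {w : P.support ⊕ PQ.support → ℝ}
    (hw : ∀ t, w t ∈ Set.Icc (0 : ℝ) 1) : ∃ W U, letterParam P PQ W U = w := by
  lift w to P.support ⊕ PQ.support → I using hw
  refine ⟨bernPMF ∘ Function.extend Subtype.val (w ∘ Sum.inl) 0,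
    bernPMF ∘ Function.extend Subtype.val (w ∘ Sum.inr) 0, ?_⟩
  ext (a | t) <;>
    simp [letterParam, toReal_bernPMF]

theorem ofReal_mul_expCrossEntropy_ne_top_iff (hR : R < 1) :
    ENNReal.ofReal (1 - R) * expCrossEntropy PQ U id ≠ ⊤ ↔ expCrossEntropy PQ U id ≠ ⊤ := by
  simp [ENNReal.mul_eq_top, hR]

theorem encCost_ne_top_iff [Finite P.support] [Finite PQ.support] (hR : R < 1) :
    encCost R P p PQ W U ≠ ⊤ ↔ letterParam P PQ W U ∈ compatible (letterBias P PQ p) := by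
  rw [encCost, ENNReal.add_ne_top, ofReal_mul_expCrossEntropy_ne_top_iff hR,
    expCrossEntropy_ne_top_iff, expCrossEntropy_ne_top_iff]
  simp only [compatible, Set.mem_ofPred_eq, pmf_toReal_mem_Icc, true_and, Sum.forall, letterParam,
    Sum.elim_inl, Sum.elim_inr, Function.comp_apply, Subtype.forall, id]

variable [Fintype P.support] [Fintype PQ.support]

theorem ofReal_le_condEntropy_add_iff (hR : R < 1) {E : ℝ} (hE : 0 ≤ E) :
    ENNReal.ofReal E ≤ condEntropy P W + ENNReal.ofReal (1 - R) * condEntropy PQ U ↔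
      E * Real.log 2 ≤ ent (letterMass R P PQ) (letterParam P PQ W U) := by
  have hU : ENNReal.ofReal (1 - R) * condEntropy PQ U ≠ ⊤ :=
    ENNReal.mul_ne_top ENNReal.ofReal_ne_top condEntropy_ne_top
  rw [← ENNReal.toReal_le_toReal ENNReal.ofReal_ne_top
      (ENNReal.add_ne_top.2 ⟨condEntropy_ne_top, hU⟩),
    ENNReal.toReal_add condEntropy_ne_top hU, ENNReal.toReal_mul, toReal_condEntropy,
    toReal_condEntropy, ENNReal.toReal_ofReal hE, ENNReal.toReal_ofReal (by linarith),
    mul_div_assoc', ← add_div, le_div_iff₀ (Real.log_pos one_lt_two), ent, Fintype.sum_sum_type]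
  simp only [letterMass, letterParam, Sum.elim_inl, Sum.elim_inr, Finset.mul_sum, mul_assoc]

theorem toReal_encCost (hR : R < 1) (h : encCost R P p PQ W U ≠ ⊤) :
    (encCost R P p PQ W U).toReal =
      linCost (natCost (letterBias P PQ p)) (letterMass R P PQ) (letterParam P PQ W U) /
        Real.log 2 := by
  obtain ⟨hW, hU⟩ := ENNReal.add_ne_top.1 h
  rw [encCost, ENNReal.toReal_add hW hU, ENNReal.toReal_mul, toReal_expCrossEntropy hW,
    toReal_expCrossEntropy ((ofReal_mul_expCrossEntropy_ne_top_iff hR).1 hU),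
    ENNReal.toReal_ofReal (by linarith), linCost, Fintype.sum_sum_type, mul_div_assoc', ← add_div]
  simp only [letterMass, letterParam, natCost, Sum.elim_inl, Sum.elim_inr, Function.comp_apply,
    Finset.mul_sum, mul_assoc, id]

end Letters

section Encoder

variable {S : Type*} {R : ℝ} {PS : PMF S} {pe : S → I} {PQ : PMF I} {W : S → PMF (ZMod 2)}
  {U : I → PMF (ZMod 2)}

/-- If the minimum were infinite, every feasible pair would be a minimizer. -/
theorem IsUniqueMinimizer.encCost_ne_top (h : IsUniqueMinimizer R PS pe PQ W U) :
    encCost R PS pe PQ W U ≠ ⊤ := by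
  intro htop
  have hmin : ∀ {W' U'}, EncFeasible R PS PQ W' U' → IsMinimizer R PS pe PQ W' U' :=
    fun hfeas => ⟨hfeas, fun W'' U'' hfeas'' => le_top.trans (htop ▸ h.1.2 W'' U'' hfeas'')⟩
  have hfair : condEntropy PS (fun _ => bernPMF half) = 1 := by
    have hhalf : (half : ℝ) = 2⁻¹ := one_div 2
    have hlog : Real.log 2 ≠ 0 := (Real.log_pos one_lt_two).ne'
    simp [condEntropy, entropy_eq_binEntropy, toReal_bernPMF, hhalf, Real.binEntropy_two_inv, hlog,
      expect]
  have hfeas : ∀ b : ZMod 2, EncFeasible R PS PQ (fun _ => bernPMF half) fun _ => PMF.pure b :=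
    fun b => by
      rw [EncFeasible, hfair]
      exact le_self_add
  obtain ⟨t, ht⟩ := PQ.support_nonempty
  have heq : (PMF.pure 0 : PMF (ZMod 2)) = PMF.pure 1 :=
    ((h.2 _ _ (hmin (hfeas 0))).2 t ht).trans ((h.2 _ _ (hmin (hfeas 1))).2 t ht).symm
  simpa using congrArg (fun Q : PMF (ZMod 2) => Q 1) heq

variable [Fintype PS.support] [Fintype PQ.support]

theorem IsUniqueMinimizer.isUniqueLetterMinimizer (hR : R < 1)
    (h : IsUniqueMinimizer R PS pe PQ W U) :
    IsUniqueLetterMinimizer (letterBias PS PQ pe) (natCost (letterBias PS PQ pe))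
      (letterMass R PS PQ) (Real.log 2) (letterParam PS PQ W U) := by
  have hfeas_iff {W' U'} : EncFeasible R PS PQ W' U' ↔
      Real.log 2 ≤ ent (letterMass R PS PQ) (letterParam PS PQ W' U') := by
    rw [EncFeasible, ← ENNReal.ofReal_one, ofReal_le_condEntropy_add_iff hR zero_le_one, one_mul]
  have hfin := h.encCost_ne_top
  refine ⟨(encCost_ne_top_iff hR).1 hfin, hfeas_iff.1 h.1.1, fun w hw hent hle => ?_⟩
  obtain ⟨W', U', rfl⟩ := exists_letterParam_eq fun t => (hw t).1
  have hfin' : encCost R PS pe PQ W' U' ≠ ⊤ := (encCost_ne_top_iff hR).2 hw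
  have hcost : encCost R PS pe PQ W' U' ≤ encCost R PS pe PQ W U := by
    rw [← ENNReal.toReal_le_toReal hfin' hfin, toReal_encCost hR hfin', toReal_encCost hR hfin]
    exact div_le_div_of_nonneg_right hle (Real.log_pos one_lt_two).le
  obtain ⟨hW, hU⟩ := h.2 W' U'
    ⟨hfeas_iff.2 hent, fun W'' U'' hfeas => hcost.trans (h.1.2 W'' U'' hfeas)⟩
  ext (a | t)
  · simp only [letterParam, Sum.elim_inl, hW a a.2]
  · simp only [letterParam, Sum.elim_inr, hU t t.2]

/-- Fair bits at the letters whose biases lie strictly between `0` and `1`, and forced bits at the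
other letters. -/
def freeParam {T : Type*} (p : T → I) (t : T) : ℝ :=
  open Classical in if p t ∈ Set.Ioo (0 : I) 1 then 2⁻¹ else p t

theorem eq_zero_or_one_of_notMem_Ioo {t : I} (h : t ∉ Set.Ioo (0 : I) 1) : t = 0 ∨ t = 1 := by
  rw [Set.mem_Ioo, unitInterval.pos_iff_ne_zero, unitInterval.lt_one_iff_ne_one] at h
  tauto

theorem freeParam_mem_compatible {T : Type*} (p : T → I) : freeParam p ∈ compatible p := fun t => by
  unfold freeParam
  split_ifs with h
  · exact ⟨by norm_num, fun b hb => absurd hb (bitProb_ne_zero h b)⟩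
  · exact ⟨(p t).2, fun b hb => hb⟩

theorem binEntropy_freeParam {T : Type*} (p : T → I) (t : T) :
    Real.binEntropy (freeParam p t) =
      Real.log 2 * (Set.Ioo (0 : I) 1).indicator (fun _ => 1) (p t) := by
  unfold freeParam
  split_ifs with h
  · rw [Real.binEntropy_two_inv, Set.indicator_of_mem h, mul_one]
  · rw [Set.indicator_of_notMem h, mul_zero]
    rcases eq_zero_or_one_of_notMem_Ioo h with h | h <;> simp [h]

theorem ent_freeParam (R : ℝ) (PS : PMF S) (pe : S → I) (PQ : PMF I) [Fintype PS.support]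
    [Fintype PQ.support] :
    ent (letterMass R PS PQ) (freeParam (letterBias PS PQ pe)) =
      Real.log 2 * ((PS.toOuterMeasure {a | pe a ∈ Set.Ioo (0 : I) 1}).toReal +
        (1 - R) * (PQ.toOuterMeasure (Set.Ioo (0 : I) 1)).toReal) := by
  simp only [ent, binEntropy_freeParam, Fintype.sum_sum_type, letterMass, Sum.elim_inl,
    Sum.elim_inr, toReal_toOuterMeasure, mul_add, Finset.mul_sum]
  congr 1 <;> refine Finset.sum_congr rfl fun _ _ => ?_
  · rw [mul_left_comm]
    rfl
  · ring

theorem toOuterMeasure_ne_top {α : Type*} (P : PMF α) (s : Set α) : P.toOuterMeasure s ≠ ⊤ :=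
  ((toOuterMeasure_le_one P s).trans_lt ENNReal.one_lt_top).ne

theorem EncNondegenerate.encoderSlack (hR : R < 1) (h : EncNondegenerate R PS pe PQ) :
    EncoderSlack (letterBias PS PQ pe) (letterMass R PS PQ) := by
  by_cases hroom : 1 < PS.toOuterMeasure {a | pe a ∈ Set.Ioo (0 : I) 1} +
      ENNReal.ofReal (1 - R) * PQ.toOuterMeasure (Set.Ioo (0 : I) 1)
  · refine Or.inl ⟨_, freeParam_mem_compatible _, ?_⟩
    have hQ := ENNReal.mul_ne_top (a := ENNReal.ofReal (1 - R)) ENNReal.ofReal_ne_top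
      (toOuterMeasure_ne_top PQ (Set.Ioo (0 : I) 1))
    rw [← ENNReal.toReal_lt_toReal ENNReal.one_ne_top
        (ENNReal.add_ne_top.2 ⟨toOuterMeasure_ne_top _ _, hQ⟩),
      ENNReal.toReal_add (toOuterMeasure_ne_top _ _) hQ, ENNReal.toReal_mul,
      ENNReal.toReal_ofReal (by linarith), ENNReal.toReal_one] at hroom
    rw [ent_freeParam]
    exact lt_mul_of_one_lt_right (Real.log_pos one_lt_two) hroom
  · have hfree := h.resolve_right hroom
    refine Or.inr ⟨fun a => hfree a a.2, fun t => eq_zero_or_one_of_notMem_Ioo fun ht => hroom ?_,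
      sum_support_toReal PS⟩
    have hone : PS.toOuterMeasure {a | pe a ∈ Set.Ioo (0 : I) 1} = 1 :=
      (PMF.toOuterMeasure_apply_eq_one_iff _ _).2 fun a ha => hfree a ha
    rw [hone]
    refine ENNReal.lt_add_right ENNReal.one_ne_top (mul_ne_zero (by simpa using hR) ?_)
    rw [Ne, PMF.toOuterMeasure_apply_eq_zero_iff, Set.not_disjoint_iff]
    exact ⟨t, t.2, ht⟩

end Encoder

section Decoder

variable {S Y : Type*} {R : ℝ} {PS : PMF S} {PY : S → ZMod 2 → PMF Y} {pd : Y → I}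
  {PQ : PMF I} {W : S → PMF (ZMod 2)} {U : I → PMF (ZMod 2)}

theorem DecNondegenerate.bitProb_ne_zero {pe : S → I} (h : DecNondegenerate PS PY pe pd)
    {a : S} (ha : a ∈ PS.support) {b : ZMod 2} (hb : bitProb (pe a) b ≠ 0) {y : Y}
    (hy : y ∈ (PY a b).support) : bitProb (pd y) b ≠ 0 := by
  rw [Ne, ← crossEntropy_bit_eq_top_iff] at hb ⊢
  exact h a ha b hb y hy

theorem lawXY_apply (b : ZMod 2) (y : Y) :
    lawXY PS W PY (b, y) = expect PS fun a => W a b * PY a b y := by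
  classical
  rw [lawXY, PMF.bind_apply, expect]
  refine tsum_congr fun a => ?_
  rw [PMF.bind_apply, tsum_eq_single b, PMF.map_apply, tsum_eq_single y]
  · simp
  · exact fun y' hy' => by simp [hy'.symm]
  · exact fun b' hb' => by simp [PMF.map_apply, hb'.symm]

theorem map_snd_lawXY_apply (y : Y) :
    (lawXY PS W PY).map Prod.snd y = ∑ b, lawXY PS W PY (b, y) := by
  classical
  rw [PMF.map_apply, ENNReal.tsum_prod', tsum_fintype]
  simp

theorem expect_of_apply_eq_mul {α β : Type*} {P : PMF (β × α)} {Q : PMF α} {V : α → PMF β}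
    (h : ∀ b a, P (b, a) = Q a * V a b) (f : β × α → ℝ≥0∞) :
    expect P f = expect Q fun a => expect (V a) fun b => f (b, a) := by
  simp only [expect]
  rw [ENNReal.tsum_prod', ENNReal.tsum_comm]
  simp only [h, mul_assoc, ENNReal.tsum_mul_left]

variable [Fintype PS.support]

/-- The weights of the decoder's letters, when the bits have conditional distributions `W` and `U`;
at an output this is its probability. -/
abbrev outputMass (R : ℝ) (PS : PMF S) (PY : S → ZMod 2 → PMF Y) (PQ : PMF I)
    (W : S → PMF (ZMod 2)) (U : I → PMF (ZMod 2)) [Fintype PS.support] : Y ⊕ PQ.support → ℝ :=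
  decMass (fun a : PS.support => PY a) (letterMass R PS PQ) (letterParam PS PQ W U)

/-- The conditional probabilities of a one given the decoder's letters, when the bits have
conditional distributions `W` and `U` given the encoder's letters. -/
abbrev outputParam (R : ℝ) (PS : PMF S) (PY : S → ZMod 2 → PMF Y) (PQ : PMF I)
    (W : S → PMF (ZMod 2)) (U : I → PMF (ZMod 2)) [Fintype PS.support] : Y ⊕ PQ.support → ℝ :=
  decParam (fun a : PS.support => PY a) (letterMass R PS PQ) (letterParam PS PQ W U)

theorem toReal_lawXY (R : ℝ) (PQ : PMF I) (U : I → PMF (ZMod 2)) (b : ZMod 2) (y : Y) :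
    (lawXY PS W PY (b, y)).toReal = outMass (fun a : PS.support => PY a) (letterMass R PS PQ)
      (letterParam PS PQ W U) y b := by
  rw [lawXY_apply, toReal_expect (expect_ne_top_iff.2 fun a _ =>
    ENNReal.mul_ne_top (PMF.apply_ne_top _ _) (PMF.apply_ne_top _ _))]
  simp only [outMass, letterMass, letterParam, Sum.elim_inl, ENNReal.toReal_mul,
    pmf_toReal_eq_bitProb (W _) b]

theorem toReal_map_snd_lawXY (R : ℝ) (PQ : PMF I) (U : I → PMF (ZMod 2)) (y : Y) :
    ((lawXY PS W PY).map Prod.snd y).toReal = outputMass R PS PY PQ W U (Sum.inl y) := by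
  rw [map_snd_lawXY_apply, ENNReal.toReal_sum fun b _ => PMF.apply_ne_top _ _]
  simp only [toReal_lawXY R PQ U, outputMass, decMass, Sum.elim_inl]

theorem exists_posterior (hR : R < 1) (PS : PMF S) [Fintype PS.support] (PY : S → ZMod 2 → PMF Y)
    (PQ : PMF I) (W : S → PMF (ZMod 2)) (U : I → PMF (ZMod 2)) :
    ∃ V : Y → PMF (ZMod 2),
      (∀ b y, lawXY PS W PY (b, y) = (lawXY PS W PY).map Prod.snd y * V y b) ∧
      letterParam ((lawXY PS W PY).map Prod.snd) PQ V U =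
        outputParam R PS PY PQ W U ∘ Sum.map Subtype.val id := by
  have hμ t := (letterMass_pos (P := PS) (PQ := PQ) hR t).le
  have hmem := decParam_mem_Icc (PY := fun a : PS.support => PY a) hμ
    (letterParam_mem_Icc (W := W) (U := U))
  refine ⟨fun y => bernPMF ⟨_, hmem (Sum.inl y)⟩, fun b y => ?_, ?_⟩
  · rw [← ENNReal.toReal_eq_toReal_iff' (PMF.apply_ne_top _ _)
      (ENNReal.mul_ne_top (PMF.apply_ne_top _ _) (PMF.apply_ne_top _ _)), ENNReal.toReal_mul,
      toReal_lawXY R PQ U, toReal_map_snd_lawXY R PQ U, toReal_bernPMF,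
      decMass_mul_bitProb_decParam_inl hμ letterParam_mem_Icc]
  · ext (y | t)
    · exact (toReal_bernPMF _ 1).trans (bitProb_one _)
    · rfl

variable [Fintype Y] [Fintype PQ.support]

theorem sum_letterMass_map_snd_lawXY [Fintype ((lawXY PS W PY).map Prod.snd).support]
    (R : ℝ) (U : I → PMF (ZMod 2)) (g : Y ⊕ PQ.support → ℝ) :
    ∑ t, letterMass R ((lawXY PS W PY).map Prod.snd) PQ t * g (Sum.map Subtype.val id t) =
      ∑ t, outputMass R PS PY PQ W U t * g t := by
  rw [Fintype.sum_sum_type, Fintype.sum_sum_type]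
  congr 1
  refine (sum_support_mul _ fun y => g (Sum.inl y)).trans ?_
  simp only [toReal_map_snd_lawXY R PQ U]

theorem DecoderInequality.linCost_outputParam_lt (hR : R < 1)
    (h : DecoderInequality R PS PY pd PQ W U) {w : Y ⊕ PQ.support → ℝ}
    (hw : w ∘ Sum.map Subtype.val id ∈ compatible (letterBias ((lawXY PS W PY).map Prod.snd) PQ pd))
    (hent : (1 - R) * Real.log 2 ≤ ent (outputMass R PS PY PQ W U) w) :
    linCost (natCost (Sum.elim pd Subtype.val)) (outputMass R PS PY PQ W U)
        (outputParam R PS PY PQ W U) <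
      linCost (natCost (Sum.elim pd Subtype.val)) (outputMass R PS PY PQ W U) w := by
  classical
  let P := (lawXY PS W PY).map Prod.snd
  have : Fintype P.support := Fintype.ofFinite _
  obtain ⟨V, hV, hVU⟩ := exists_posterior hR PS PY PQ W U
  obtain ⟨W', U', hWU⟩ := exists_letterParam_eq fun t => (hw t).1
  have hlin (v : Y ⊕ PQ.support → ℝ) :
      linCost (natCost (letterBias P PQ pd)) (letterMass R P PQ) (v ∘ Sum.map Subtype.val id) =
        linCost (natCost (Sum.elim pd Subtype.val)) (outputMass R PS PY PQ W U) v := by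
    refine Eq.trans (Finset.sum_congr rfl ?_) (sum_letterMass_map_snd_lawXY R U _)
    rintro (y | t) - <;> rfl
  have hfeas : ENNReal.ofReal (1 - R) ≤
      condEntropy P W' + ENNReal.ofReal (1 - R) * condEntropy PQ U' := by
    rw [ofReal_le_condEntropy_add_iff hR (sub_pos.2 hR).le, hWU]
    exact hent.trans_eq (sum_letterMass_map_snd_lawXY R U _).symm
  have hlt : encCost R P pd PQ V U < encCost R P pd PQ W' U' := by
    have hlt := h W' U' hfeas
    rwa [expect_of_apply_eq_mul hV] at hlt
  have hfin := hlt.ne_top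
  have hfin' : encCost R P pd PQ W' U' ≠ ⊤ := (encCost_ne_top_iff hR).2 (hWU ▸ hw)
  rwa [← ENNReal.toReal_lt_toReal hfin hfin', toReal_encCost hR hfin, toReal_encCost hR hfin',
    div_lt_div_iff_of_pos_right (Real.log_pos one_lt_two), hVU, hWU, hlin, hlin] at hlt

end Decoder

section Symmetry

variable {PQ : PMF I}

theorem apply_symm_of_map_symm_eq (h : PQ.map σ = PQ) (t : I) : PQ (σ t) = PQ t := by
  classical
  conv_lhs => rw [← h]
  rw [PMF.map_apply, tsum_eq_single t, if_pos rfl]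
  exact fun t' ht' => if_neg fun h => ht' (unitInterval.symm_bijective.1 h.symm)

theorem symm_mem_support_iff (h : PQ.map σ = PQ) {t : I} : σ t ∈ PQ.support ↔ t ∈ PQ.support := by
  rw [PMF.mem_support_iff, PMF.mem_support_iff, apply_symm_of_map_symm_eq h]

theorem sum_support_mul_symm [Fintype PQ.support] (h : PQ.map σ = PQ) (f : I → ℝ) :
    ∑ t : PQ.support, (PQ t).toReal * f (σ t) = ∑ t : PQ.support, (PQ t).toReal * f t := by
  let e : PQ.support ≃ PQ.support :=
    { toFun := fun t => ⟨σ t, (symm_mem_support_iff h).2 t.2⟩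
      invFun := fun t => ⟨σ t, (symm_mem_support_iff h).2 t.2⟩
      left_inv := fun _ => Subtype.ext (unitInterval.symm_symm _)
      right_inv := fun _ => Subtype.ext (unitInterval.symm_symm _) }
  refine Fintype.sum_equiv e _ _ fun t => ?_
  rw [← apply_symm_of_map_symm_eq h]
  rfl

variable {S Y : Type*} [Fintype Y] {R : ℝ} {PS : PMF S} {PY : S → ZMod 2 → PMF Y} {pd : Y → I}
  {W : S → PMF (ZMod 2)} {U : I → PMF (ZMod 2)} [Fintype PS.support] [Fintype PQ.support]

theorem linCost_fair_parity_eq (h : PQ.map σ = PQ) :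
    linCost (natCost (Sum.elim pd Subtype.val)) (outputMass R PS PY PQ W U)
        (Sum.elim 0 fun _ => 2⁻¹) =
      linCost (natCost (Sum.elim pd Subtype.val)) (outputMass R PS PY PQ W U) 0 := by
  have hswap := sum_support_mul_symm h fun t => -Real.log (bitProb t 0)
  simp only [linCost_eq, Fintype.sum_sum_type]
  congr 1
  simp only [outputMass, decMass, letterMass, natCost, Sum.elim_inr, mul_assoc, ← Finset.mul_sum,
    Pi.zero_apply, zero_mul, zero_add, sub_zero, one_mul]
  congr 1
  simp only [bitProb_zero, unitInterval.coe_symm_eq, sub_sub_cancel] at hswap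
  simp only [bitProb_zero, bitProb_one, mul_add, mul_left_comm _ (2⁻¹ : ℝ),
    mul_left_comm _ (1 - 2⁻¹ : ℝ), Finset.sum_add_distrib, ← Finset.mul_sum, hswap]
  ring

theorem DecoderInequality.linCost_outputParam_lt_zero (hR : R < 1)
    (h : DecoderInequality R PS PY pd PQ W U) (hsymm : PQ.map σ = PQ)
    (hbias : ∀ t, 0 < outputMass R PS PY PQ W U t → (Sum.elim pd Subtype.val t : I) ≠ 1) :
    linCost (natCost (Sum.elim pd Subtype.val)) (outputMass R PS PY PQ W U)
        (outputParam R PS PY PQ W U) <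
      linCost (natCost (Sum.elim pd Subtype.val)) (outputMass R PS PY PQ W U) 0 := by
  have hne_one (t : PQ.support) : (t : I) ≠ 1 :=
    hbias (Sum.inr t) (letterMass_pos (P := PS) hR (Sum.inr t))
  have hne_zero (t : PQ.support) : (t : I) ≠ 0 := fun ht =>
    hne_one ⟨σ t, (symm_mem_support_iff hsymm).2 t.2⟩ (by simp [ht])
  refine (h.linCost_outputParam_lt (w := Sum.elim 0 fun _ => 2⁻¹) hR ?_ ?_).trans_eq
    (linCost_fair_parity_eq hsymm)
  · rintro (y | t)
    · have hy : (pd y : I) ≠ 1 := hbias (Sum.inl y) <| by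
        rw [← toReal_map_snd_lawXY R PQ U]
        exact toReal_pos_of_mem_support y
      refine ⟨by simp, fun b hb => ?_⟩
      rcases zmod_two_cases b with rfl | rfl
      · exact absurd (Subtype.ext (sub_eq_zero.1 ((bitProb_zero _).symm.trans hb)).symm) hy
      · exact bitProb_one _
    · refine ⟨by norm_num [Sum.map], fun b hb => absurd hb (bitProb_ne_zero ?_ b)⟩
      exact ⟨unitInterval.pos_iff_ne_zero.2 (hne_zero t),
        unitInterval.lt_one_iff_ne_one.2 (hne_one t)⟩
  · rw [ent, Fintype.sum_sum_type]
    simp only [Sum.elim_inl, Sum.elim_inr, Pi.zero_apply, Real.binEntropy_zero, mul_zero,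
      Finset.sum_const_zero, zero_add, Real.binEntropy_two_inv, outputMass, decMass, letterMass]
    rw [← Finset.sum_mul, ← Finset.mul_sum, sum_support_toReal, mul_one]

theorem DecoderInequality.isDecoderDominant (hR : R < 1)
    (h : DecoderInequality R PS PY pd PQ W U) (hsymm : PQ.map σ = PQ) :
    IsDecoderDominant (Sum.elim pd Subtype.val) (outputMass R PS PY PQ W U)
      ((1 - R) * Real.log 2) (outputParam R PS PY PQ W U) :=
  ⟨fun w hw => h.linCost_outputParam_lt hR <| by
    rintro (y | t)
    exacts [hw (Sum.inl y), hw (Sum.inr t)], h.linCost_outputParam_lt_zero hR hsymm⟩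

end Symmetry

/-! ### Averaging over the message, the states and the parity biases -/

section Letters

theorem letterCount_comp_of_injective {ι T T' : Type*} [Fintype ι] {f : T → T'}
    (hf : f.Injective) (l : ι → T) (t : T) : letterCount (f ∘ l) (f t) = letterCount l t := by
  classical
  simp only [letterCount, Function.comp_apply, hf.eq_iff]

variable {ι κ A B : Type*} [Fintype ι] [Fintype κ]

theorem letterCount_map_inl (s : ι → A) (q : κ → B) (a : A) :
    letterCount (Sum.map s q) (Sum.inl a) = letterCount s a := by
  classical
  simp only [letterCount, Finset.card_filter, Fintype.sum_sum_type, Sum.map_inl, Sum.map_inr,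
    Sum.inl.injEq, reduceCtorEq, if_false, Finset.sum_const_zero, add_zero]

theorem letterCount_map_inr (s : ι → A) (q : κ → B) (t : B) :
    letterCount (Sum.map s q) (Sum.inr t) = letterCount q t := by
  classical
  simp only [letterCount, Finset.card_filter, Fintype.sum_sum_type, Sum.map_inl, Sum.map_inr,
    Sum.inr.injEq, reduceCtorEq, if_false, Finset.sum_const_zero, zero_add]

end Letters

section IndependentLetters

variable {α : Type*}

theorem mem_support_of_mem_support_prodPMF {n : ℕ} {P : Fin n → PMF α} {a : Fin n → α}
    (h : a ∈ (prodPMF P).support) (i : Fin n) : a i ∈ (P i).support := by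
  rw [PMF.mem_support_iff, prodPMF_apply] at h
  exact (PMF.mem_support_iff _ _).2 (Finset.prod_ne_zero_iff.1 h i (Finset.mem_univ _))

theorem prodPMF_letterCount_deviation_le (P : PMF α) [Fintype P.support] (n : ℕ) {c : ℝ}
    (hc : 0 < c) :
    (prodPMF fun _ : Fin n => P).toOuterMeasure
        {a | ∃ t : P.support, c ≤ |(letterCount a (t : α) : ℝ) - n * (P t).toReal|} ≤
      ENNReal.ofReal (Fintype.card P.support * (n / c ^ 2)) := by
  classical
  rw [Set.ofPred_exists]
  refine (MeasureTheory.measure_iUnion_le _).trans ?_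
  rw [tsum_fintype, ENNReal.ofReal_mul (Nat.cast_nonneg _), ENNReal.ofReal_natCast,
    ← Finset.card_univ, ← nsmul_eq_mul, ← Finset.sum_const]
  refine Finset.sum_le_sum fun t _ => ?_
  simpa [letterCount, PMF.toOuterMeasure_apply_singleton] using
    prodPMF_deviation_le (fun _ : Fin n => P) (fun _ => {(t : α)}) hc

variable {R δ : ℝ} {P : PMF α} {PQ : PMF I} {k r : ℕ}

theorem lettersTypical_map {s : Fin (k + r) → P.support} {q : Fin r → PQ.support}
    (hN : 0 < k + r) (hr : |(r : ℝ) / (k + r : ℕ) - (1 - R)| ≤ δ / 2)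
    (hs : ∀ a, |(letterCount s a : ℝ) - (k + r : ℕ) * (P a).toReal| ≤ δ / 2 * (k + r : ℕ))
    (hq : ∀ t, |(letterCount q t : ℝ) - r * (PQ t).toReal| ≤ δ / 2 * (k + r : ℕ)) :
    LettersTypical (letterMass R P PQ) δ (k + r) (Sum.map s q) := by
  have hN' : (0 : ℝ) < (k + r : ℕ) := by exact_mod_cast hN
  have hδ : 0 ≤ δ / 2 := (abs_nonneg _).trans hr
  rintro (a | t)
  · rw [letterCount_map_inl, letterMass, Sum.elim_inl, div_sub' hN'.ne', abs_div,
      abs_of_pos hN', div_le_iff₀ hN']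
    exact (hs a).trans (by gcongr; linarith)
  · obtain ⟨hP0, hP1⟩ := pmf_toReal_mem_Icc PQ (t : I)
    have hcount : |(letterCount q t : ℝ) / (k + r : ℕ) - r / (k + r : ℕ) * (PQ t).toReal| ≤
        δ / 2 := by
      rw [div_mul_eq_mul_div, ← sub_div, abs_div, abs_of_pos hN', div_le_iff₀ hN']
      exact hq t
    have hrate : |(r : ℝ) / (k + r : ℕ) * (PQ t).toReal - (1 - R) * (PQ t).toReal| ≤ δ / 2 := by
      rw [← sub_mul, abs_mul, abs_of_nonneg hP0]
      exact (mul_le_of_le_one_right (abs_nonneg _) hP1).trans hr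
    rw [letterCount_map_inr]
    exact (abs_sub_le _ _ _).trans ((add_le_add hcount hrate).trans_eq (add_halves δ))

end IndependentLetters

section RunLaw

variable {S Y : Type*}

/-- The run with the given message, states, parity biases, matrix and outputs. -/
def runOf (τ : TieBreak) (pe : S → I) {k r : ℕ} (m : Fin k → ZMod 2) (s : Fin (k + r) → S)
    (q : Fin r → I) (ω : GL (Fin (k + r)) (ZMod 2) × (Fin (k + r) → Y)) : Run S Y k r where
  message := m
  state := s
  parityBias := q
  matrix := ω.1
  codeword := encode τ pe ω.1 q m s
  output := ω.2

theorem runLaw_eq_bind_codeLaw (τ : TieBreak) (PS : PMF S) (PY : S → ZMod 2 → PMF Y)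
    (pe : S → I) (PQ : PMF I) (k r : ℕ) :
    runLaw τ PS PY pe PQ k r =
      (PMF.uniformOfFintype (Fin k → ZMod 2)).bind fun m =>
      (prodPMF fun _ : Fin (k + r) => PS).bind fun s =>
      (prodPMF fun _ : Fin r => PQ).bind fun q =>
      (codeLaw τ PY pe m s q).map (runOf τ pe m s q) := by
  simp only [codeLaw, PMF.map_bind, PMF.map_comp]
  rfl

theorem uniformOfFintype_toOuterMeasure_zero (k : ℕ) :
    (PMF.uniformOfFintype (Fin k → ZMod 2)).toOuterMeasure {0} = ENNReal.ofReal (2⁻¹ ^ k) := by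
  rw [PMF.toOuterMeasure_apply_singleton, PMF.uniformOfFintype_apply, ENNReal.ofReal_pow (by simp),
    Fintype.card_fun, ZMod.card, Fintype.card_fin, ENNReal.ofReal_inv_of_pos two_pos]
  simp [ENNReal.inv_pow]

variable {R : ℝ} {τ : TieBreak} {PS : PMF S} {PY : S → ZMod 2 → PMF Y} {pe : S → I} {PQ : PMF I}
  [Fintype PS.support] [Fintype PQ.support]

theorem runLaw_toOuterMeasure_le {k r : ℕ} (hN : 0 < k + r) {E : Set (Run S Y k r)} {δ : ℝ}
    {η : ℝ≥0∞} (hδ : 0 < δ) (hr : |(r : ℝ) / (k + r : ℕ) - (1 - R)| ≤ δ / 2)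
    (h : ∀ {s : Fin (k + r) → PS.support} {q : Fin r → PQ.support},
      LettersTypical (letterMass R PS PQ) δ (k + r) (Sum.map s q) → ∀ {m}, m ≠ 0 →
        (codeLaw τ PY pe m (Subtype.val ∘ s) (Subtype.val ∘ q)).toOuterMeasure
          (runOf τ pe m (Subtype.val ∘ s) (Subtype.val ∘ q) ⁻¹' E) ≤ η) :
    (runLaw τ PS PY pe PQ k r).toOuterMeasure E ≤ ENNReal.ofReal (2⁻¹ ^ k) +
      (ENNReal.ofReal (Fintype.card PS.support * ((k + r : ℕ) / (δ / 2 * (k + r : ℕ)) ^ 2)) +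
        (ENNReal.ofReal (Fintype.card PQ.support * (r / (δ / 2 * (k + r : ℕ)) ^ 2)) + η)) := by
  have hc : 0 < δ / 2 * (k + r : ℕ) := mul_pos (half_pos hδ) (by exact_mod_cast hN)
  rw [runLaw_eq_bind_codeLaw, ← uniformOfFintype_toOuterMeasure_zero]
  refine toOuterMeasure_bind_le _ _ fun m _ hm => ?_
  refine (toOuterMeasure_bind_le _ _ fun s hs hs' => ?_).trans
    (add_le_add_left (prodPMF_letterCount_deviation_le PS (k + r) hc) _)
  refine (toOuterMeasure_bind_le _ _ fun q hq hq' => ?_).trans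
    (add_le_add_left (prodPMF_letterCount_deviation_le PQ r hc) _)
  lift s to Fin (k + r) → PS.support using mem_support_of_mem_support_prodPMF hs
  lift q to Fin r → PQ.support using mem_support_of_mem_support_prodPMF hq
  simp only [Set.mem_ofPred_eq, not_exists, not_le] at hs' hq'
  rw [PMF.toOuterMeasure_map_apply]
  refine h (lettersTypical_map hN hr (fun a => ?_) fun t => ?_) hm
  · rw [← letterCount_comp_of_injective Subtype.val_injective s a]
    exact (hs' a).le
  · rw [← letterCount_comp_of_injective Subtype.val_injective q t]
    exact (hq' t).le

end RunLaw

section Limit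

theorem floor_mul_le {R : ℝ} (hR : R ≤ 1) (n : ℕ) : ⌊(n : ℝ) * R⌋₊ ≤ n :=
  Nat.floor_le_of_le (mul_le_of_le_one_right (Nat.cast_nonneg n) hR)

theorem tendsto_sub_floor_mul_div {R : ℝ} (hR0 : 0 ≤ R) (hR1 : R ≤ 1) :
    Filter.Tendsto (fun n : ℕ => ((n - ⌊(n : ℝ) * R⌋₊ : ℕ) : ℝ) / n) Filter.atTop
      (𝓝 (1 - R)) := by
  have h := (tendsto_nat_floor_mul_div_atTop hR0).comp (tendsto_natCast_atTop_atTop (R := ℝ))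
  refine (h.const_sub 1).congr' ?_
  filter_upwards [Filter.eventually_ne_atTop 0] with n hn
  rw [Nat.cast_sub (floor_mul_le hR1 n), Function.comp_apply, mul_comm R, sub_div,
    div_self (by exact_mod_cast hn)]

theorem tendsto_const_mul_div_sq (K c : ℝ) :
    Filter.Tendsto (fun n : ℕ => K * ((n : ℝ) / (c * n) ^ 2)) Filter.atTop (𝓝 0) := by
  have h : Filter.Tendsto (fun n : ℕ => K / c ^ 2 * ((n : ℝ))⁻¹) Filter.atTop (𝓝 0) := by
    simpa using tendsto_inv_atTop_nhds_zero_nat (𝕜 := ℝ).const_mul (K / c ^ 2)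
  refine h.congr' ?_
  filter_upwards [Filter.eventually_ne_atTop 0] with n hn
  have hn' : (n : ℝ) ≠ 0 := by exact_mod_cast hn
  rw [mul_pow, div_mul_eq_div_div_swap]
  field_simp

variable {S Y : Type*} {R : ℝ} {τ : TieBreak} {PS : PMF S} {PY : S → ZMod 2 → PMF Y}
  {pe : S → I} {PQ : PMF I} {W : S → PMF (ZMod 2)} {U : I → PMF (ZMod 2)}

theorem tendsto_runLaw_toOuterMeasure_zero [Finite PS.support] [Finite PQ.support]
    (hR0 : 0 < R) (hR1 : R < 1) (E : ∀ k r, Set (Run S Y k r))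
    (h : ∀ {η : ℝ}, 0 < η → ∃ δ > 0, ∃ N₀ : ℕ, ∀ {k r : ℕ} {s : Fin (k + r) → PS.support}
      {q : Fin r → PQ.support}, N₀ ≤ k + r → |(r : ℝ) / (k + r : ℕ) - (1 - R)| ≤ δ →
      LettersTypical (letterMass R PS PQ) δ (k + r) (Sum.map s q) → ∀ {m}, m ≠ 0 →
        (codeLaw τ PY pe m (Subtype.val ∘ s) (Subtype.val ∘ q)).toOuterMeasure
          (runOf τ pe m (Subtype.val ∘ s) (Subtype.val ∘ q) ⁻¹' E k r) ≤ ENNReal.ofReal η) :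
    Filter.Tendsto (fun n : ℕ => (runLaw τ PS PY pe PQ ⌊(n : ℝ) * R⌋₊
      (n - ⌊(n : ℝ) * R⌋₊)).toOuterMeasure (E ⌊(n : ℝ) * R⌋₊ (n - ⌊(n : ℝ) * R⌋₊)))
      Filter.atTop (𝓝 0) := by
  cases nonempty_fintype PS.support
  cases nonempty_fintype PQ.support
  rw [ENNReal.tendsto_nhds_zero]
  intro ε hε
  obtain ⟨η, hη, hηε⟩ := ENNReal.lt_iff_exists_nnreal_btwn.1
    (ENNReal.div_pos hε.ne' (ENNReal.ofNat_ne_top (n := 4)))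
  rw [ENNReal.coe_pos] at hη
  have hη' : (0 : ℝ) < η := hη
  obtain ⟨δ, hδ, N₀, hbound⟩ := h hη'
  have hpow : Filter.Tendsto (fun n : ℕ => (2⁻¹ : ℝ) ^ ⌊(n : ℝ) * R⌋₊) Filter.atTop (𝓝 0) :=
    (tendsto_pow_atTop_nhds_zero_of_lt_one (by norm_num) (by norm_num)).comp
      (tendsto_nat_floor_atTop.comp (tendsto_natCast_atTop_atTop.atTop_mul_const hR0))
  filter_upwards [hpow.eventually_le_const hη',
    (tendsto_const_mul_div_sq (Fintype.card PS.support) (δ / 2)).eventually_le_const hη',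
    (tendsto_const_mul_div_sq (Fintype.card PQ.support) (δ / 2)).eventually_le_const hη',
    (tendsto_sub_floor_mul_div hR0.le hR1.le).eventually
      (Metric.closedBall_mem_nhds _ (half_pos hδ)),
    Filter.eventually_gt_atTop 0, Filter.eventually_ge_atTop N₀] with n hm hs hq hr hn hN₀
  have hkr : ⌊(n : ℝ) * R⌋₊ + (n - ⌊(n : ℝ) * R⌋₊) = n :=
    Nat.add_sub_cancel' (floor_mul_le hR1.le n)
  generalize ⌊(n : ℝ) * R⌋₊ = k at *
  generalize n - k = r at *
  subst hkr
  refine (runLaw_toOuterMeasure_le hn hδ hr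
    (hbound hN₀ (hr.trans (half_le_self hδ.le)))).trans ?_
  have hq' : (Fintype.card PQ.support : ℝ) * (r / (δ / 2 * (k + r : ℕ)) ^ 2) ≤ η := by
    refine le_trans ?_ hq
    gcongr
    exact Nat.le_add_left r k
  calc _ ≤ ENNReal.ofReal η + (ENNReal.ofReal η + (ENNReal.ofReal η + ENNReal.ofReal η)) := by
        gcongr
    _ = 4 * η := by
        rw [ENNReal.ofReal_coe_nnreal]
        ring
    _ ≤ ε := ENNReal.mul_le_of_le_div' hηε.le

theorem abs_empirical_sub_le_of_typical {δ : ℝ} (hδ : 0 ≤ δ) {n : ℕ} {s : Fin n → PS.support}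
    {x : Fin n → ZMod 2}
    (h : Typical (letterMass R PS PQ ∘ Sum.inl) (letterParam PS PQ W U ∘ Sum.inl) δ n s x)
    (a : S) (b : ZMod 2) :
    |empirical (Subtype.val ∘ s) x a b - (PS a * W a b).toReal| ≤ δ := by
  classical
  by_cases ha : a ∈ PS.support
  · have hcount : empirical (Subtype.val ∘ s) x a b = bitCount s ⟨a, ha⟩ b x / n := by
      simp only [empirical, bitCount, Function.comp_apply, Subtype.ext_iff]
    rw [hcount, ENNReal.toReal_mul, pmf_toReal_eq_bitProb (W a)]
    exact h ⟨a, ha⟩ b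
  · have hs : ∀ i, (s i : S) ≠ a := fun i hi => ha (hi ▸ (s i).2)
    rw [(PMF.apply_eq_zero_iff _ _).2 ha]
    simpa [empirical, hs] using hδ

/-- The runs that end with a decoding error, or whose states and codeword have an empirical
distribution at distance at least `ε` from `P_S P_{X|S}`. -/
def badRuns (τ : TieBreak) (pd : Y → I) (PS : PMF S) (W : S → PMF (ZMod 2)) (ε : ℝ) (k r : ℕ) :
    Set (Run S Y k r) :=
  {ω | decode τ pd ω.matrix ω.parityBias ω.output ≠ ω.message} ∪
    {ω | ∃ (a : S) (b : ZMod 2),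
      ε ≤ |empirical ω.state ω.codeword a b - (PS a * W a b).toReal|}

theorem tendsto_runLaw_badRuns [Finite Y] (hSfin : PS.support.Finite)
    (hQfin : PQ.support.Finite) (hR0 : 0 < R) (hR1 : R < 1) {pd : Y → I}
    (hQsymm : PQ.map σ = PQ) (hpe : EncNondegenerate R PS pe PQ)
    (hpd : DecNondegenerate PS PY pe pd) (hmin : IsUniqueMinimizer R PS pe PQ W U)
    (hdec : DecoderInequality R PS PY pd PQ W U) (τ : TieBreak) {ε : ℝ} (hε : 0 < ε) :
    Filter.Tendsto (fun n : ℕ => (runLaw τ PS PY pe PQ ⌊(n : ℝ) * R⌋₊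
      (n - ⌊(n : ℝ) * R⌋₊)).toOuterMeasure
        (badRuns τ pd PS W ε ⌊(n : ℝ) * R⌋₊ (n - ⌊(n : ℝ) * R⌋₊)))
      Filter.atTop (𝓝 0) := by
  have := hSfin.fintype
  have := hQfin.fintype
  cases nonempty_fintype Y
  refine tendsto_runLaw_toOuterMeasure_zero hR0 hR1 (badRuns τ pd PS W ε) fun {η} hη => ?_
  obtain ⟨δ, hδ, N₀, hbound⟩ := exists_codeLaw_decode_ne_or_not_typical_le
    (PY := fun a : PS.support => PY a)
    (hmin.isUniqueLetterMinimizer hR1) (letterMass_pos hR1) (hpe.encoderSlack hR1)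
    (hdec.isDecoderDominant hR1 hQsymm) (fun a b => hpd.bitProb_ne_zero a.2) τ (half_pos hε) hη
  refine ⟨δ, hδ, N₀, fun hN hr hl _ hm => (PMF.toOuterMeasure_mono _ ?_).trans
    (hbound hN hr hl hm)⟩
  rintro ω ⟨hne | ⟨a, b, hab⟩, -⟩
  · exact Or.inl hne
  · exact Or.inr fun htyp => (half_lt_self hε).not_ge
      (hab.trans (abs_empirical_sub_le_of_typical (half_pos hε).le htyp a b))

end Limit

end

end WPC

theorem mainTheorem1_general {S Y : Type*} [Finite Y]
    (R : ℝ) (hR0 : 0 < R) (hR1 : R < 1)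
    (PS : PMF S) (hSfin : PS.support.Finite) (PY : S → ZMod 2 → PMF Y)
    (pe : S → unitInterval) (pd : Y → unitInterval)
    (PQ : PMF unitInterval) (hQfin : PQ.support.Finite)
    (hQsymm : PQ.map unitInterval.symm = PQ)
    (hpe : WPC.EncNondegenerate R PS pe PQ) (hpd : WPC.DecNondegenerate PS PY pe pd)
    (W : S → PMF (ZMod 2)) (U : unitInterval → PMF (ZMod 2))
    (hmin : WPC.IsUniqueMinimizer R PS pe PQ W U)
    (hdec : WPC.DecoderInequality R PS PY pd PQ W U)
    (τ : WPC.TieBreak) :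
    Filter.Tendsto
        (fun n : ℕ => WPC.errorProb τ PS PY pe pd PQ ⌊(n : ℝ) * R⌋₊ (n - ⌊(n : ℝ) * R⌋₊))
        Filter.atTop (𝓝 0) ∧
      ∀ ε : ℝ, 0 < ε →
        Filter.Tendsto
          (fun n : ℕ => WPC.deviationProb τ PS PY pe PQ W ε ⌊(n : ℝ) * R⌋₊ (n - ⌊(n : ℝ) * R⌋₊))
          Filter.atTop (𝓝 0) := by
  have hbad {ε : ℝ} (hε : 0 < ε) := WPC.tendsto_runLaw_badRuns hSfin hQfin hR0 hR1 hQsymm hpe hpd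
    hmin hdec τ hε
  refine ⟨?_, fun ε hε => ?_⟩
  · exact tendsto_of_tendsto_of_tendsto_of_le_of_le tendsto_const_nhds (hbad one_pos)
      (fun _ => zero_le) fun _ => MeasureTheory.measure_mono Set.subset_union_left
  · exact tendsto_of_tendsto_of_tendsto_of_le_of_le tendsto_const_nhds (hbad hε)
      (fun _ => zero_le) fun _ => MeasureTheory.measure_mono Set.subset_union_right

theorem mainTheorem1 {S Y : Type*} [Finite S] [Finite Y]
    (R : ℝ) (hR0 : 0 < R) (hR1 : R < 1)
    (PS : PMF S) (PY : S → ZMod 2 → PMF Y)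
    (pe : S → unitInterval) (pd : Y → unitInterval)
    (PQ : PMF unitInterval) (hQfin : PQ.support.Finite)
    (hQsymm : PQ.map unitInterval.symm = PQ)
    (hpe : WPC.EncNondegenerate R PS pe PQ) (hpd : WPC.DecNondegenerate PS PY pe pd)
    (W : S → PMF (ZMod 2)) (U : unitInterval → PMF (ZMod 2))
    (hmin : WPC.IsUniqueMinimizer R PS pe PQ W U)
    (hdec : WPC.DecoderInequality R PS PY pd PQ W U)
    (τ : WPC.TieBreak) :
    Filter.Tendsto
        (fun n : ℕ => WPC.errorProb τ PS PY pe pd PQ ⌊(n : ℝ) * R⌋₊ (n - ⌊(n : ℝ) * R⌋₊))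
        Filter.atTop (𝓝 0) ∧
      ∀ ε : ℝ, 0 < ε →
        Filter.Tendsto
          (fun n : ℕ => WPC.deviationProb τ PS PY pe PQ W ε ⌊(n : ℝ) * R⌋₊ (n - ⌊(n : ℝ) * R⌋₊))
          Filter.atTop (𝓝 0) :=
  mainTheorem1_general R hR0 hR1 PS (Set.toFinite _) PY pe pd PQ hQfin hQsymm hpe hpd W U hmin
    hdec τ
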